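/- **Theorem (Linear reservoir embeddings).** Let $M$ be a compact Hausdorff smooth manifold (without boundary) of dimension $q$, and let $\phi\in\mathrm{Diff}^2(M)$ be a $C^2$ diffeomorphism with finitely many periodic orbits. Suppose that for each periodic point $m$ of $\phi$ with (minimal) period $n$ the linear map $T_m\phi^{-n}:T_mM\to T_mM$ has $q$ distinct (complex) eigenvalues. Let $\ell$ be the least common multiple of the periods of the periodic points of $\phi$ (with $\ell=1$ if there are none), and let $N>\max\{2q,\ell\}$. Let $\overline A$ be a random real $N\times N$ matrix and $\overline{\mathbf C}$ a random vector in $\mathbb R^N$, defined on a probability space $(\Omega,\mathcal F,\mathbb P)$, whose $N^2+N$ entries are jointly independent real random variables, each of them regular, i.e. $\mathbb P(X=x)=0$ for every entry $X$ and every $x\in\mathbb R$ (the entries need not be identically distributed). For $\omega\in C^2(M,\mathbb R)$ and a map $F:\mathbb R^N\times\mathbb R\to\mathbb R^N$, a map $f:M\to\mathbb R^N$ is called the generalized synchronization $f_{(\phi,\omega,F)}$ if for every $m\in M$ the recursion $\mathbf x_t=F(\mathbf x_{t-1},\omega(\phi^t(m)))$, $t\in\mathbb Z$, has exactly one bounded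 solution $(\mathbf x_t)_{t\in\mathbb Z}$, and this solution is $\mathbf x_t=f(\phi^t(m))$ for all $t\in\mathbb Z$. Then there exist positive real random variables $a$ and $c$ on $\Omega$ such that, for the rescaled versions $A=a\overline A$ and $\mathbf C=c\,\overline{\mathbf C}$ and the state map $F(\mathbf x,z)=A\mathbf x+\mathbf Cz$, the following holds almost surely: 1. for every $\omega\in C^2(M,\mathbb R)$ the generalized synchronization $f_{(\phi,\omega,F)}$ exists, belongs to $C^2(M,\mathbb R^N)$, and is given by $f_{(\phi,\omega,F)}(m)=\sum_{j=0}^\infty A^j\mathbf C\,\omega(\phi^{-j}(m))$; 2. for generic $\omega\in C^2(M,\mathbb R)$ the map $f_{(\phi,\omega,F)}$ is an embedding (a $C^2$ immersion which is a homeomorphism onto its image): the set of all such $\omega$ is open and dense in $C^2(M,\mathbb R)$ with its $C^2$ (Banach space) topology. -/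

import Mathlib

open scoped Manifold ContDiff

/-- A solution `(x_t)`, `t ∈ ℤ`, in `ℓ^∞` of the drive-response recursion
`x_t = F (x_{t-1}, w (φ^t m))`, driven by the observations `w` of `φ`. -/
def IsBoundedResponse {M V : Type*} [NormedAddCommGroup V]
    (φ : Equiv.Perm M) (w : M → ℝ) (F : V → ℝ → V) (m : M) (x : ℤ → V) : Prop :=
  Bornology.IsBounded (Set.range x) ∧ ∀ t : ℤ, x t = F (x (t - 1)) (w ((φ ^ t) m))

/-- The `(φ, w)`-echo state property: existence and uniqueness of the response along every
orbit. -/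
def EchoStateProperty {M V : Type*} [NormedAddCommGroup V]
    (φ : Equiv.Perm M) (w : M → ℝ) (F : V → ℝ → V) : Prop :=
  ∀ m : M, ∃! x : ℤ → V, IsBoundedResponse φ w F m x

/-- `f` is the generalized synchronization `f_{(φ, w, F)}`: the responses exist uniquely and are
`x_t = f (φ^t m)`. Such an `f` is unique. -/
structure IsGeneralizedSynchronization {M V : Type*} [NormedAddCommGroup V]
    (φ : Equiv.Perm M) (w : M → ℝ) (F : V → ℝ → V) (f : M → V) : Prop where
  echoState : EchoStateProperty φ w F
  response_eq : ∀ (m : M) (x : ℤ → V), IsBoundedResponse φ w F m x →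
    ∀ t : ℤ, x t = f ((φ ^ t) m)

/-- The linear state map `F(x, z) = A x + C z` with connectivity matrix `A` and input mask `C`. -/
noncomputable def linearStateMap {N : ℕ} (A : Matrix (Fin N) (Fin N) ℝ)
    (C : EuclideanSpace ℝ (Fin N)) (x : EuclideanSpace ℝ (Fin N)) (z : ℝ) :
    EuclideanSpace ℝ (Fin N) :=
  Matrix.toEuclideanCLM (𝕜 := ℝ) A x + z • C

section Manifold

variable {q : ℕ} {M : Type*} [TopologicalSpace M] [ChartedSpace (EuclideanSpace ℝ (Fin q)) M]

/-- A `C^2` embedding into a normed space: a `C^2` map which is an immersion (its derivative is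
injective at every point) and a homeomorphism onto its image. -/
structure IsC2Embedding {V : Type*} [NormedAddCommGroup V] [NormedSpace ℝ V]
    (f : M → V) : Prop where
  contMDiff : ContMDiff (𝓡 q) 𝓘(ℝ, V) 2 f
  immersion : ∀ m : M, Function.Injective (mfderiv (𝓡 q) 𝓘(ℝ, V) f m)
  isEmbedding : Topology.IsEmbedding f

/-- The `C^2` topology on `C^2(M, ℝ)`: in every smooth chart of `M`, uniform convergence of the
derivatives of orders `0`, `1`, `2` of the chart expression on compact subsets of the chart image.
For compact `M` it is the topology of the Banach norm
`‖w‖_∞ + ‖Dw‖_∞ + ‖D²w‖_∞` of `C^2(M, ℝ)`. -/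
noncomputable instance instTopologicalSpaceC2 :
    TopologicalSpace (ContMDiffMap (𝓡 q) 𝓘(ℝ, ℝ) M ℝ 2) :=
  ⨅ e ∈ IsManifold.maximalAtlas (𝓡 q) ∞ M, ⨅ k : Fin 3,
    TopologicalSpace.induced
      (fun w : ContMDiffMap (𝓡 q) 𝓘(ℝ, ℝ) M ℝ 2 =>
        UniformOnFun.ofFun {K : Set (EuclideanSpace ℝ (Fin q)) | IsCompact K ∧ K ⊆ e.target}
          (iteratedFDeriv ℝ (k : ℕ) (fun u => w (e.symm u))))
      inferInstance

/-- The derivative `T_m φ^{-n} : T_m M → T_{φ^{-n} m} M`, with `n` the (minimal) period of `m`. At a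
periodic point `φ^{-n} m = m`, and both tangent spaces are the model space through the same
preferred chart, so that this is an endomorphism of `T_m M`. -/
noncomputable def periodDerivative (φ : M ≃ₘ^2⟮𝓡 q, 𝓡 q⟯ M) (m : M) :
    EuclideanSpace ℝ (Fin q) →L[ℝ] EuclideanSpace ℝ (Fin q) :=
  mfderiv (𝓡 q) (𝓡 q) (φ.symm)^[Function.minimalPeriod φ m] m

end Manifold

open scoped Manifold ContDiff Matrix
open Topology Filter MeasureTheory ProbabilityTheory

/-! The random part reduces to one deterministic condition on the pair (A, C), `IsCyclicForPowers`:
for every n > 0 the vectors A^(ni) C, i < N, are independent. For fixed n this is the non-vanishing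
of a polynomial in the entries, and the polynomial is not zero because a diagonal matrix and the
all-ones vector turn it into a Vandermonde determinant. At independent atomless variables a non-zero
polynomial almost surely does not vanish, and only countably many n occur. Scaling preserves the
condition, so A may be made so small that A^j decays faster than the C² size of ω ∘ φ^(-j) grows.
The series f then converges in C² and depends continuously on ω, and contraction makes it the only
bounded response.

On a compact M an embedding is an injective immersion, which is an open condition on ω. Density is a
transversality argument (`exists_nhds_forall_exists_forall_ne_zero`, `dense_setOf_forall_ne_zero`).
Failure means a zero of Df(x)v or of f(x) - f(y); both depend on 2q real parameters and take values
in a space of dimension N > 2q. Where the evaluation in ω is onto, the perturbations that create a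
zero fill the C¹ image of a 2q-dimensional set, whose complement is dense. Surjectivity comes from
bump functions shrinking to a point z: in the limit they select the coefficients A^j C with φ^(-j) x
= z, and the range of the evaluation is closed because it is finite-dimensional. At non-periodic
points the range therefore contains every A^j C, and these span.

At the finitely many periodic points one good ω suffices, since it can be spread to a dense set
along lines. For the immersion property, the q distinct eigenvalues of T = T_x φ^(-n) give a
covector η for which the numbers η(T^i u), i < q, determine u. An observation with differential η at
x and 0 on the rest of the orbit has Df(x)u = ∑ η(T^i u) A^(ni) C. By Cayley–Hamilton, vanishing of
this series is a finite relation between independent vectors (`LinearMap.eq_zero_of_hasSum_cyclic`).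
Two periodic points are separated because the term j = 0 dominates the rest of the series
(`DelaySeries.exists_sync_ne`). -/

/-! ### Zeros of polynomials in independent atomless variables. -/

theorem MvPolynomial.measure_pi_zeros_eq_zero {n : ℕ} (μ : Fin n → Measure ℝ)
    [∀ i, IsProbabilityMeasure (μ i)] [∀ i, NullSingletonClass (μ i)] (p : MvPolynomial (Fin n) ℝ)
    (hp : p ≠ 0) : Measure.pi μ {x | MvPolynomial.eval x p = 0} = 0 := by
  induction n with
  | zero =>
    have : {x : Fin 0 → ℝ | MvPolynomial.eval x p = 0} = ∅ := by
      ext x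
      simp only [Set.mem_ofPred_eq, Set.mem_empty_iff_false, iff_false]
      intro h
      apply hp
      apply MvPolynomial.funext
      intro y
      rw [Subsingleton.elim y x, h, map_zero]
    rw [this, measure_empty]
  | succ n ih =>
    have hmeas : ∀ {m : ℕ} (r : MvPolynomial (Fin m) ℝ),
        MeasurableSet {x | MvPolynomial.eval x r = 0} := fun r =>
      (isClosed_eq (MvPolynomial.continuous_eval r) continuous_const).measurableSet
    set P := MvPolynomial.finSuccEquiv ℝ n p with hP
    have hP0 : P ≠ 0 := by simpa [hP] using hp
    have hlead := ih (fun i => μ i.succ) P.leadingCoeff (by simpa using hP0)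
    have hmp := (measurePreserving_piFinSuccAbove μ 0).symm
    rw [← hmp.measure_preimage (hmeas p).nullMeasurableSet]
    have hms := hmp.measurable (hmeas p)
    -- The swap makes the last n coordinates the outer variable of Fubini. For almost every y the
    -- leading coefficient does not vanish at y, so the slice over y is a finite set of roots.
    rw [← Measure.prod_swap, Measure.map_apply measurable_swap hms,
      Measure.measure_prod_null (measurable_swap hms)]
    have hae : ∀ᵐ y ∂(Measure.pi fun i => μ (Fin.succ i)),
        MvPolynomial.eval y P.leadingCoeff ≠ 0 := by
      simpa [ae_iff] using hlead
    filter_upwards [hae] with y hy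
    have hne : P.map (MvPolynomial.eval y) ≠ 0 := by
      intro h
      apply hy
      have := congrArg (fun r => r.coeff P.natDegree) h
      simpa [Polynomial.coeff_map] using this
    refine measure_mono_null (t := {t | t ∈ (P.map (MvPolynomial.eval y)).roots.toFinset}) ?_
      ((Finset.finite_toSet _).measure_zero _)
    intro t ht
    have ht' : MvPolynomial.eval (Fin.cons t y : Fin (n + 1) → ℝ) p = 0 := by
      simpa [MeasurableEquiv.piFinSuccAbove_symm_apply, Fin.insertNth_zero', Fin.consEquiv] using ht
    rw [MvPolynomial.eval_eq_eval_mv_eval'] at ht'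
    simpa [hne] using ht'

theorem MvPolynomial.ae_eval_ne_zero_of_iIndepFun {σ Ω : Type*} [Fintype σ] [MeasurableSpace Ω]
    {P : Measure Ω} [IsProbabilityMeasure P] {X : σ → Ω → ℝ} (hX : ∀ k, Measurable (X k))
    (hind : iIndepFun X P) (hreg : ∀ k x, P {s | X k s = x} = 0)
    (p : MvPolynomial σ ℝ) (hp : p ≠ 0) :
    ∀ᵐ s ∂P, MvPolynomial.eval (fun k => X k s) p ≠ 0 := by
  let e := Fintype.equivFin σ
  let Y : Fin (Fintype.card σ) → Ω → ℝ := fun i => X (e.symm i)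
  have hY : ∀ i, Measurable (Y i) := fun i => hX _
  have hindY : iIndepFun Y P := hind.precomp e.symm.injective
  have hmap := (iIndepFun_iff_map_fun_eq_pi_map fun i => (hY i).aemeasurable).1 hindY
  have : ∀ i, IsProbabilityMeasure (P.map (Y i)) :=
    fun i => Measure.isProbabilityMeasure_map (hY i).aemeasurable
  have : ∀ i, NullSingletonClass (P.map (Y i)) := fun i => ⟨fun x => by
    rw [Measure.map_apply (hY i) (measurableSet_singleton x)]
    exact hreg _ x⟩
  have h0 := MvPolynomial.measure_pi_zeros_eq_zero (fun i => P.map (Y i))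
    (MvPolynomial.rename e p)
    (by simpa using (MvPolynomial.rename_injective e e.injective).ne hp)
  rw [← hmap, Measure.map_apply (measurable_pi_lambda _ hY)
    ((isClosed_eq (MvPolynomial.continuous_eval _) continuous_const).measurableSet)] at h0
  rw [ae_iff]
  convert h0 using 2
  ext s
  simp only [not_not, Set.mem_ofPred_eq, Set.mem_preimage, MvPolynomial.eval_rename]
  have : (fun k => X k s) = (fun i => Y i s) ∘ e := by
    ext k; simp [Y]
  rw [this]

/-! ### Almost sure cyclicity of the random pair. -/

/-- The pair `(A, C)` is cyclic for all positive powers of `A`. -/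
def IsCyclicForPowers {N : ℕ} (A : Matrix (Fin N) (Fin N) ℝ) (C : EuclideanSpace ℝ (Fin N)) :
    Prop :=
  ∀ n : ℕ, 0 < n → LinearIndependent ℝ fun i : Fin N =>
    Matrix.toEuclideanCLM (𝕜 := ℝ) (A ^ (n * (i : ℕ))) C

/-- This allows the normalization of A after the random choice: each vector is only multiplied by
the non-zero number a^(ni) c. -/
theorem IsCyclicForPowers.smul {N : ℕ} {A : Matrix (Fin N) (Fin N) ℝ}
    {C : EuclideanSpace ℝ (Fin N)} (h : IsCyclicForPowers A C) {a c : ℝ} (ha : a ≠ 0)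
    (hc : c ≠ 0) : IsCyclicForPowers (a • A) (c • C) := by
  intro n hn
  convert (h n hn).units_smul (fun i => Units.mk0 (a ^ (n * (i : ℕ)) * c) (by positivity)) using 1
  ext1 i
  simp [smul_pow, Units.smul_def, mul_smul, smul_comm c]

/-- The Krylov matrix of the generic pair of a matrix and a vector. -/
noncomputable def genericKrylov (N n : ℕ) :
    Matrix (Fin N) (Fin N) (MvPolynomial ((Fin N × Fin N) ⊕ Fin N) ℝ) :=
  Matrix.of fun i => (Matrix.of fun k l => MvPolynomial.X (Sum.inl (k, l))) ^ (n * (i : ℕ)) *ᵥ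
    fun k => MvPolynomial.X (Sum.inr k)

theorem eval_det_genericKrylov {N n : ℕ} (A : Matrix (Fin N) (Fin N) ℝ) (C : Fin N → ℝ) :
    MvPolynomial.eval (Sum.elim (fun p : Fin N × Fin N => A p.1 p.2) C) (genericKrylov N n).det =
      (Matrix.of fun i : Fin N => A ^ (n * (i : ℕ)) *ᵥ C).det := by
  rw [RingHom.map_det]
  congr 1
  ext i k
  simp only [genericKrylov, RingHom.mapMatrix_apply, Matrix.map_apply, Matrix.of_apply]
  rw [RingHom.map_mulVec, ← RingHom.mapMatrix_apply, map_pow]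
  have hA : (MvPolynomial.eval (Sum.elim (fun p : Fin N × Fin N => A p.1 p.2) C)).mapMatrix
      (Matrix.of fun k l => MvPolynomial.X (Sum.inl (k, l))) = A := by
    ext k l; simp
  have hC : ⇑(MvPolynomial.eval (Sum.elim (fun p : Fin N × Fin N => A p.1 p.2) C)) ∘
      (fun k => MvPolynomial.X (Sum.inr k)) = C := by
    ext k; simp
  rw [hA, hC]

theorem det_genericKrylov_ne_zero {N n : ℕ} (hn : 0 < n) : (genericKrylov N n).det ≠ 0 := by
  intro h
  -- At this diagonal matrix and the all-ones vector the transposed Krylov matrix is the Vandermonde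
  -- matrix of the nodes k^n, which are distinct because k ≥ 0 and n > 0.
  have h1 := eval_det_genericKrylov (n := n)
    (Matrix.diagonal fun k : Fin N => ((k : ℕ) : ℝ)) (fun _ => (1 : ℝ))
  rw [h, map_zero, ← Matrix.det_transpose] at h1
  have h2 : (Matrix.of fun i : Fin N => (Matrix.diagonal fun k : Fin N => ((k : ℕ) : ℝ)) ^
      (n * (i : ℕ)) *ᵥ fun _ => (1 : ℝ)).transpose =
      Matrix.vandermonde fun k : Fin N => ((k : ℕ) : ℝ) ^ n := by
    ext k i
    simp [Matrix.diagonal_pow, Matrix.mulVec_diagonal, Matrix.vandermonde_apply, pow_mul]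
  rw [h2] at h1
  refine Matrix.det_vandermonde_ne_zero_iff.2 ?_ h1.symm
  intro k l hkl
  have := (pow_left_inj₀ (Nat.cast_nonneg _) (Nat.cast_nonneg _) hn.ne').1 hkl
  exact Fin.ext (Nat.cast_injective this)

theorem isCyclicForPowers_of_det_ne_zero {N : ℕ} (A : Matrix (Fin N) (Fin N) ℝ)
    (C : EuclideanSpace ℝ (Fin N))
    (h : ∀ n, 0 < n → (Matrix.of fun i : Fin N => A ^ (n * (i : ℕ)) *ᵥ C.ofLp).det ≠ 0) :
    IsCyclicForPowers A C := by
  intro n hn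
  have h1 := Matrix.linearIndependent_rows_of_det_ne_zero (h n hn)
  exact h1.map' (WithLp.linearEquiv 2 ℝ (Fin N → ℝ)).symm.toLinearMap (LinearEquiv.ker _)

theorem ae_isCyclicForPowers {N : ℕ} {Ω : Type*} [MeasurableSpace Ω] {P : Measure Ω}
    [IsProbabilityMeasure P] {A : Ω → Matrix (Fin N) (Fin N) ℝ}
    {C : Ω → EuclideanSpace ℝ (Fin N)}
    (hA : ∀ i j, Measurable fun s => A s i j) (hC : ∀ i, Measurable fun s => C s i)
    (hindep : iIndepFun (fun (k : (Fin N × Fin N) ⊕ Fin N) (s : Ω) =>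
        Sum.elim (fun p : Fin N × Fin N => A s p.1 p.2) (fun i => C s i) k) P)
    (hAreg : ∀ i j, ∀ x : ℝ, P {s | A s i j = x} = 0)
    (hCreg : ∀ i, ∀ x : ℝ, P {s | C s i = x} = 0) :
    ∀ᵐ s ∂P, IsCyclicForPowers (A s) (C s) := by
  have h : ∀ n : ℕ, 0 < n → ∀ᵐ s ∂P,
      (Matrix.of fun i : Fin N => A s ^ (n * (i : ℕ)) *ᵥ (C s).ofLp).det ≠ 0 := by
    intro n hn
    have := MvPolynomial.ae_eval_ne_zero_of_iIndepFun (P := P)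
      (X := fun (k : (Fin N × Fin N) ⊕ Fin N) (s : Ω) =>
        Sum.elim (fun p : Fin N × Fin N => A s p.1 p.2) (fun i => C s i) k)
      (by rintro (k | k); exacts [hA _ _, hC _]) hindep
      (by rintro (k | k) x; exacts [hAreg _ _ x, hCreg _ x]) _ (det_genericKrylov_ne_zero hn)
    filter_upwards [this] with s hs
    rwa [← eval_det_genericKrylov]
  have h' : ∀ᵐ s ∂P, ∀ n : ℕ, 0 < n →
      (Matrix.of fun i : Fin N => A s ^ (n * (i : ℕ)) *ᵥ (C s).ofLp).det ≠ 0 := by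
    rw [ae_all_iff]
    intro n
    by_cases hn : 0 < n
    · filter_upwards [h n hn] with s hs _ using hs
    · filter_upwards with s h using absurd h hn
  filter_upwards [h'] with s hs using isCyclicForPowers_of_det_ne_zero _ _ hs

/-! ### Cyclic vectors, cyclic covectors and linear recurrences. -/

/-- Multiply the power series ∑ y_i B^i C by the reversed polynomial ∑ p_k B^(q-k). The recurrence
kills every coefficient from degree q on, so what is left is a relation between the q independent
vectors. -/
theorem LinearRecurrence.eq_zero_of_hasSum_smul_pow {V : Type*} [NormedAddCommGroup V]
    [NormedSpace ℝ V] {q : ℕ} (B : V →L[ℝ] V) (C : V)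
    (hli : LinearIndependent ℝ fun i : Fin q => (B ^ (i : ℕ)) C)
    (p y : ℕ → ℝ) (hp : p q = 1)
    (hrec : ∀ m, ∑ k ∈ Finset.range (q + 1), p k * y (m + k) = 0)
    (hsum : HasSum (fun i => y i • (B ^ i) C) 0) : ∀ i < q, y i = 0 := by
  -- The coefficient of B^m in the product. The guard discards the indices that truncated
  -- subtraction would send to 0.
  let d : ℕ → ℝ := fun m =>
    ∑ k ∈ Finset.range (q + 1), if q ≤ m + k then p k * y (m + k - q) else 0
  have h1 : ∀ k ∈ Finset.range (q + 1), HasSum (fun m => (if q ≤ m + k then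
      p k * y (m + k - q) else 0) • (B ^ m) C) 0 := by
    intro k hk
    have hkq : k ≤ q := Nat.lt_succ_iff.1 (Finset.mem_range.1 hk)
    have h2 := (hsum.mapL (B ^ (q - k))).const_smul (p k)
    rw [map_zero, smul_zero] at h2
    have h3 := (hasSum_nat_add_iff (f := fun m => (if q ≤ m + k then
      p k * y (m + k - q) else 0) • (B ^ m) C) (q - k) (g := 0)).1 ?_
    · rw [zero_add, Finset.sum_eq_zero] at h3
      · exact h3
      · intro i hi
        rw [if_neg (by have := Finset.mem_range.1 hi; omega), zero_smul]
    · convert h2 using 2 with i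
      have e1 : i + (q - k) + k - q = i := by omega
      rw [if_pos (by omega), e1, map_smul, smul_smul, add_comm, pow_add]
      rfl
  have h4 : HasSum (fun m => d m • (B ^ m) C) 0 := by
    have := hasSum_sum h1
    simpa [d, Finset.sum_smul] using this
  have h5 : ∀ m, q ≤ m → d m = 0 := by
    intro m hm
    rw [← hrec (m - q)]
    refine Finset.sum_congr rfl fun k _ => ?_
    rw [if_pos (by omega), show m + k - q = m - q + k by omega]
  have h6 : ∑ i : Fin q, d i • (B ^ (i : ℕ)) C = 0 := by
    rw [Fin.sum_univ_eq_sum_range (fun m => d m • (B ^ m) C)]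
    refine (hasSum_sum_of_ne_finset_zero ?_).unique h4
    intro m hm
    rw [h5 m (by simpa using hm), zero_smul]
  have h7 : ∀ m < q, d m = 0 := fun m hm =>
    Fintype.linearIndependent_iff.1 hli (fun i => d i) h6 ⟨m, hm⟩
  -- The system d = 0 is triangular: y_i enters d_i with coefficient p_q = 1, and the other terms
  -- involve only earlier values.
  intro i
  induction i using Nat.strong_induction_on with
  | _ i ih =>
    intro hi
    rw [← h7 i hi]
    simp only [d]
    rw [Finset.sum_range_succ, if_pos (by omega), hp, Finset.sum_eq_zero]
    · simp
    · intro k hk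
      have := Finset.mem_range.1 hk
      split_ifs with h
      · rw [ih _ (by omega) (by omega), mul_zero]
      · rfl
-- Distinct eigenvalues give a basis of complex eigenvectors, and a real covector that kills none of
-- them is cyclic. Its values on A^i u are ∑ c_k λ_k^i, with c_k the k-th coordinate of u times a
-- non-zero number, and the Vandermonde matrix of the λ_k is invertible.
theorem Matrix.exists_cyclic_covector {q : ℕ} (A : Matrix (Fin q) (Fin q) ℝ)
    (hA : (A.charpoly.rootSet ℂ).ncard = q) :
    ∃ y : Fin q → ℝ, ∀ u : Fin q → ℝ, (∀ i < q, y ⬝ᵥ (A ^ i *ᵥ u) = 0) → u = 0 := by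
  let f : Module.End ℂ (Fin q → ℂ) := Matrix.toLin' (A.map (algebraMap ℝ ℂ))
  let e : Fin q ≃ A.charpoly.rootSet ℂ :=
    (finCongr ((Nat.card_coe_set_eq _).trans hA).symm).trans (Finite.equivFin _).symm
  have hev : ∀ k : Fin q, ∃ v, f.HasEigenvector (e k : ℂ) v := by
    intro k
    refine Module.End.HasEigenvalue.exists_hasEigenvector ?_
    rw [Module.End.hasEigenvalue_iff_isRoot_charpoly, Matrix.charpoly_toLin', Matrix.charpoly_map]
    have := (e k).2
    rw [Polynomial.mem_rootSet'] at this
    rw [Polynomial.IsRoot, Polynomial.eval_map_algebraMap]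
    exact this.2
  choose v hv using hev
  have hinj : Function.Injective fun k => (e k : ℂ) :=
    Subtype.val_injective.comp e.injective
  have hli : LinearIndependent ℂ v :=
    Module.End.eigenvectors_linearIndependent' f _ hinj v hv
  let b := Module.Basis.mk hli (hli.span_eq_top_of_card_eq_finrank' (by simp)).ge
  have hb : ∀ k, b k = v k := fun k => by simp [b]
  obtain ⟨g, hg⟩ : ∃ g : Module.Dual ℝ (Fin q → ℝ), ∀ k : Fin q,
      g (fun i => (v k i).re) ≠ 0 ∨ g (fun i => (v k i).im) ≠ 0 := by
    classical
    obtain ⟨g, hg⟩ := Module.exists_dual_forall_apply_ne_zero (K := ℝ) (M := Fin q → ℝ)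
      (fun k : Fin q => if (fun i => (v k i).re) ≠ 0 then fun i => (v k i).re
        else fun i => (v k i).im) (by
      intro k
      split_ifs with h
      · exact h
      · intro h'
        apply (hv k).2
        ext i
        exact Complex.ext (congrFun (not_not.1 h) i) (congrFun h' i))
    refine ⟨g, fun k => ?_⟩
    have := hg k
    split_ifs at this with h
    · exact Or.inl this
    · exact Or.inr this
  refine ⟨fun i => g (Pi.single i 1), fun u hu => ?_⟩
  have hgy : ∀ w : Fin q → ℝ, (fun i => g (Pi.single i 1)) ⬝ᵥ w = g w := by
    intro w
    conv_rhs => rw [pi_eq_sum_univ' w]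
    simp only [dotProduct, map_sum, map_smul, smul_eq_mul]
    exact Finset.sum_congr rfl fun i _ => mul_comm _ _
  let G : (Fin q → ℂ) →ₗ[ℂ] ℂ :=
    ∑ i, ((g (Pi.single i 1) : ℝ) : ℂ) • LinearMap.proj i
  have hG : ∀ w : Fin q → ℂ, G w = g (fun i => (w i).re) + g (fun i => (w i).im) * Complex.I := by
    intro w
    rw [← hgy, ← hgy]
    apply Complex.ext <;> simp [G, dotProduct]
  have hGv : ∀ k, G (v k) ≠ 0 := by
    intro k h
    rw [hG] at h
    rcases hg k with h1 | h1
    · exact h1 (by simpa using congrArg Complex.re h)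
    · exact h1 (by simpa using congrArg Complex.im h)
  have hfu : ∀ i, (f ^ i) (fun k => (u k : ℂ)) = fun k => (((A ^ i *ᵥ u) k : ℝ) : ℂ) := by
    intro i
    rw [← Matrix.toLin'_pow, Matrix.toLin'_apply]
    have := RingHom.map_mulVec (algebraMap ℝ ℂ) (A ^ i) u
    ext k
    have h2 := this k
    rw [← RingHom.mapMatrix_apply, map_pow] at h2
    exact h2.symm
  have hGu : ∀ i < q, G ((f ^ i) (fun k => (u k : ℂ))) = 0 := by
    intro i hi
    rw [hfu, hG]
    have := hu i hi
    rw [hgy] at this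
    simp [this]
    exact g.map_zero
  have hpow : ∀ i k, (f ^ i) (v k) = (e k : ℂ) ^ i • v k := by
    intro i k
    induction i with
    | zero => simp
    | succ i ih =>
      rw [pow_succ', Module.End.mul_apply, ih, map_smul, (hv k).apply_eq_smul, smul_smul, pow_succ]
  have hexp : ∀ i, G ((f ^ i) (fun k => (u k : ℂ))) =
      ∑ k, b.repr (fun k => (u k : ℂ)) k * G (v k) * (e k : ℂ) ^ i := by
    intro i
    conv_lhs => rw [← b.sum_repr (fun k => (u k : ℂ))]
    simp only [map_sum, map_smul, hb, hpow, smul_eq_mul]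
    exact Finset.sum_congr rfl fun k _ => by ring
  have hz := Matrix.eq_zero_of_forall_pow_sum_mul_pow_eq_zero (f := fun k => (e k : ℂ))
    (v := fun k => b.repr (fun k => (u k : ℂ)) k * G (v k)) hinj
    (fun i => by rw [← hGu i i.2, hexp])
  have hrep : b.repr (fun k => (u k : ℂ)) = 0 := by
    ext k
    exact (mul_eq_zero.1 (congrFun hz k)).resolve_right (hGv k)
  have hu0 := b.repr.map_eq_zero_iff.1 hrep
  ext k
  exact Complex.ofReal_eq_zero.1 (congrFun hu0 k)

theorem LinearMap.exists_cyclic_covector {E : Type*} [AddCommGroup E] [Module ℝ E]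
    [FiniteDimensional ℝ E] {q : ℕ} (hq : Module.finrank ℝ E = q) (T : E →ₗ[ℝ] E)
    (hT : (T.charpoly.rootSet ℂ).ncard = q) :
    ∃ g : E →ₗ[ℝ] ℝ, ∀ u : E, (∀ i < q, g ((T ^ i) u) = 0) → u = 0 := by
  let b := Module.finBasisOfFinrankEq ℝ E hq
  obtain ⟨y, hy⟩ := Matrix.exists_cyclic_covector (LinearMap.toMatrix b b T)
    (by rwa [LinearMap.charpoly_toMatrix])
  refine ⟨(dotProductBilin ℝ ℝ y).comp b.equivFun.toLinearMap, fun u hu => ?_⟩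
  have := hy (b.equivFun u) fun i hi => by
    rw [← hu i hi, LinearMap.toMatrix_pow, Module.Basis.equivFun_apply,
      LinearMap.toMatrix_mulVec_repr]
    rfl
  simpa using this

/-- A series of rank one operators built from a cyclic covector of `T` and a vector that is cyclic
for `B` has trivial kernel. -/
theorem LinearMap.eq_zero_of_hasSum_cyclic {E V : Type*} [AddCommGroup E] [Module ℝ E]
    [FiniteDimensional ℝ E] [NormedAddCommGroup V] [NormedSpace ℝ V] {q : ℕ}
    (hq : Module.finrank ℝ E = q) (T : E →ₗ[ℝ] E) (g : E →ₗ[ℝ] ℝ)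
    (hg : ∀ u : E, (∀ i < q, g ((T ^ i) u) = 0) → u = 0) (B : V →L[ℝ] V) (C : V)
    (hli : LinearIndependent ℝ fun i : Fin q => (B ^ (i : ℕ)) C) (u : E)
    (hsum : HasSum (fun i => g ((T ^ i) u) • (B ^ i) C) 0) : u = 0 := by
  refine hg u (LinearRecurrence.eq_zero_of_hasSum_smul_pow B C hli T.charpoly.coeff _ ?_ ?_ hsum)
  · rw [← hq, ← LinearMap.charpoly_natDegree T]
    exact T.charpoly_monic
  · intro m
    -- Cayley–Hamilton: the sequence g (T^i u) satisfies the recurrence of the characteristic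
    -- polynomial of T.
    have h := LinearMap.aeval_self_charpoly T
    rw [Polynomial.aeval_eq_sum_range, LinearMap.charpoly_natDegree, hq] at h
    have h2 := congrArg (fun S : E →ₗ[ℝ] E => g ((T ^ m) (S u))) h
    simpa [LinearMap.sum_apply, pow_add] using h2

/-! ### Transversality: generic absence of zeros when parameters are few. -/

theorem IsCompact.isOpen_setOf_forall_ne_zero {W P V : Type*} [TopologicalSpace W]
    [TopologicalSpace P] [TopologicalSpace V] [T1Space V] [Zero V] {ev : W → P → V} {Z : Set P}
    (hZ : IsCompact Z)
    (hcont : ∀ p ∈ Z, ∀ w, ContinuousAt (fun x : W × P => ev x.1 x.2) (w, p)) :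
    IsOpen {w | ∀ p ∈ Z, ev w p ≠ 0} := by
  rw [isOpen_iff_mem_nhds]
  intro w hw
  exact hZ.eventually_forall_of_forall_eventually fun p hp =>
    (hcont p hp w).eventually_ne (hw p hp)

/-- Choose ψ_i whose evaluations at p₀ form a basis; near p₀ they still do. Then w₀ + ∑ v_i ψ_i has
a zero at p only if v = G p, and the C¹ image of G has Hausdorff dimension at most dim F < dim V, so
arbitrarily small v avoid it. The neighbourhood does not depend on w₀, hence finitely many of them
can be combined. -/
theorem exists_nhds_forall_exists_forall_ne_zero {W V F : Type*} [TopologicalSpace W]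
    [AddCommGroup W] [Module ℝ W] [ContinuousAdd W] [ContinuousSMul ℝ W]
    [NormedAddCommGroup V] [NormedSpace ℝ V] [FiniteDimensional ℝ V]
    [NormedAddCommGroup F] [NormedSpace ℝ F] [FiniteDimensional ℝ F]
    (hdim : Module.finrank ℝ F < Module.finrank ℝ V) (ev : W →ₗ[ℝ] F → V)
    {Ω : Set F} (hΩ : IsOpen Ω) (hC : ∀ w, ContDiffOn ℝ 1 (ev w) Ω) {p₀ : F} (hp₀ : p₀ ∈ Ω)
    (hsurj : ∀ v, ∃ w, ev w p₀ = v) :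
    ∃ U ∈ 𝓝 p₀, ∀ w₀, ∀ O ∈ 𝓝 w₀, ∃ w ∈ O, ∀ p ∈ U, ev w p ≠ 0 := by
  let b := Module.finBasis ℝ V
  choose ψ hψ using fun i => hsurj (b i)
  let L : F → V →L[ℝ] V := fun p =>
    ∑ i, (LinearMap.toContinuousLinearMap (b.coord i)).smulRight (ev (ψ i) p)
  have hL : ContDiffOn ℝ 1 L Ω := by
    refine ContDiffOn.sum fun i _ => ?_
    exact (ContinuousLinearMap.smulRightL ℝ V V
      (LinearMap.toContinuousLinearMap (b.coord i))).contDiff.comp_contDiffOn (hC (ψ i))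
  have hL0 : L p₀ = 1 := by
    ext v
    simp only [L, hψ, sum_apply, ContinuousLinearMap.smulRight_apply]
    exact b.sum_repr v
  have hunit : ∀ᶠ p in 𝓝 p₀, IsUnit (L p) := by
    have h1 : ContinuousAt L p₀ := hL.continuousOn.continuousAt (hΩ.mem_nhds hp₀)
    exact h1.eventually (by rw [hL0]; exact Units.nhds 1)
  obtain ⟨ε, hε, hball⟩ := Metric.mem_nhds_iff.1 (Filter.inter_mem (hΩ.mem_nhds hp₀) hunit)
  refine ⟨Metric.ball p₀ ε, Metric.ball_mem_nhds _ hε, fun w₀ O hO => ?_⟩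
  let G : F → V := fun p => Ring.inverse (L p) (-(ev w₀ p))
  have hG : ContDiffOn ℝ 1 G (Metric.ball p₀ ε) := by
    intro p hp
    obtain ⟨hpΩ, hpu⟩ := hball hp
    obtain ⟨u, hu⟩ := hpu
    have h1 : ContDiffAt ℝ 1 (fun p => Ring.inverse (L p)) p := by
      have h2 : ContDiffAt ℝ 1 Ring.inverse (L p) := hu ▸ contDiffAt_ringInverse ℝ u
      exact h2.comp p (hL.contDiffAt (hΩ.mem_nhds hpΩ))
    exact (h1.clm_apply ((hC w₀).contDiffAt (hΩ.mem_nhds hpΩ)).neg).contDiffWithinAt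
  have hd : Dense (G '' Metric.ball p₀ ε)ᶜ := by
    refine hG.dense_compl_image_of_dimH_lt_finrank (convex_ball _ _) subset_rfl ?_
    rw [Real.dimH_of_mem_nhds (Metric.ball_mem_nhds _ hε)]
    exact_mod_cast hdim
  let σ : V → W := fun v => w₀ + ∑ i, b.coord i v • ψ i
  have hσ : Continuous σ := by
    refine continuous_const.add (continuous_finsetSum _ fun i _ => ?_)
    exact (LinearMap.toContinuousLinearMap (b.coord i)).continuous.smul continuous_const
  have hσ0 : σ 0 = w₀ := by simp [σ]
  obtain ⟨v, hvO, hvG⟩ := hd.inter_nhds_nonempty (hσ.continuousAt.preimage_mem_nhds (by rwa [hσ0])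
    : σ ⁻¹' O ∈ 𝓝 (0 : V))
  refine ⟨σ v, by assumption, fun p hp h0 => ?_⟩
  have h1 : ev w₀ p + L p v = 0 := by
    simpa [σ, L] using h0
  have h2 : G p = v := by
    simp only [G]
    rw [neg_eq_of_add_eq_zero_right h1, ← mul_apply_eq_comp,
      Ring.inverse_mul_cancel _ (hball hp).2]
    rfl
  have h3 : v ∈ (G '' Metric.ball p₀ ε)ᶜ := by assumption
  exact h3 ⟨p, hp, h2⟩

/-- On Z₀ the evaluation need not be onto, and openness replaces surjectivity: if w₀ has no zero on
Z₀, then no w near w₀ has a zero in some neighbourhood U of Z₀. The compact rest Z \ U is covered by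
finitely many neighbourhoods on which absence of zeros is open and dense. -/
theorem dense_setOf_forall_ne_zero {W V F : Type*} [TopologicalSpace W]
    [AddCommGroup W] [Module ℝ W] [ContinuousAdd W] [ContinuousSMul ℝ W]
    [NormedAddCommGroup V] [NormedSpace ℝ V] [FiniteDimensional ℝ V]
    [NormedAddCommGroup F] [NormedSpace ℝ F] [FiniteDimensional ℝ F]
    (hdim : Module.finrank ℝ F < Module.finrank ℝ V) (ev : W →ₗ[ℝ] F → V)
    {Ω : Set F} (hΩ : IsOpen Ω) (hC : ∀ w, ContDiffOn ℝ 1 (ev w) Ω)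
    (hcont : ∀ p ∈ Ω, ∀ w, ContinuousAt (fun x : W × F => ev x.1 x.2) (w, p))
    {Z Z₀ : Set F} (hZ : IsCompact Z) (hZΩ : Z ⊆ Ω) (hZ₀ : IsCompact Z₀) (hZ₀Ω : Z₀ ⊆ Ω)
    (hsurj : ∀ p ∈ Z \ Z₀, ∀ v, ∃ w, ev w p = v)
    (hdense : Dense {w | ∀ p ∈ Z₀, ev w p ≠ 0}) :
    Dense {w | ∀ p ∈ Z, ev w p ≠ 0} := by
  have key : ∀ Y : Set F, IsCompact Y → Y ⊆ Z \ Z₀ → Dense {w | ∀ p ∈ Y, ev w p ≠ 0} := by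
    intro Y hY hYZ
    obtain ⟨D, -, hDd, hDY⟩ : ∃ D : Set W, IsOpen D ∧ Dense D ∧ ∀ w ∈ D, ∀ p ∈ Y, ev w p ≠ 0 := by
      refine hY.induction_on (p := fun Y => ∃ D : Set W, IsOpen D ∧ Dense D ∧
        ∀ w ∈ D, ∀ p ∈ Y, ev w p ≠ 0) ⟨Set.univ, isOpen_univ, dense_univ, by simp⟩ ?_ ?_ ?_
      · rintro s t hst ⟨D, h1, h2, h3⟩
        exact ⟨D, h1, h2, fun w hw p hp => h3 w hw p (hst hp)⟩
      · rintro s t ⟨D, h1, h2, h3⟩ ⟨D', h1', h2', h3'⟩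
        refine ⟨D ∩ D', h1.inter h1', h2.inter_of_isOpen_left h2' h1, ?_⟩
        rintro w ⟨hw, hw'⟩ p (hp | hp)
        exacts [h3 w hw p hp, h3' w hw' p hp]
      · intro p hp
        have hpΩ := hZΩ (hYZ hp).1
        obtain ⟨U, hU, hUd⟩ := exists_nhds_forall_exists_forall_ne_zero hdim ev hΩ hC hpΩ
          (hsurj p (hYZ hp))
        obtain ⟨K, hK, hKU, hKc⟩ := LocallyCompactSpace.local_compact_nhds p (U ∩ Ω)
          (Filter.inter_mem hU (hΩ.mem_nhds hpΩ))
        refine ⟨K, mem_nhdsWithin_of_mem_nhds hK, {w | ∀ p ∈ K, ev w p ≠ 0},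
          hKc.isOpen_setOf_forall_ne_zero fun p hp => hcont p (hKU hp).2, ?_, fun w hw => hw⟩
        rw [dense_iff_inter_open]
        rintro O hO ⟨w₀, hw₀⟩
        obtain ⟨w, hwO, hw⟩ := hUd w₀ O (hO.mem_nhds hw₀)
        exact ⟨w, hwO, fun p hp => hw p (hKU hp).1⟩
    exact hDd.mono hDY
  rw [dense_iff_inter_open]
  intro O hO hne
  obtain ⟨w₀, hw₀O, hw₀⟩ := hdense.inter_open_nonempty O hO hne
  have hev : ∀ᶠ x in 𝓝ˢ ({w₀} ×ˢ Z₀), ev x.1 x.2 ≠ 0 := by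
    rw [Filter.eventually_iff, mem_nhdsSet_iff_forall]
    rintro ⟨w, p⟩ ⟨rfl, hp⟩
    exact (hcont p (hZ₀Ω hp) w).eventually_ne (hw₀ p hp)
  obtain ⟨O', U, hO', hU, hwO', hZU, hsub⟩ :=
    generalized_tube_lemma isCompact_singleton hZ₀ isOpen_interior
      (subset_interior_iff_mem_nhdsSet.2 hev)
  obtain ⟨w, ⟨hwO, hwO'⟩, hw⟩ := (key (Z \ U) (hZ.diff hU)
    (Set.sdiff_subset_sdiff_right hZU)).inter_open_nonempty (O ∩ O') (hO.inter hO')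
    ⟨w₀, hw₀O, hwO' rfl⟩
  refine ⟨w, hwO, fun p hp => ?_⟩
  by_cases hpU : p ∈ U
  · exact interior_subset (hsub (Set.mk_mem_prod hwO' hpU))
  · exact hw p ⟨hp, hpU⟩

theorem Finset.dense_setOf_forall_of_isOpen {W ι : Type*} [TopologicalSpace W] (s : Finset ι)
    (Q : ι → W → Prop) (ho : ∀ i ∈ s, IsOpen {w | Q i w}) (hd : ∀ i ∈ s, Dense {w | Q i w}) :
    Dense {w | ∀ i ∈ s, Q i w} := by
  classical
  induction s using Finset.induction_on with
  | empty => simp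
  | insert i s _ ih =>
    simp only [Finset.forall_mem_insert] at ho hd ⊢
    exact hd.1.inter_of_isOpen_left (ih ho.2 hd.2) ho.1

/-! ### C²(M, ℝ) as a topological vector space. -/

section C2Topology

/-- The space `C^2(M, ℝ)`. -/
abbrev C2Fun (q : ℕ) (M : Type*) [TopologicalSpace M] [ChartedSpace (EuclideanSpace ℝ (Fin q)) M] :
    Type _ :=
  ContMDiffMap (𝓡 q) 𝓘(ℝ, ℝ) M ℝ 2

variable {q : ℕ} {M : Type*} [TopologicalSpace M] [ChartedSpace (EuclideanSpace ℝ (Fin q)) M]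

theorem C2Fun.tendsto_nhds_iff {ι : Type*} {l : Filter ι} {F : ι → C2Fun q M} {w : C2Fun q M} :
    Tendsto F l (𝓝 w) ↔ ∀ e ∈ IsManifold.maximalAtlas (𝓡 q) ∞ M, ∀ k : Fin 3,
      ∀ K, IsCompact K → K ⊆ e.target →
        TendstoUniformlyOn (fun i => iteratedFDeriv ℝ (k : ℕ) fun u => F i (e.symm u))
          (iteratedFDeriv ℝ (k : ℕ) fun u => w (e.symm u)) l K := by
  simp only [nhds_iInf, tendsto_iInf, nhds_induced, tendsto_comap_iff]
  refine forall₂_congr fun e he => forall_congr' fun k => ?_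
  rw [UniformOnFun.tendsto_iff_tendstoUniformlyOn]
  exact ⟨fun h K hK hKe => h K ⟨hK, hKe⟩, fun h K hK => h K hK.1 hK.2⟩

theorem C2Fun.continuous_iff {X : Type*} [TopologicalSpace X] {F : X → C2Fun q M} :
    Continuous F ↔ ∀ e ∈ IsManifold.maximalAtlas (𝓡 q) ∞ M, ∀ k : Fin 3,
      ∀ K, IsCompact K → K ⊆ e.target → ∀ x,
        TendstoUniformlyOn (fun i => iteratedFDeriv ℝ (k : ℕ) fun u => F i (e.symm u))
          (iteratedFDeriv ℝ (k : ℕ) fun u => F x (e.symm u)) (𝓝 x) K := by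
  simp only [continuous_iff_continuousAt, ContinuousAt, C2Fun.tendsto_nhds_iff]
  exact ⟨fun h e he k K hK hKe x => h x e he k K hK hKe,
    fun h x e he k K hK hKe => h e he k K hK hKe x⟩

theorem ContMDiff.contDiffOn_comp_symm {V : Type*} [NormedAddCommGroup V] [NormedSpace ℝ V]
    {w : M → V} (hw : ContMDiff (𝓡 q) 𝓘(ℝ, V) 2 w)
    {e : OpenPartialHomeomorph M (EuclideanSpace ℝ (Fin q))}
    (he : e ∈ IsManifold.maximalAtlas (𝓡 q) ∞ M) :
    ContDiffOn ℝ 2 (fun u => w (e.symm u)) e.target := by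
  rw [← contMDiffOn_iff_contDiffOn]
  exact hw.comp_contMDiffOn
    ((contMDiffOn_symm_of_mem_maximalAtlas he).of_le ENat.LEInfty.out)

theorem C2Fun.contDiffAt_comp_symm (w : C2Fun q M)
    {e : OpenPartialHomeomorph M (EuclideanSpace ℝ (Fin q))}
    (he : e ∈ IsManifold.maximalAtlas (𝓡 q) ∞ M) {u : EuclideanSpace ℝ (Fin q)}
    (hu : u ∈ e.target) : ContDiffAt ℝ 2 (fun u => w (e.symm u)) u :=
  (w.contMDiff.contDiffOn_comp_symm he).contDiffAt (e.open_target.mem_nhds hu)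

theorem C2Fun.iteratedFDeriv_add_apply (w w' : C2Fun q M)
    {e : OpenPartialHomeomorph M (EuclideanSpace ℝ (Fin q))}
    (he : e ∈ IsManifold.maximalAtlas (𝓡 q) ∞ M) {u : EuclideanSpace ℝ (Fin q)}
    (hu : u ∈ e.target) {k : ℕ} (hk : k ≤ 2) :
    iteratedFDeriv ℝ k (fun u => (w + w') (e.symm u)) u =
      iteratedFDeriv ℝ k (fun u => w (e.symm u)) u +
        iteratedFDeriv ℝ k (fun u => w' (e.symm u)) u :=
  _root_.iteratedFDeriv_add_apply
    ((w.contDiffAt_comp_symm he hu).of_le (by exact_mod_cast hk))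
    ((w'.contDiffAt_comp_symm he hu).of_le (by exact_mod_cast hk))

theorem C2Fun.iteratedFDeriv_smul_apply (t : ℝ) (w : C2Fun q M)
    {e : OpenPartialHomeomorph M (EuclideanSpace ℝ (Fin q))}
    (he : e ∈ IsManifold.maximalAtlas (𝓡 q) ∞ M) {u : EuclideanSpace ℝ (Fin q)}
    (hu : u ∈ e.target) {k : ℕ} (hk : k ≤ 2) :
    iteratedFDeriv ℝ k (fun u => (t • w) (e.symm u)) u =
      t • iteratedFDeriv ℝ k (fun u => w (e.symm u)) u :=
  iteratedFDeriv_const_smul_apply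
    ((w.contDiffAt_comp_symm he hu).of_le (by exact_mod_cast hk))

theorem ContDiffOn.exists_norm_iteratedFDeriv_le {E V : Type*} [NormedAddCommGroup E]
    [NormedSpace ℝ E] [NormedAddCommGroup V] [NormedSpace ℝ V] {f : E → V} {O K : Set E} {n : ℕ}
    (hf : ContDiffOn ℝ n f O) (hO : IsOpen O) (hK : IsCompact K) (hKO : K ⊆ O) {k : ℕ}
    (hk : k ≤ n) : ∃ b : ℝ, ∀ u ∈ K, ‖iteratedFDeriv ℝ k f u‖ ≤ b := by
  refine hK.exists_bound_of_continuousOn fun u hu => ?_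
  exact ((hf.contDiffAt (hO.mem_nhds (hKO hu))).continuousAt_iteratedFDeriv
    (by exact_mod_cast hk)).continuousWithinAt

/-- Continuity of the vector space operations is what makes a finite-dimensional perturbation with
small coefficients small in C². -/
instance : ContinuousAdd (C2Fun q M) where
  continuous_add := by
    rw [C2Fun.continuous_iff]
    rintro e he k K hK hKe ⟨w, w'⟩
    have h1 := C2Fun.tendsto_nhds_iff.1
      (continuous_fst.tendsto ((w, w') : C2Fun q M × C2Fun q M)) e he k K hK hKe
    have h2 := C2Fun.tendsto_nhds_iff.1
      (continuous_snd.tendsto ((w, w') : C2Fun q M × C2Fun q M)) e he k K hK hKe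
    have hk : (k : ℕ) ≤ 2 := Nat.lt_succ_iff.1 k.2
    refine ((h1.add h2).congr (Eventually.of_forall fun x u hu => ?_)).congr_right fun u hu => ?_
    · exact (C2Fun.iteratedFDeriv_add_apply _ _ he (hKe hu) hk).symm
    · exact (C2Fun.iteratedFDeriv_add_apply _ _ he (hKe hu) hk).symm

instance : ContinuousSMul ℝ (C2Fun q M) where
  continuous_smul := by
    rw [C2Fun.continuous_iff]
    rintro e he k K hK hKe ⟨t, w⟩
    have hk : (k : ℕ) ≤ 2 := Nat.lt_succ_iff.1 k.2
    have h2 := C2Fun.tendsto_nhds_iff.1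
      (continuous_snd.tendsto ((t, w) : ℝ × C2Fun q M)) e he k K hK hKe
    obtain ⟨b, hb⟩ := (w.contMDiff.contDiffOn_comp_symm he).exists_norm_iteratedFDeriv_le
      (n := 2) e.open_target hK hKe hk
    rw [Metric.tendstoUniformlyOn_iff] at h2 ⊢
    intro ε hε
    have h3 := h2 (ε / 2 / (|t| + 1)) (by positivity)
    have h4 : ∀ᶠ x : ℝ × C2Fun q M in 𝓝 (t, w), |x.1 - t| * (|b| + 1) < ε / 2 := by
      have hc : Continuous fun x : ℝ × C2Fun q M => |x.1 - t| * (|b| + 1) := by fun_prop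
      exact (hc.tendsto' (t, w) 0 (by simp)).eventually_lt_const (by positivity)
    have h5 : ∀ᶠ x : ℝ × C2Fun q M in 𝓝 (t, w), |x.1| < |t| + 1 := by
      have hc : Continuous fun x : ℝ × C2Fun q M => |x.1| := by fun_prop
      exact (hc.tendsto (t, w)).eventually_lt_const (by simp)
    filter_upwards [h3, h4, h5] with x hx3 hx4 hx5 u hu
    have hx := hx3 u hu
    rw [C2Fun.iteratedFDeriv_smul_apply _ _ he (hKe hu) hk,
      C2Fun.iteratedFDeriv_smul_apply _ _ he (hKe hu) hk]
    set D := iteratedFDeriv ℝ (k : ℕ) (fun u => w (e.symm u)) u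
    set D' := iteratedFDeriv ℝ (k : ℕ) (fun u => x.2 (e.symm u)) u
    have hD : ‖D‖ ≤ b := hb u hu
    rw [dist_eq_norm] at hx ⊢
    have e1 : t • D - x.1 • D' = x.1 • (D - D') - (x.1 - t) • D := by
      rw [smul_sub, sub_smul]; abel
    calc ‖t • D - x.1 • D'‖ ≤ |x.1| * ‖D - D'‖ + |x.1 - t| * ‖D‖ := by
          rw [e1, ← Real.norm_eq_abs, ← Real.norm_eq_abs, ← norm_smul, ← norm_smul]
          exact norm_sub_le _ _
      _ ≤ (|t| + 1) * (ε / 2 / (|t| + 1)) + |x.1 - t| * (|b| + 1) := by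
          gcongr
          exact hD.trans ((le_abs_self b).trans (by linarith))
      _ < ε / 2 + ε / 2 := by
          rw [mul_div_cancel₀ _ (by positivity)]
          linarith
      _ = ε := by ring

end C2Topology

/-! ### Growth of the derivatives of w ∘ h^j in a finite atlas. -/

section JetBounds

variable {q : ℕ} {M : Type*} [TopologicalSpace M] [ChartedSpace (EuclideanSpace ℝ (Fin q)) M]

/-- A finite cover of a manifold by coordinate balls whose closed doubles are contained in the
chart. -/
structure ChartCover (q : ℕ) (M : Type*) [TopologicalSpace M]
    [ChartedSpace (EuclideanSpace ℝ (Fin q)) M] where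
  /-- The centers of the balls. -/
  centers : Finset M
  /-- The radii of the balls. -/
  radius : M → ℝ
  radius_pos : ∀ c, 0 < radius c
  closedBall_subset : ∀ c, Metric.closedBall (chartAt (EuclideanSpace ℝ (Fin q)) c c)
    (2 * radius c) ⊆ (chartAt (EuclideanSpace ℝ (Fin q)) c).target
  exists_mem : ∀ m, ∃ c ∈ centers, m ∈ (chartAt (EuclideanSpace ℝ (Fin q)) c).source ∧
    chartAt (EuclideanSpace ℝ (Fin q)) c m ∈
      Metric.ball (chartAt (EuclideanSpace ℝ (Fin q)) c c) (radius c)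

theorem ChartCover.nonempty [CompactSpace M] : Nonempty (ChartCover q M) := by
  have h1 : ∀ c : M, ∃ r > 0, Metric.closedBall (chartAt (EuclideanSpace ℝ (Fin q)) c c) (2 * r) ⊆
      (chartAt (EuclideanSpace ℝ (Fin q)) c).target := by
    intro c
    obtain ⟨ε, hε, h⟩ := Metric.nhds_basis_closedBall.mem_iff.1
      ((chartAt (EuclideanSpace ℝ (Fin q)) c).open_target.mem_nhds (mem_chart_target _ c))
    exact ⟨ε / 2, half_pos hε, by rwa [mul_div_cancel₀ _ two_ne_zero]⟩
  choose r hr hsub using h1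
  obtain ⟨s, hs⟩ := CompactSpace.elim_nhds_subcover (X := M)
    (fun c => (chartAt (EuclideanSpace ℝ (Fin q)) c).source ∩
      chartAt (EuclideanSpace ℝ (Fin q)) c ⁻¹'
        Metric.ball (chartAt (EuclideanSpace ℝ (Fin q)) c c) (r c)) fun c =>
    ((chartAt (EuclideanSpace ℝ (Fin q)) c).isOpen_inter_preimage Metric.isOpen_ball).mem_nhds
      ⟨mem_chart_source _ c, Metric.mem_ball_self (hr c)⟩
  refine ⟨⟨s, r, hr, hsub, fun m => ?_⟩⟩
  have hm : m ∈ (⊤ : Set M) := trivial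
  rw [← hs] at hm
  obtain ⟨c, hc, h⟩ := Set.mem_iUnion₂.1 hm
  exact ⟨c, hc, h.1, h.2⟩

namespace ChartCover

variable (𝒰 : ChartCover q M)

/-- The open coordinate ball around `c` of twice the radius of the cover. -/
def ball (c : M) : Set (EuclideanSpace ℝ (Fin q)) :=
  Metric.ball (chartAt (EuclideanSpace ℝ (Fin q)) c c) (2 * 𝒰.radius c)

/-- The closed coordinate ball around `c` of twice the radius of the cover. -/
def closedBall (c : M) : Set (EuclideanSpace ℝ (Fin q)) :=
  Metric.closedBall (chartAt (EuclideanSpace ℝ (Fin q)) c c) (2 * 𝒰.radius c)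

/-- The closed coordinate ball around `c`. -/
def core (c : M) : Set (EuclideanSpace ℝ (Fin q)) :=
  Metric.closedBall (chartAt (EuclideanSpace ℝ (Fin q)) c c) (𝒰.radius c)

theorem ball_subset_closedBall (c : M) : 𝒰.ball c ⊆ 𝒰.closedBall c :=
  Metric.ball_subset_closedBall

theorem closedBall_subset_target (c : M) :
    𝒰.closedBall c ⊆ (chartAt (EuclideanSpace ℝ (Fin q)) c).target :=
  𝒰.closedBall_subset c

theorem ball_subset_target (c : M) :
    𝒰.ball c ⊆ (chartAt (EuclideanSpace ℝ (Fin q)) c).target :=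
  (𝒰.ball_subset_closedBall c).trans (𝒰.closedBall_subset c)

theorem core_subset_ball (c : M) : 𝒰.core c ⊆ 𝒰.ball c :=
  Metric.closedBall_subset_ball (by linarith [𝒰.radius_pos c])

theorem isOpen_ball (c : M) : IsOpen (𝒰.ball c) := Metric.isOpen_ball

theorem isCompact_closedBall (c : M) : IsCompact (𝒰.closedBall c) :=
  ProperSpace.isCompact_closedBall _ _

theorem isCompact_core (c : M) : IsCompact (𝒰.core c) :=
  ProperSpace.isCompact_closedBall _ _

theorem exists_mem_core (m : M) : ∃ c ∈ 𝒰.centers,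
    m ∈ (chartAt (EuclideanSpace ℝ (Fin q)) c).source ∧
      chartAt (EuclideanSpace ℝ (Fin q)) c m ∈ 𝒰.core c := by
  obtain ⟨c, hc, h1, h2⟩ := 𝒰.exists_mem m
  exact ⟨c, hc, h1, Metric.ball_subset_closedBall h2⟩

/-- The derivatives of `w` of order at most `n` are bounded by `b` in the coordinate balls of the
cover. -/
def JetBound (n : ℕ) (w : M → ℝ) (b : ℝ) : Prop :=
  ∀ c ∈ 𝒰.centers, ∀ u ∈ 𝒰.closedBall c, ∀ k ≤ n,
    ‖iteratedFDeriv ℝ k (fun u => w ((chartAt (EuclideanSpace ℝ (Fin q)) c).symm u)) u‖ ≤ b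

variable {𝒰}

theorem JetBound.abs_le {n : ℕ} {w : M → ℝ} {b : ℝ} (h : 𝒰.JetBound n w b) (m : M) :
    |w m| ≤ b := by
  obtain ⟨c, hc, hm, hmc⟩ := 𝒰.exists_mem_core m
  have := h c hc _ (𝒰.ball_subset_closedBall c (𝒰.core_subset_ball c hmc)) 0 n.zero_le
  rwa [norm_iteratedFDeriv_zero, OpenPartialHomeomorph.left_inv _ hm] at this

end ChartCover

theorem exists_eventually_norm_iteratedFDeriv_comp_le {h : M → M}
    (hh : ContMDiff (𝓡 q) (𝓡 q) 2 h)
    {e e' : OpenPartialHomeomorph M (EuclideanSpace ℝ (Fin q))}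
    (he : e ∈ IsManifold.maximalAtlas (𝓡 q) ∞ M) (he' : e' ∈ IsManifold.maximalAtlas (𝓡 q) ∞ M)
    {u₀ : EuclideanSpace ℝ (Fin q)} (hu₀ : u₀ ∈ e.target) (hm : h (e.symm u₀) ∈ e'.source) :
    ∃ K : ℝ, 1 ≤ K ∧ ∀ᶠ u in 𝓝 u₀, ∀ w : C2Fun q M, ∀ n ≤ 2, ∀ b : ℝ,
      (∀ k ≤ n, ‖iteratedFDeriv ℝ k (fun v => w (e'.symm v)) (e' (h (e.symm u)))‖ ≤ b) →
      ∀ k ≤ n, ‖iteratedFDeriv ℝ k (fun v => w (h (e.symm v))) u‖ ≤ K * b := by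
  let O := e.target ∩ e.symm ⁻¹' (h ⁻¹' e'.source)
  have hO : IsOpen O :=
    e.symm.isOpen_inter_preimage (e'.open_source.preimage hh.continuous)
  let H : EuclideanSpace ℝ (Fin q) → EuclideanSpace ℝ (Fin q) := fun u => e' (h (e.symm u))
  have hH : ContDiffOn ℝ 2 H O := by
    rw [← contMDiffOn_iff_contDiffOn]
    exact ((contMDiffOn_of_mem_maximalAtlas he').of_le ENat.LEInfty.out).comp
      (hh.comp_contMDiffOn ((contMDiffOn_symm_of_mem_maximalAtlas he).of_le
        ENat.LEInfty.out |>.mono Set.inter_subset_left)) fun u hu => hu.2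
  have hu₀O : u₀ ∈ O := ⟨hu₀, hm⟩
  obtain ⟨D, hD1, hD⟩ : ∃ D : ℝ, 1 ≤ D ∧ ∀ᶠ u in 𝓝 u₀, ∀ k ≤ 2, ‖iteratedFDeriv ℝ k H u‖ ≤ D := by
    have hc : ∀ k ≤ 2, ContinuousAt (fun u => ‖iteratedFDeriv ℝ k H u‖) u₀ := fun k hk =>
      ((hH.contDiffAt (hO.mem_nhds hu₀O)).continuousAt_iteratedFDeriv (by exact_mod_cast hk)).norm
    have hb : ∀ k ∈ Finset.range 3, ∃ b, ∀ᶠ u in 𝓝 u₀, ‖iteratedFDeriv ℝ k H u‖ ≤ b :=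
      fun k hk => ⟨_, ((hc k (Nat.lt_succ_iff.1 (Finset.mem_range.1 hk))).eventually_lt_const
        (lt_add_one _)).mono fun u hu => hu.le⟩
    choose! b hb using hb
    refine ⟨1 + ∑ k ∈ Finset.range 3, |b k|, le_add_of_nonneg_right (by positivity), ?_⟩
    filter_upwards [(Finset.eventually_all _).2 hb] with u hu k hk
    have hk' : k ∈ Finset.range 3 := Finset.mem_range.2 (by omega)
    have := Finset.single_le_sum (f := fun k => |b k|) (fun i _ => abs_nonneg _) hk'
    linarith [hu k hk', le_abs_self (b k)]
  -- The bound for composed derivatives is k! b D^k; for k ≤ 2 and D ≥ 1 it is at most 2 D² b.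
  refine ⟨2 * D ^ 2, by nlinarith, ?_⟩
  filter_upwards [hD, hO.mem_nhds hu₀O] with u hDu huO w n hn b hb k hk
  have hb0 : 0 ≤ b := (norm_nonneg _).trans (hb 0 n.zero_le)
  have hcomp := norm_iteratedFDerivWithin_comp_le (N := 2) (n := k) (x := u)
    (w.contMDiff.contDiffOn_comp_symm he') hH (by exact_mod_cast hk.trans hn)
    e'.open_target.uniqueDiffOn hO.uniqueDiffOn (fun v hv => e'.map_source hv.2) huO (C := b)
    (D := D) (fun i hi => by
      rw [iteratedFDerivWithin_of_isOpen i e'.open_target (e'.map_source huO.2)]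
      exact hb i (hi.trans hk)) (fun i hi hik => by
      rw [iteratedFDerivWithin_of_isOpen i hO huO]
      exact (hDu i (by omega)).trans (le_self_pow₀ hD1 (by omega)))
  rw [iteratedFDerivWithin_of_isOpen k hO huO] at hcomp
  have heq : (fun v => w (h (e.symm v))) =ᶠ[𝓝 u] (fun v => w (e'.symm v)) ∘ H := by
    filter_upwards [hO.mem_nhds huO] with v hv
    simp only [H, Function.comp_apply]
    rw [e'.left_inv hv.2]
  rw [(heq.iteratedFDeriv ℝ k).eq_of_nhds]
  have hk2 : k ≤ 2 := hk.trans hn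
  calc _ ≤ (k.factorial : ℝ) * b * D ^ k := hcomp
    _ ≤ 2 * b * D ^ 2 := by
        gcongr
        · exact_mod_cast (Nat.factorial_le hk2).trans (by norm_num)
    _ = 2 * D ^ 2 * b := by ring

namespace ChartCover

variable (𝒰 : ChartCover q M) [IsManifold (𝓡 q) ∞ M]

theorem exists_jetBound (w : C2Fun q M) : ∃ b, 𝒰.JetBound 2 w b := by
  have h : ∀ c ∈ 𝒰.centers, ∀ k ∈ Finset.range 3, ∃ b : ℝ, ∀ u ∈ 𝒰.closedBall c,
      ‖iteratedFDeriv ℝ k (fun u => w ((chartAt (EuclideanSpace ℝ (Fin q)) c).symm u)) u‖ ≤ b :=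
    fun c _ k hk => (w.contMDiff.contDiffOn_comp_symm
      (IsManifold.chart_mem_maximalAtlas c)).exists_norm_iteratedFDeriv_le (n := 2)
      (chartAt _ c).open_target (𝒰.isCompact_closedBall c) (𝒰.closedBall_subset c)
      (Nat.lt_succ_iff.1 (Finset.mem_range.1 hk))
  choose! b hb using h
  refine ⟨∑ c ∈ 𝒰.centers, ∑ k ∈ Finset.range 3, |b c k|, fun c hc u hu k hk => ?_⟩
  have hk' : k ∈ Finset.range 3 := Finset.mem_range.2 (by omega)
  calc _ ≤ b c k := hb c hc k hk' u hu
    _ ≤ |b c k| := le_abs_self _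
    _ ≤ ∑ k ∈ Finset.range 3, |b c k| :=
        Finset.single_le_sum (f := fun k => |b c k|) (fun i _ => abs_nonneg _) hk'
    _ ≤ _ := Finset.single_le_sum (f := fun c => ∑ k ∈ Finset.range 3, |b c k|)
        (fun i _ => by positivity) hc

theorem eventually_jetBound_sub (w₀ : C2Fun q M) {ε : ℝ} (hε : 0 < ε) :
    ∀ᶠ w in 𝓝 w₀, 𝒰.JetBound 2 (w - w₀ : C2Fun q M) ε := by
  have h := C2Fun.tendsto_nhds_iff.1 (tendsto_id : Tendsto id (𝓝 w₀) (𝓝 w₀))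
  have h1 : ∀ c ∈ 𝒰.centers, ∀ k : Fin 3, ∀ᶠ w : C2Fun q M in 𝓝 w₀, ∀ u ∈ 𝒰.closedBall c,
      dist (iteratedFDeriv ℝ (k : ℕ)
        (fun u => w₀ ((chartAt (EuclideanSpace ℝ (Fin q)) c).symm u)) u)
        (iteratedFDeriv ℝ (k : ℕ)
        (fun u => w ((chartAt (EuclideanSpace ℝ (Fin q)) c).symm u)) u) < ε := by
    intro c _ k
    exact Metric.tendstoUniformlyOn_iff.1 (h _ (IsManifold.chart_mem_maximalAtlas c) k _
      (𝒰.isCompact_closedBall c) (𝒰.closedBall_subset c)) ε hε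
  have h2 := (Finset.eventually_all 𝒰.centers).2 fun c hc => eventually_all.2 (h1 c hc)
  filter_upwards [h2] with w hw c hc u hu k hk
  have h3 := hw c hc ⟨k, by omega⟩ u hu
  have hut := 𝒰.closedBall_subset_target c hu
  rw [show w - w₀ = w + (-1 : ℝ) • w₀ by rw [neg_one_smul, sub_eq_add_neg],
    C2Fun.iteratedFDeriv_add_apply _ _ (IsManifold.chart_mem_maximalAtlas c) hut hk,
    C2Fun.iteratedFDeriv_smul_apply _ _ (IsManifold.chart_mem_maximalAtlas c) hut hk,
    neg_one_smul, ← sub_eq_add_neg, ← dist_eq_norm, dist_comm]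
  exact h3.le

/-- The image under h of a point of a coordinate ball lies in the core of some chart of the cover,
so nearby points land in the larger ball, where the bound on w is available. Compactness then makes
the constant uniform. -/
theorem exists_jetBound_comp {h : M → M} (hh : ContMDiff (𝓡 q) (𝓡 q) 2 h) :
    ∃ K : ℝ, 1 ≤ K ∧ ∀ w : C2Fun q M, ∀ n ≤ 2, ∀ b : ℝ,
      𝒰.JetBound n w b → 𝒰.JetBound n (w ∘ h) (K * b) := by
  have key : ∀ c ∈ 𝒰.centers, ∃ K : ℝ, 1 ≤ K ∧ ∀ u ∈ 𝒰.closedBall c,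
      ∀ w : C2Fun q M, ∀ n ≤ 2, ∀ b : ℝ, 𝒰.JetBound n w b → ∀ k ≤ n,
      ‖iteratedFDeriv ℝ k
        (fun v => w (h ((chartAt (EuclideanSpace ℝ (Fin q)) c).symm v))) u‖ ≤ K * b := by
    intro c hc
    refine (𝒰.isCompact_closedBall c).induction_on (p := fun s => ∃ K : ℝ, 1 ≤ K ∧ ∀ u ∈ s,
      ∀ w : C2Fun q M, ∀ n ≤ 2, ∀ b : ℝ, 𝒰.JetBound n w b → ∀ k ≤ n,
      ‖iteratedFDeriv ℝ k
        (fun v => w (h ((chartAt (EuclideanSpace ℝ (Fin q)) c).symm v))) u‖ ≤ K * b)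
      ⟨1, le_rfl, by simp⟩ ?_ ?_ ?_
    · rintro s t hst ⟨K, hK, h1⟩
      exact ⟨K, hK, fun u hu => h1 u (hst hu)⟩
    · rintro s t ⟨K, hK, h1⟩ ⟨K', hK', h1'⟩
      refine ⟨max K K', hK.trans (le_max_left _ _), ?_⟩
      rintro u hu w n hn b hb k hk
      have hb0 : 0 ≤ b := (norm_nonneg _).trans
        (hb c hc _ (Metric.mem_closedBall_self (by linarith [𝒰.radius_pos c])) 0 n.zero_le)
      rcases hu with hu | hu
      · exact (h1 u hu w n hn b hb k hk).trans (by gcongr; exact le_max_left _ _)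
      · exact (h1' u hu w n hn b hb k hk).trans (by gcongr; exact le_max_right _ _)
    · intro u₀ hu₀
      have hut := 𝒰.closedBall_subset_target c hu₀
      obtain ⟨c', hc', hm, hmc⟩ :=
        𝒰.exists_mem_core (h ((chartAt (EuclideanSpace ℝ (Fin q)) c).symm u₀))
      obtain ⟨K, hK, h1⟩ := exists_eventually_norm_iteratedFDeriv_comp_le hh
        (IsManifold.chart_mem_maximalAtlas c) (IsManifold.chart_mem_maximalAtlas c') hut hm
      have hcont : ContinuousAt (fun u => chartAt (EuclideanSpace ℝ (Fin q)) c'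
          (h ((chartAt (EuclideanSpace ℝ (Fin q)) c).symm u))) u₀ :=
        ((chartAt _ c').continuousAt hm).comp (f := fun u =>
          h ((chartAt (EuclideanSpace ℝ (Fin q)) c).symm u))
          (hh.continuous.continuousAt.comp ((chartAt _ c).continuousAt_symm hut))
      have h2 := hcont.eventually_mem ((𝒰.isOpen_ball c').mem_nhds (𝒰.core_subset_ball c' hmc))
      refine ⟨_, mem_nhdsWithin_of_mem_nhds (h1.and h2), K, hK, ?_⟩
      rintro u ⟨hu1, hu2⟩ w n hn b hb
      exact hu1 w n hn b fun k hk => hb c' hc' _ (𝒰.ball_subset_closedBall c' hu2) k hk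
  choose! K hK hKb using key
  have hsum : ∀ c ∈ 𝒰.centers, K c ≤ 1 + ∑ c ∈ 𝒰.centers, |K c| := fun c hc => by
    have := Finset.single_le_sum (f := fun c => |K c|) (fun i _ => abs_nonneg _) hc
    linarith [le_abs_self (K c)]
  refine ⟨1 + ∑ c ∈ 𝒰.centers, |K c|, le_add_of_nonneg_right (by positivity), ?_⟩
  intro w n hn b hb c hc u hu k hk
  have hb0 : 0 ≤ b := (norm_nonneg _).trans (hb c hc u hu k hk)
  exact (hKb c hc u hu w n hn b hb k hk).trans (by gcongr; exact hsum c hc)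

/-- The one-step constant does not depend on w, so induction gives a geometric rate. The order n
stays free because the shrinking bumps used later have uniformly bounded derivatives of order at
most 1 only. -/
theorem exists_jetBound_iterate {h : M → M} (hh : ContMDiff (𝓡 q) (𝓡 q) 2 h) :
    ∃ K : ℝ, 1 ≤ K ∧ ∀ w : C2Fun q M, ∀ n ≤ 2, ∀ b : ℝ,
      𝒰.JetBound n w b → ∀ j : ℕ, 𝒰.JetBound n (w ∘ h^[j]) (K ^ j * b) := by
  obtain ⟨K, hK, h1⟩ := 𝒰.exists_jetBound_comp hh
  refine ⟨K, hK, fun w n hn b hb j => ?_⟩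
  induction j with
  | zero => simpa using hb
  | succ j ih =>
    have hj : ContMDiff (𝓡 q) (𝓡 q) 2 h^[j] := hh.iterate j
    have := h1 ⟨w ∘ h^[j], w.contMDiff.comp hj⟩ n hn _ ih
    rw [Function.iterate_succ, ← Function.comp_assoc, pow_succ', mul_assoc]
    exact this

end ChartCover

end JetBounds

/-! ### Term by term differentiation of series. -/

theorem hasFDerivAt_tsum_of_contDiffOn {E V : Type*} [NormedAddCommGroup E]
    [NormedSpace ℝ E] [NormedAddCommGroup V] [NormedSpace ℝ V] [CompleteSpace V] {s : Set E}
    (hs : IsOpen s) (hs' : IsPreconnected s) {f : ℕ → E → V}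
    (hf : ∀ j, ContDiffOn ℝ 1 (f j) s) {v : ℕ → ℝ} (hv : Summable v)
    (hfv : ∀ j, ∀ k ≤ 1, ∀ u ∈ s, ‖iteratedFDeriv ℝ k (f j) u‖ ≤ v j) {u : E} (hu : u ∈ s) :
    HasFDerivAt (fun u => ∑' j, f j u) (∑' j, fderiv ℝ (f j) u) u := by
  refine hasFDerivAt_tsum_of_isPreconnected hv hs hs'
    (fun j x hx => (((hf j).differentiableOn one_ne_zero).differentiableAt
      (hs.mem_nhds hx)).hasFDerivAt) (fun j x hx => ?_) hu
    (Summable.of_norm_bounded hv fun j => ?_) hu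
  · rw [← norm_iteratedFDeriv_one]
    exact hfv j 1 le_rfl x hx
  · rw [← norm_iteratedFDeriv_zero (𝕜 := ℝ)]
    exact hfv j 0 zero_le_one u hu

/-- The same summable sequence dominates the orders 0, 1 and 2, so the series is differentiated
twice and the second derivative is a uniform limit of continuous maps. -/
theorem contDiffOn_tsum_of_isOpen {E : Type*} [NormedAddCommGroup E] [NormedSpace ℝ E]
    {V : Type*} [NormedAddCommGroup V] [NormedSpace ℝ V] [CompleteSpace V] {s : Set E}
    (hs : IsOpen s) (hs' : IsPreconnected s) {f : ℕ → E → V}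
    (hf : ∀ j, ContDiffOn ℝ 2 (f j) s) {v : ℕ → ℝ} (hv : Summable v)
    (hfv : ∀ j, ∀ k ≤ 2, ∀ u ∈ s, ‖iteratedFDeriv ℝ k (f j) u‖ ≤ v j) :
    ContDiffOn ℝ 2 (fun u => ∑' j, f j u) s := by
  have h1 : ∀ j, ContDiffOn ℝ 1 (fderiv ℝ (f j)) s := fun j =>
    ((contDiffOn_succ_iff_fderiv_of_isOpen (n := 1) hs).1
      (by simpa [one_add_one_eq_two] using hf j)).2.2
  have hd : ∀ u ∈ s, HasFDerivAt (fun u => ∑' j, f j u) (∑' j, fderiv ℝ (f j) u) u :=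
    fun u hu => hasFDerivAt_tsum_of_contDiffOn hs hs' (fun j => (hf j).of_le one_le_two) hv
      (fun j k hk => hfv j k (hk.trans one_le_two)) hu
  have hd2 : ∀ u ∈ s, HasFDerivAt (fun u => ∑' j, fderiv ℝ (f j) u)
      (∑' j, fderiv ℝ (fderiv ℝ (f j)) u) u :=
    fun u hu => hasFDerivAt_tsum_of_contDiffOn hs hs' h1 hv
      (fun j k hk u hu => by
        rw [norm_iteratedFDeriv_fderiv]; exact hfv j _ (by omega) u hu) hu
  have hc : ContinuousOn (fun u => ∑' j, fderiv ℝ (fderiv ℝ (f j)) u) s := by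
    refine continuousOn_tsum (fun j => (h1 j).continuousOn_fderiv_of_isOpen hs le_rfl) hv ?_
    intro j u hu
    rw [← norm_iteratedFDeriv_one, norm_iteratedFDeriv_fderiv]
    exact hfv j 2 le_rfl u hu
  rw [← one_add_one_eq_two, contDiffOn_succ_iff_fderiv_of_isOpen hs]
  refine ⟨fun u hu => (hd u hu).differentiableAt.differentiableWithinAt, by simp, ?_⟩
  have h2 : ContDiffOn ℝ (0 + 1) (fun u => ∑' j, fderiv ℝ (f j) u) s := by
    rw [contDiffOn_succ_iff_fderiv_of_isOpen hs]
    refine ⟨fun u hu => (hd2 u hu).differentiableAt.differentiableWithinAt, by simp, ?_⟩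
    exact contDiffOn_zero.2 (hc.congr fun u hu => (hd2 u hu).fderiv)
  rw [zero_add] at h2
  exact h2.congr fun u hu => (hd u hu).fderiv

/-! ### The synchronization as a C² function, continuous in the observation. -/

section DelaySeries

variable {q : ℕ} {M : Type*} [TopologicalSpace M] [ChartedSpace (EuclideanSpace ℝ (Fin q)) M]

/-- The data of a series `∑ j, w (h^j m) • a j` whose coefficients decay faster than the derivatives
of `w ∘ h^j` can grow. -/
structure DelaySeries (𝒰 : ChartCover q M) (V : Type*) [NormedAddCommGroup V]
    [NormedSpace ℝ V] where
  /-- The map along whose orbits the observations are summed. -/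
  map : M → M
  /-- The coefficients of the series. -/
  coeff : ℕ → V
  /-- The growth rate of the derivatives. -/
  growth : ℝ
  contMDiff_map : ContMDiff (𝓡 q) (𝓡 q) 2 map
  one_le_growth : 1 ≤ growth
  jetBound_iterate : ∀ w : C2Fun q M, ∀ n ≤ 2, ∀ b : ℝ, 𝒰.JetBound n w b →
    ∀ j : ℕ, 𝒰.JetBound n (w ∘ map^[j]) (growth ^ j * b)
  summable_growth : Summable fun j => growth ^ j * ‖coeff j‖

namespace DelaySeries

variable {V : Type*} [NormedAddCommGroup V] [NormedSpace ℝ V] {𝒰 : ChartCover q M}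
  (𝒮 : DelaySeries 𝒰 V)

/-- The function `w ∘ h^j`. -/
noncomputable def shift (w : C2Fun q M) (j : ℕ) : C2Fun q M :=
  ⟨w ∘ 𝒮.map^[j], w.contMDiff.comp (𝒮.contMDiff_map.iterate j)⟩

theorem jetBound_shift {w : C2Fun q M} {n : ℕ} (hn : n ≤ 2) {b : ℝ} (h : 𝒰.JetBound n w b)
    (j : ℕ) : 𝒰.JetBound n (𝒮.shift w j) (𝒮.growth ^ j * b) :=
  𝒮.jetBound_iterate w n hn b h j

/-- The sum of the norms of the coefficients, weighted by the growth rate. -/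
noncomputable def weight : ℝ := ∑' j, 𝒮.growth ^ j * ‖𝒮.coeff j‖

theorem growth_nonneg : 0 ≤ 𝒮.growth := zero_le_one.trans 𝒮.one_le_growth

theorem weight_nonneg : 0 ≤ 𝒮.weight :=
  tsum_nonneg fun j => mul_nonneg (pow_nonneg 𝒮.growth_nonneg j) (norm_nonneg _)

theorem summable_bound (b : ℝ) : Summable fun j => 𝒮.growth ^ j * b * ‖𝒮.coeff j‖ := by
  simpa [mul_right_comm, mul_assoc, mul_comm b] using 𝒮.summable_growth.mul_left b

theorem tsum_bound (b : ℝ) :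
    ∑' j, 𝒮.growth ^ j * b * ‖𝒮.coeff j‖ = b * 𝒮.weight := by
  rw [weight, ← tsum_mul_left]
  exact tsum_congr fun j => by ring

theorem norm_term_le {w : C2Fun q M} {n : ℕ} (hn : n ≤ 2) {b : ℝ} (h : 𝒰.JetBound n w b) (m : M)
    (j : ℕ) : ‖w (𝒮.map^[j] m) • 𝒮.coeff j‖ ≤ 𝒮.growth ^ j * b * ‖𝒮.coeff j‖ := by
  rw [norm_smul]
  gcongr
  exact (𝒮.jetBound_shift hn h j).abs_le m

variable [IsManifold (𝓡 q) ∞ M]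

theorem norm_iteratedFDeriv_term_le {w : C2Fun q M} {n : ℕ} (hn : n ≤ 2) {b : ℝ}
    (h : 𝒰.JetBound n w b) {c : M} (hc : c ∈ 𝒰.centers) (j : ℕ) {k : ℕ} (hk : k ≤ n)
    {u : EuclideanSpace ℝ (Fin q)} (hu : u ∈ 𝒰.closedBall c) :
    ‖iteratedFDeriv ℝ k (fun u => 𝒮.shift w j
      ((chartAt (EuclideanSpace ℝ (Fin q)) c).symm u) • 𝒮.coeff j) u‖ ≤
      𝒮.growth ^ j * b * ‖𝒮.coeff j‖ := by
  have h1 := ((𝒮.shift w j).contDiffAt_comp_symm (IsManifold.chart_mem_maximalAtlas c)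
    (𝒰.closedBall_subset_target c hu))
  have h2 := ContinuousLinearMap.norm_iteratedFDeriv_comp_left
    ((1 : ℝ →L[ℝ] ℝ).smulRight (𝒮.coeff j)) h1 (n := k) (by exact_mod_cast hk.trans hn)
  refine h2.trans ?_
  rw [ContinuousLinearMap.norm_smulRight_apply, norm_one, one_mul, mul_comm]
  gcongr
  exact 𝒮.jetBound_shift hn h j c hc u hu k hk

variable [CompleteSpace V]

theorem summable (w : C2Fun q M) (m : M) : Summable fun j => w (𝒮.map^[j] m) • 𝒮.coeff j := by
  obtain ⟨b, hb⟩ := 𝒰.exists_jetBound w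
  exact Summable.of_norm_bounded (𝒮.summable_bound b) (𝒮.norm_term_le le_rfl hb m)

/-- The sum of the series `∑ j, w (h^j m) • a j`, as a linear function of the observation `w`. -/
noncomputable def sync : C2Fun q M →ₗ[ℝ] M → V where
  toFun w m := ∑' j, w (𝒮.map^[j] m) • 𝒮.coeff j
  map_add' w w' := by
    ext m
    rw [Pi.add_apply, ← (𝒮.summable w m).tsum_add (𝒮.summable w' m)]
    exact tsum_congr fun j => add_smul _ _ _
  map_smul' t w := by
    ext m
    rw [RingHom.id_apply, Pi.smul_apply, ← (𝒮.summable w m).tsum_const_smul]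
    exact tsum_congr fun j => mul_smul _ _ _

theorem hasSum (w : C2Fun q M) (m : M) :
    HasSum (fun j => w (𝒮.map^[j] m) • 𝒮.coeff j) (𝒮.sync w m) :=
  (𝒮.summable w m).hasSum

theorem norm_sync_le {w : C2Fun q M} {n : ℕ} (hn : n ≤ 2) {b : ℝ} (h : 𝒰.JetBound n w b) (m : M) :
    ‖𝒮.sync w m‖ ≤ b * 𝒮.weight := by
  rw [← 𝒮.tsum_bound]
  exact tsum_of_norm_bounded (𝒮.summable_bound b).hasSum (𝒮.norm_term_le hn h m)

theorem hasFDerivAt_sync (w : C2Fun q M) {c : M} (hc : c ∈ 𝒰.centers)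
    {u : EuclideanSpace ℝ (Fin q)} (hu : u ∈ 𝒰.ball c) :
    HasFDerivAt (fun u => 𝒮.sync w ((chartAt (EuclideanSpace ℝ (Fin q)) c).symm u))
      (∑' j, fderiv ℝ (fun u => 𝒮.shift w j
        ((chartAt (EuclideanSpace ℝ (Fin q)) c).symm u) • 𝒮.coeff j) u) u := by
  obtain ⟨b, hb⟩ := 𝒰.exists_jetBound w
  refine hasFDerivAt_tsum_of_contDiffOn (𝒰.isOpen_ball c) (convex_ball _ _).isPreconnected
    (fun j => ?_) (𝒮.summable_bound b) (fun j k hk u hu =>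
      𝒮.norm_iteratedFDeriv_term_le le_rfl hb hc j (by omega) (𝒰.ball_subset_closedBall c hu)) hu
  exact ((((𝒮.shift w j).contMDiff.contDiffOn_comp_symm
    (IsManifold.chart_mem_maximalAtlas c)).mono (𝒰.ball_subset_target c)).of_le
      one_le_two).smul contDiffOn_const

theorem contDiffOn_sync (w : C2Fun q M) {c : M} (hc : c ∈ 𝒰.centers) :
    ContDiffOn ℝ 2 (fun u => 𝒮.sync w ((chartAt (EuclideanSpace ℝ (Fin q)) c).symm u))
      (𝒰.ball c) := by
  obtain ⟨b, hb⟩ := 𝒰.exists_jetBound w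
  refine contDiffOn_tsum_of_isOpen (𝒰.isOpen_ball c) (convex_ball _ _).isPreconnected
    (fun j => ?_) (𝒮.summable_bound b) (fun j k hk u hu =>
      𝒮.norm_iteratedFDeriv_term_le le_rfl hb hc j hk (𝒰.ball_subset_closedBall c hu))
  exact (((𝒮.shift w j).contMDiff.contDiffOn_comp_symm
    (IsManifold.chart_mem_maximalAtlas c)).mono (𝒰.ball_subset_target c)).smul contDiffOn_const

theorem norm_fderiv_sync_le {w : C2Fun q M} {n : ℕ} (hn : n ≤ 2) (hn' : 1 ≤ n) {b : ℝ}
    (h : 𝒰.JetBound n w b) {c : M} (hc : c ∈ 𝒰.centers)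
    {u : EuclideanSpace ℝ (Fin q)} (hu : u ∈ 𝒰.ball c) :
    ‖fderiv ℝ (fun u => 𝒮.sync w ((chartAt (EuclideanSpace ℝ (Fin q)) c).symm u)) u‖ ≤
      b * 𝒮.weight := by
  rw [(𝒮.hasFDerivAt_sync w hc hu).fderiv, ← 𝒮.tsum_bound]
  refine tsum_of_norm_bounded (𝒮.summable_bound b).hasSum fun j => ?_
  rw [← norm_iteratedFDeriv_one]
  exact 𝒮.norm_iteratedFDeriv_term_le hn h hc j hn' (𝒰.ball_subset_closedBall c hu)

theorem contMDiff_sync (w : C2Fun q M) : ContMDiff (𝓡 q) 𝓘(ℝ, V) 2 (𝒮.sync w) := by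
  intro m
  obtain ⟨c, hc, hm, hmc⟩ := 𝒰.exists_mem_core m
  have h1 : ContMDiffAt 𝓘(ℝ, EuclideanSpace ℝ (Fin q)) 𝓘(ℝ, V) 2
      (fun u => 𝒮.sync w ((chartAt (EuclideanSpace ℝ (Fin q)) c).symm u))
      (chartAt (EuclideanSpace ℝ (Fin q)) c m) :=
    ((𝒮.contDiffOn_sync w hc).contDiffAt
      ((𝒰.isOpen_ball c).mem_nhds (𝒰.core_subset_ball c hmc))).contMDiffAt
  have h2 : ContMDiffAt (𝓡 q) (𝓡 q) 2 (chartAt (EuclideanSpace ℝ (Fin q)) c) m :=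
    ((contMDiffOn_of_mem_maximalAtlas (IsManifold.chart_mem_maximalAtlas (n := ∞) c)).contMDiffAt
      ((chartAt _ c).open_source.mem_nhds hm)).of_le ENat.LEInfty.out
  refine (h1.comp m h2).congr_of_eventuallyEq ?_
  filter_upwards [(chartAt (EuclideanSpace ℝ (Fin q)) c).open_source.mem_nhds hm] with x hx
  simp only [Function.comp_apply]
  rw [OpenPartialHomeomorph.left_inv _ hx]

/-- By linearity the difference is the synchronization of w - w₀, whose jets are small near w₀.
Dividing ε by the weight plus one gives a strict inequality even when the weight is zero. -/
theorem eventually_norm_sync_sub_le (w₀ : C2Fun q M) {ε : ℝ} (hε : 0 < ε) :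
    ∀ᶠ w in 𝓝 w₀, (∀ m, ‖𝒮.sync w m - 𝒮.sync w₀ m‖ < ε) ∧ ∀ c ∈ 𝒰.centers, ∀ u ∈ 𝒰.ball c,
      ‖fderiv ℝ (fun u => 𝒮.sync w ((chartAt (EuclideanSpace ℝ (Fin q)) c).symm u)) u -
        fderiv ℝ (fun u => 𝒮.sync w₀ ((chartAt (EuclideanSpace ℝ (Fin q)) c).symm u)) u‖ < ε := by
  have hw := 𝒮.weight_nonneg
  filter_upwards [𝒰.eventually_jetBound_sub w₀ (ε := ε / (𝒮.weight + 1)) (by positivity)] with w h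
  have hlt : ε / (𝒮.weight + 1) * 𝒮.weight < ε := by
    rw [div_mul_eq_mul_div, div_lt_iff₀ (by positivity)]
    nlinarith
  refine ⟨fun m => ?_, fun c hc u hu => ?_⟩
  · rw [← Pi.sub_apply, ← map_sub]
    exact (𝒮.norm_sync_le le_rfl h m).trans_lt hlt
  · rw [← fderiv_fun_sub (𝒮.hasFDerivAt_sync w hc hu).differentiableAt
      (𝒮.hasFDerivAt_sync w₀ hc hu).differentiableAt]
    have := (𝒮.norm_fderiv_sync_le le_rfl one_le_two h hc hu).trans_lt hlt
    rwa [map_sub] at this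

theorem continuous_uncurry_sync : Continuous fun x : C2Fun q M × M => 𝒮.sync x.1 x.2 := by
  rw [continuous_iff_continuousAt]
  rintro ⟨w₀, m₀⟩
  rw [ContinuousAt, Metric.tendsto_nhds]
  intro ε hε
  have h1 := (continuous_fst.tendsto (w₀, m₀)).eventually
    (𝒮.eventually_norm_sync_sub_le w₀ (half_pos hε))
  have h2 := (continuous_snd.tendsto (w₀, m₀)).eventually
    (Metric.tendsto_nhds.1 ((𝒮.contMDiff_sync w₀).continuous.tendsto m₀) _ (half_pos hε))
  filter_upwards [h1, h2] with x hx1 hx2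
  have h3 := hx1.1 x.2
  rw [← dist_eq_norm] at h3
  linarith [dist_triangle (𝒮.sync x.1 x.2) (𝒮.sync w₀ x.2) (𝒮.sync w₀ m₀)]

theorem continuousAt_uncurry_fderiv_sync (w₀ : C2Fun q M) {c : M} (hc : c ∈ 𝒰.centers)
    {u₀ : EuclideanSpace ℝ (Fin q)} (hu₀ : u₀ ∈ 𝒰.ball c) :
    ContinuousAt (fun x : C2Fun q M × EuclideanSpace ℝ (Fin q) => fderiv ℝ (fun u =>
      𝒮.sync x.1 ((chartAt (EuclideanSpace ℝ (Fin q)) c).symm u)) x.2) (w₀, u₀) := by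
  rw [ContinuousAt, Metric.tendsto_nhds]
  intro ε hε
  have h1 := (continuous_fst.tendsto (w₀, u₀)).eventually
    (𝒮.eventually_norm_sync_sub_le w₀ (half_pos hε))
  have hc1 : ContinuousAt (fderiv ℝ (fun u =>
      𝒮.sync w₀ ((chartAt (EuclideanSpace ℝ (Fin q)) c).symm u))) u₀ :=
    ((𝒮.contDiffOn_sync w₀ hc).continuousOn_fderiv_of_isOpen (𝒰.isOpen_ball c)
      one_le_two).continuousAt ((𝒰.isOpen_ball c).mem_nhds hu₀)
  have h2 := (continuous_snd.tendsto (w₀, u₀)).eventually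
    (Metric.tendsto_nhds.1 hc1 _ (half_pos hε))
  have h4 := (continuous_snd.tendsto (w₀, u₀)).eventually ((𝒰.isOpen_ball c).mem_nhds hu₀)
  filter_upwards [h1, h2, h4] with x hx1 hx2 hx4
  have h3 := hx1.2 c hc x.2 hx4
  rw [← dist_eq_norm] at h3
  refine (dist_triangle _ (fderiv ℝ (fun u =>
      𝒮.sync w₀ ((chartAt (EuclideanSpace ℝ (Fin q)) c).symm u)) x.2) _).trans_lt ?_
  linarith

end DelaySeries

end DelaySeries

/-! ### Derivatives on the manifold and the differentiated series. -/

section TangentMaps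

variable {q : ℕ} {M : Type*} [TopologicalSpace M] [ChartedSpace (EuclideanSpace ℝ (Fin q)) M]
  {V : Type*} [NormedAddCommGroup V] [NormedSpace ℝ V]

/-- The derivative of a vector valued function at a point of the manifold, as a linear map on the
model space. -/
noncomputable def tder (f : M → V) (m : M) : EuclideanSpace ℝ (Fin q) →L[ℝ] V :=
  mfderiv (𝓡 q) 𝓘(ℝ, V) f m

/-- The derivative of a map between manifolds, as a linear endomorphism of the model space. -/
noncomputable def tmap {M' : Type*} [TopologicalSpace M']
    [ChartedSpace (EuclideanSpace ℝ (Fin q)) M'] (h : M → M') (m : M) :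
    EuclideanSpace ℝ (Fin q) →L[ℝ] EuclideanSpace ℝ (Fin q) :=
  mfderiv (𝓡 q) (𝓡 q) h m

theorem tder_comp {f : M → V} {h : M → M} {m : M} (hf : MDifferentiableAt (𝓡 q) 𝓘(ℝ, V) f (h m))
    (hh : MDifferentiableAt (𝓡 q) (𝓡 q) h m) :
    tder (q := q) (f ∘ h) m = (tder (q := q) f (h m)).comp (tmap h m) :=
  mfderiv_comp m hf hh

theorem tmap_comp {h g : M → M} {m : M} (hh : MDifferentiableAt (𝓡 q) (𝓡 q) h (g m))
    (hg : MDifferentiableAt (𝓡 q) (𝓡 q) g m) :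
    tmap (q := q) (h ∘ g) m = (tmap (q := q) h (g m)).comp (tmap g m) :=
  mfderiv_comp m hh hg

theorem tmap_id (m : M) : tmap (q := q) (id : M → M) m = ContinuousLinearMap.id ℝ _ :=
  mfderiv_id

theorem tder_congr {f g : M → V} {m : M} (h : f =ᶠ[𝓝 m] g) :
    tder (q := q) f m = tder (q := q) g m :=
  h.mfderiv_eq

theorem tder_const (v : V) (m : M) : tder (q := q) (fun _ : M => v) m = 0 :=
  mfderiv_const

theorem tmap_chartAt_self [IsManifold (𝓡 q) ∞ M] (c : M) :
    tmap (q := q) (chartAt (EuclideanSpace ℝ (Fin q)) c) c = ContinuousLinearMap.id ℝ _ := by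
  have : IsManifold (𝓡 q) 1 M := IsManifold.of_le (n := ∞) ENat.LEInfty.out
  have h := mfderiv_extChartAt_self (I := 𝓡 q) (x := c)
  simp only [extChartAt, OpenPartialHomeomorph.extend, modelWithCornersSelf_partialEquiv] at h
  exact h

theorem tder_eq_fderiv_comp [IsManifold (𝓡 q) ∞ M] {f : M → V} {c m : M}
    (hm : m ∈ (chartAt (EuclideanSpace ℝ (Fin q)) c).source)
    (hf : MDifferentiableAt (𝓡 q) 𝓘(ℝ, V) f m) :
    tder (q := q) f m = (fderiv ℝ (fun u => f ((chartAt (EuclideanSpace ℝ (Fin q)) c).symm u))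
      (chartAt (EuclideanSpace ℝ (Fin q)) c m)).comp
        (tmap (chartAt (EuclideanSpace ℝ (Fin q)) c) m) := by
  have : IsManifold (𝓡 q) 1 M := IsManifold.of_le (n := ∞) ENat.LEInfty.out
  set e := chartAt (EuclideanSpace ℝ (Fin q)) c with he
  have h1 : MDifferentiableAt (𝓡 q) (𝓡 q) e m := (mdifferentiable_chart c).mdifferentiableAt hm
  have h2 : MDifferentiableAt (𝓡 q) 𝓘(ℝ, V) (fun u => f (e.symm u)) (e m) := by
    refine MDifferentiableAt.comp (I' := 𝓡 q) (e m) ?_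
      ((mdifferentiable_chart c).mdifferentiableAt_symm (e.map_source hm))
    rwa [e.left_inv hm]
  have h3 : f =ᶠ[𝓝 m] (fun u => f (e.symm u)) ∘ e := by
    filter_upwards [e.open_source.mem_nhds hm] with x hx
    simp only [Function.comp_apply]
    rw [e.left_inv hx]
  rw [tder_congr h3, ← mfderiv_eq_fderiv]
  exact mfderiv_comp m h2 h1

theorem bijective_tmap_chartAt [IsManifold (𝓡 q) ∞ M] {c m : M}
    (hm : m ∈ (chartAt (EuclideanSpace ℝ (Fin q)) c).source) :
    Function.Bijective (tmap (q := q) (chartAt (EuclideanSpace ℝ (Fin q)) c) m) :=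
  have : IsManifold (𝓡 q) 1 M := IsManifold.of_le (n := ∞) ENat.LEInfty.out
  (mdifferentiable_chart c).mfderiv_bijective hm

namespace DelaySeries

variable {𝒰 : ChartCover q M} (𝒮 : DelaySeries 𝒰 V)

theorem tder_shift (w : C2Fun q M) (j : ℕ) (m : M) :
    tder (q := q) (𝒮.shift w j) m =
      (tder (q := q) w (𝒮.map^[j] m)).comp (tmap 𝒮.map^[j] m) :=
  tder_comp (w.contMDiff.mdifferentiableAt two_ne_zero)
    ((𝒮.contMDiff_map.iterate j).mdifferentiableAt two_ne_zero)

variable [IsManifold (𝓡 q) ∞ M]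

/-- The majorant for passing to the limit of shrinking bumps in the differentiated series; for that
purpose it may use only first-order jets. -/
theorem exists_norm_tder_shift_le (m : M) (u : EuclideanSpace ℝ (Fin q)) :
    ∃ R : ℝ, ∀ w : C2Fun q M, ∀ b, 𝒰.JetBound 1 w b → ∀ j,
      ‖tder (q := q) (𝒮.shift w j) m u • 𝒮.coeff j‖ ≤ 𝒮.growth ^ j * b * ‖𝒮.coeff j‖ * R := by
  obtain ⟨c, hc, hm, hmc⟩ := 𝒰.exists_mem_core m
  refine ⟨‖tmap (q := q) (chartAt (EuclideanSpace ℝ (Fin q)) c) m u‖, fun w b hb j => ?_⟩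
  have h1 := 𝒮.jetBound_shift one_le_two hb j c hc _
    (𝒰.ball_subset_closedBall c (𝒰.core_subset_ball c hmc)) 1 le_rfl
  rw [norm_iteratedFDeriv_one] at h1
  rw [tder_eq_fderiv_comp hm ((𝒮.shift w j).contMDiff.mdifferentiableAt two_ne_zero), norm_smul,
    mul_right_comm]
  refine mul_le_mul_of_nonneg_right ?_ (norm_nonneg _)
  rw [ContinuousLinearMap.comp_apply]
  exact (ContinuousLinearMap.le_opNorm _ _).trans
    (mul_le_mul_of_nonneg_right h1 (norm_nonneg _))

variable [CompleteSpace V]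

theorem hasSum_tder_sync (w : C2Fun q M) (m : M) (u : EuclideanSpace ℝ (Fin q)) :
    HasSum (fun j => tder (q := q) w (𝒮.map^[j] m) (tmap 𝒮.map^[j] m u) • 𝒮.coeff j)
      (tder (q := q) (𝒮.sync w) m u) := by
  obtain ⟨c, hc, hm, hmc⟩ := 𝒰.exists_mem_core m
  have hu := 𝒰.core_subset_ball c hmc
  obtain ⟨b, hb⟩ := 𝒰.exists_jetBound w
  have h1 : Summable fun j => fderiv ℝ (fun u => 𝒮.shift w j
      ((chartAt (EuclideanSpace ℝ (Fin q)) c).symm u) • 𝒮.coeff j)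
        (chartAt (EuclideanSpace ℝ (Fin q)) c m) := by
    refine Summable.of_norm_bounded (𝒮.summable_bound b) fun j => ?_
    rw [← norm_iteratedFDeriv_one]
    exact 𝒮.norm_iteratedFDeriv_term_le le_rfl hb hc j one_le_two (𝒰.ball_subset_closedBall c hu)
  have h2 := h1.hasSum
  rw [← (𝒮.hasFDerivAt_sync w hc hu).fderiv] at h2
  have h3 := h2.mapL (ContinuousLinearMap.apply ℝ V
    (tmap (chartAt (EuclideanSpace ℝ (Fin q)) c) m u))
  rw [tder_eq_fderiv_comp hm ((𝒮.contMDiff_sync w).mdifferentiableAt two_ne_zero)]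
  refine h3.congr_fun fun j => ?_
  have h4 := 𝒮.tder_shift w j m
  rw [tder_eq_fderiv_comp hm ((𝒮.shift w j).contMDiff.mdifferentiableAt two_ne_zero)] at h4
  have h5 := ((𝒮.shift w j).contDiffAt_comp_symm (IsManifold.chart_mem_maximalAtlas c)
    (𝒰.ball_subset_target c hu)).differentiableAt two_ne_zero
  have h6 := congrArg (fun L => L u) h4
  simp only [ContinuousLinearMap.comp_apply] at h6
  rw [← h6, ContinuousLinearMap.apply_apply, fderiv_smul_const h5]
  rfl

end DelaySeries

end TangentMaps

/-! ### Shrinking bump functions in a chart. -/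

section Bumps

variable {q : ℕ} {M : Type*} [TopologicalSpace M] [ChartedSpace (EuclideanSpace ℝ (Fin q)) M]

/-- The functions `ψ r`, `0 < r < ρ`, are the rescaled copies `g (r⁻¹ (x - x₀))` of a profile `g` in
the chart around `z₀`. -/
structure IsBumpFamily (z₀ : M) (g : EuclideanSpace ℝ (Fin q) → ℝ) (ρ : ℝ) (ψ : ℝ → C2Fun q M) :
    Prop where
  contDiff : ContDiff ℝ 2 g
  eq_zero_of_lt : ∀ v, 1 < ‖v‖ → g v = 0
  pos : 0 < ρ
  closedBall_subset : Metric.closedBall (chartAt (EuclideanSpace ℝ (Fin q)) z₀ z₀) ρ ⊆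
    (chartAt (EuclideanSpace ℝ (Fin q)) z₀).target
  apply_eq : ∀ r ∈ Set.Ioo 0 ρ, ∀ z ∈ (chartAt (EuclideanSpace ℝ (Fin q)) z₀).source,
    ψ r z = g (r⁻¹ • (chartAt (EuclideanSpace ℝ (Fin q)) z₀ z -
      chartAt (EuclideanSpace ℝ (Fin q)) z₀ z₀))
  apply_eq_zero : ∀ r ∈ Set.Ioo 0 ρ, ∀ z ∉ (chartAt (EuclideanSpace ℝ (Fin q)) z₀).source,
    ψ r z = 0

/-- Closedness, which comes from the Hausdorff property, is what makes extension by zero from the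
chart a C² function on M. -/
theorem isClosed_symm_image_closedBall [T2Space M] {z₀ : M} {r : ℝ}
    (h : Metric.closedBall (chartAt (EuclideanSpace ℝ (Fin q)) z₀ z₀) r ⊆
      (chartAt (EuclideanSpace ℝ (Fin q)) z₀).target) :
    IsClosed ((chartAt (EuclideanSpace ℝ (Fin q)) z₀).symm ''
      Metric.closedBall (chartAt (EuclideanSpace ℝ (Fin q)) z₀ z₀) r) :=
  ((ProperSpace.isCompact_closedBall _ _).image_of_continuousOn
    ((chartAt _ z₀).continuousOn_symm.mono h)).isClosed

theorem scaled_profile_eq_zero {z₀ : M} {g : EuclideanSpace ℝ (Fin q) → ℝ}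
    (hg : ∀ v, 1 < ‖v‖ → g v = 0) {r : ℝ} (hr : 0 < r) {z : M}
    (hz : z ∈ (chartAt (EuclideanSpace ℝ (Fin q)) z₀).source)
    (hzr : z ∉ (chartAt (EuclideanSpace ℝ (Fin q)) z₀).symm ''
      Metric.closedBall (chartAt (EuclideanSpace ℝ (Fin q)) z₀ z₀) r) :
    g (r⁻¹ • (chartAt (EuclideanSpace ℝ (Fin q)) z₀ z -
      chartAt (EuclideanSpace ℝ (Fin q)) z₀ z₀)) = 0 := by
  apply hg
  rw [norm_smul, norm_inv, Real.norm_of_nonneg hr.le, ← div_eq_inv_mul, one_lt_div hr]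
  by_contra! h
  exact hzr ⟨_, by rwa [Metric.mem_closedBall, dist_eq_norm],
    OpenPartialHomeomorph.left_inv _ hz⟩

theorem exists_isBumpFamily [T2Space M] [IsManifold (𝓡 q) ∞ M] (z₀ : M)
    {g : EuclideanSpace ℝ (Fin q) → ℝ} (hg : ContDiff ℝ 2 g) (hg0 : ∀ v, 1 < ‖v‖ → g v = 0) :
    ∃ ρ ψ, IsBumpFamily z₀ g ρ ψ := by
  classical
  set e := chartAt (EuclideanSpace ℝ (Fin q)) z₀ with he
  obtain ⟨ρ, hρ, hsub⟩ := Metric.nhds_basis_closedBall.mem_iff.1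
      (e.open_target.mem_nhds (mem_chart_target _ z₀))
  let f : ℝ → M → ℝ := fun r z => if z ∈ e.source then g (r⁻¹ • (e z - e z₀)) else 0
  have hf : ∀ r ∈ Set.Ioo 0 ρ, ContMDiff (𝓡 q) 𝓘(ℝ, ℝ) 2 (f r) := by
    intro r hr m
    by_cases hm : m ∈ e.source
    · have h1 : ContMDiffAt (𝓡 q) (𝓡 q) 2 e m :=
        ((contMDiffOn_of_mem_maximalAtlas
          (IsManifold.chart_mem_maximalAtlas (n := ∞) z₀)).contMDiffAt
          (e.open_source.mem_nhds hm)).of_le ENat.LEInfty.out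
      have h2 : ContDiff ℝ 2 fun v => g (r⁻¹ • (v - e z₀)) := by fun_prop
      refine (h2.contMDiff.contMDiffAt.comp m h1).congr_of_eventuallyEq ?_
      filter_upwards [e.open_source.mem_nhds hm] with x hx
      simp [f, hx]
    · have hK := isClosed_symm_image_closedBall
        ((Metric.closedBall_subset_closedBall hr.2.le).trans hsub)
      have hmK : m ∉ e.symm '' Metric.closedBall (e z₀) r := by
        rintro ⟨v, hv, rfl⟩
        exact hm (e.map_target (hsub (Metric.closedBall_subset_closedBall hr.2.le hv)))
      refine (contMDiffAt_const (c := (0 : ℝ))).congr_of_eventuallyEq ?_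
      filter_upwards [hK.isOpen_compl.mem_nhds hmK] with x hx
      by_cases hxs : x ∈ e.source
      · simp only [f, if_pos hxs]
        exact scaled_profile_eq_zero hg0 hr.1 hxs hx
      · simp [f, hxs]
  have hψ : ∀ r ∈ Set.Ioo 0 ρ, ∃ ψ : C2Fun q M, ⇑ψ = f r := fun r hr => ⟨⟨f r, hf r hr⟩, rfl⟩
  choose! ψ hψ using hψ
  refine ⟨ρ, ψ, hg, hg0, hρ, hsub, fun r hr z hz => ?_, fun r hr z hz => ?_⟩
  · rw [hψ r hr]
    exact if_pos hz
  · rw [hψ r hr]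
    exact if_neg hz

namespace IsBumpFamily

variable {z₀ : M} {g : EuclideanSpace ℝ (Fin q) → ℝ} {ρ : ℝ} {ψ : ℝ → C2Fun q M}

theorem apply_center (h : IsBumpFamily z₀ g ρ ψ) {r : ℝ} (hr : r ∈ Set.Ioo 0 ρ) : ψ r z₀ = g 0 := by
  rw [h.apply_eq r hr _ (mem_chart_source _ z₀), sub_self, smul_zero]

theorem abs_le (h : IsBumpFamily z₀ g ρ ψ) {b : ℝ} (hb : ∀ v, |g v| ≤ b) {r : ℝ} (hr : r ∈ Set.Ioo 0 ρ) (z : M) :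
    |ψ r z| ≤ b := by
  by_cases hz : z ∈ (chartAt (EuclideanSpace ℝ (Fin q)) z₀).source
  · rw [h.apply_eq r hr z hz]; exact hb _
  · rw [h.apply_eq_zero r hr z hz, abs_zero]; exact (abs_nonneg _).trans (hb 0)

theorem eventuallyEq_zero [T2Space M] (h : IsBumpFamily z₀ g ρ ψ) {r : ℝ}
    (hr : r ∈ Set.Ioo 0 ρ) {r' : ℝ} (hrr' : r ≤ r')
    (hr' : r' ≤ ρ) {z : M} (hz : z ∉ (chartAt (EuclideanSpace ℝ (Fin q)) z₀).symm ''
      Metric.closedBall (chartAt (EuclideanSpace ℝ (Fin q)) z₀ z₀) r') :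
    ψ r =ᶠ[𝓝 z] fun _ => 0 := by
  have hK := isClosed_symm_image_closedBall
    ((Metric.closedBall_subset_closedBall hr').trans h.closedBall_subset)
  filter_upwards [hK.isOpen_compl.mem_nhds hz] with x hx
  by_cases hxs : x ∈ (chartAt (EuclideanSpace ℝ (Fin q)) z₀).source
  · rw [h.apply_eq r hr x hxs]
    exact scaled_profile_eq_zero h.eq_zero_of_lt hr.1 hxs
      fun h' => hx (Set.image_mono (Metric.closedBall_subset_closedBall hrr') h')
  · exact h.apply_eq_zero r hr x hxs

theorem eventually_mem_Ioo (h : IsBumpFamily z₀ g ρ ψ) : ∀ᶠ r in 𝓝[>] (0 : ℝ), r ∈ Set.Ioo 0 ρ := Ioo_mem_nhdsGT h.pos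

theorem eventually_eventuallyEq_zero (h : IsBumpFamily z₀ g ρ ψ) [T2Space M] {z : M} (hz : z ≠ z₀) :
    ∀ᶠ r in 𝓝[>] (0 : ℝ), ψ r =ᶠ[𝓝 z] fun _ => 0 := by
  set e := chartAt (EuclideanSpace ℝ (Fin q)) z₀ with he
  by_cases hzs : z ∈ e.source
  · have hne : 0 < dist (e z) (e z₀) :=
      dist_pos.2 fun h' => hz (e.injOn hzs (mem_chart_source _ z₀) h')
    filter_upwards [h.eventually_mem_Ioo, Ioo_mem_nhdsGT hne] with r hr hr2
    refine h.eventuallyEq_zero hr le_rfl hr.2.le ?_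
    rintro ⟨v, hv, hvz⟩
    have hvt := h.closedBall_subset (Metric.closedBall_subset_closedBall hr.2.le hv)
    rw [← hvz, e.right_inv hvt] at hr2
    exact (Metric.mem_closedBall.1 hv).not_gt hr2.2
  · filter_upwards [h.eventually_mem_Ioo] with r hr
    refine h.eventuallyEq_zero hr le_rfl hr.2.le ?_
    rintro ⟨v, hv, rfl⟩
    exact hzs (e.map_target (h.closedBall_subset
      (Metric.closedBall_subset_closedBall hr.2.le hv)))

theorem comp_symm_eventuallyEq (h : IsBumpFamily z₀ g ρ ψ) {r : ℝ} (hr : r ∈ Set.Ioo 0 ρ)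
    {v : EuclideanSpace ℝ (Fin q)}
    (hv : v ∈ (chartAt (EuclideanSpace ℝ (Fin q)) z₀).target) :
    (fun u => (r • ψ r) ((chartAt (EuclideanSpace ℝ (Fin q)) z₀).symm u)) =ᶠ[𝓝 v]
      fun u => r * g (r⁻¹ • (u - chartAt (EuclideanSpace ℝ (Fin q)) z₀ z₀)) := by
  filter_upwards [(chartAt (EuclideanSpace ℝ (Fin q)) z₀).open_target.mem_nhds hv] with u hu
  rw [ContMDiffMap.coe_smul, Pi.smul_apply, smul_eq_mul, h.apply_eq r hr _
    (OpenPartialHomeomorph.map_target _ hu), OpenPartialHomeomorph.right_inv _ hu]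

theorem hasFDerivAt_comp_symm (h : IsBumpFamily z₀ g ρ ψ) {r : ℝ} (hr : r ∈ Set.Ioo 0 ρ)
    {v : EuclideanSpace ℝ (Fin q)}
    (hv : v ∈ (chartAt (EuclideanSpace ℝ (Fin q)) z₀).target) :
    HasFDerivAt (fun u => (r • ψ r) ((chartAt (EuclideanSpace ℝ (Fin q)) z₀).symm u))
      (fderiv ℝ g (r⁻¹ • (v - chartAt (EuclideanSpace ℝ (Fin q)) z₀ z₀))) v := by
  have h1 : HasFDerivAt g _ (r⁻¹ • (v - chartAt (EuclideanSpace ℝ (Fin q)) z₀ z₀)) :=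
    (h.contDiff.differentiable two_ne_zero _).hasFDerivAt
  have h2 := (h1.comp v (((hasFDerivAt_id v).sub_const
    (chartAt (EuclideanSpace ℝ (Fin q)) z₀ z₀)).const_smul r⁻¹)).const_mul r
  refine (h2.congr_of_eventuallyEq (h.comp_symm_eventuallyEq hr hv)).congr_fderiv ?_
  ext u
  simp [mul_inv_cancel_left₀ hr.1.ne']

theorem tder_center (h : IsBumpFamily z₀ g ρ ψ) [IsManifold (𝓡 q) ∞ M] {r : ℝ} (hr : r ∈ Set.Ioo 0 ρ) :
    tder (q := q) (r • ψ r : C2Fun q M) z₀ = fderiv ℝ g 0 := by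
  rw [tder_eq_fderiv_comp (mem_chart_source _ z₀)
    ((r • ψ r).contMDiff.mdifferentiableAt two_ne_zero), tmap_chartAt_self,
    (h.hasFDerivAt_comp_symm hr (mem_chart_target _ z₀)).fderiv, sub_self, smul_zero]
  rfl

/-- The factor r compensates the r⁻¹ produced by differentiating g (r⁻¹ x), so first-order jets stay
bounded while the support shrinks. -/
theorem exists_jetBound [T2Space M] [IsManifold (𝓡 q) ∞ M]
    (h : IsBumpFamily z₀ g ρ ψ) (𝒰 : ChartCover q M) :
    ∃ b : ℝ, ∀ r ∈ Set.Ioo 0 ρ, 𝒰.JetBound 1 (r • ψ r : C2Fun q M) b := by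
  have hcs : HasCompactSupport g := HasCompactSupport.intro
    (ProperSpace.isCompact_closedBall (0 : EuclideanSpace ℝ (Fin q)) 1) fun v hv =>
      h.eq_zero_of_lt v (by simpa using hv)
  obtain ⟨b₀, hb₀⟩ := hcs.exists_bound_of_continuous h.contDiff.continuous
  obtain ⟨b₁, hb₁⟩ := (hcs.fderiv ℝ).exists_bound_of_continuous
    (h.contDiff.continuous_fderiv two_ne_zero)
  set e := chartAt (EuclideanSpace ℝ (Fin q)) z₀ with he
  have hb₀0 : 0 ≤ b₀ := (norm_nonneg _).trans (hb₀ 0)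
  have hb₁0 : 0 ≤ b₁ := (norm_nonneg _).trans (hb₁ 0)
  have hρ := h.pos
  let B := ρ * b₀ + b₁
  have hB : ∀ r ∈ Set.Ioo 0 ρ, ∀ v ∈ e.target, ∀ k ≤ 1,
      ‖iteratedFDeriv ℝ k (fun u => (r • ψ r) (e.symm u)) v‖ ≤ B := by
    intro r hr v hv k hk
    interval_cases k
    · rw [norm_iteratedFDeriv_zero, (h.comp_symm_eventuallyEq hr hv).eq_of_nhds, norm_mul,
        Real.norm_of_nonneg hr.1.le]
      exact (mul_le_mul hr.2.le (hb₀ _) (norm_nonneg _) hρ.le).trans (le_add_of_nonneg_right hb₁0)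
    · rw [norm_iteratedFDeriv_one, (h.hasFDerivAt_comp_symm hr hv).fderiv]
      exact (hb₁ _).trans (le_add_of_nonneg_left (by positivity))
  have hB0 : 0 ≤ B := by positivity
  have key : ∀ c ∈ 𝒰.centers, ∃ K : ℝ, ∀ u ∈ 𝒰.closedBall c, ∀ r ∈ Set.Ioo 0 ρ, ∀ k ≤ 1,
      ‖iteratedFDeriv ℝ k
        (fun u => (r • ψ r) ((chartAt (EuclideanSpace ℝ (Fin q)) c).symm u)) u‖ ≤ K := by
    intro c hc
    refine (𝒰.isCompact_closedBall c).induction_on (p := fun s => ∃ K : ℝ, ∀ u ∈ s,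
      ∀ r ∈ Set.Ioo 0 ρ, ∀ k ≤ 1, ‖iteratedFDeriv ℝ k
        (fun u => (r • ψ r) ((chartAt (EuclideanSpace ℝ (Fin q)) c).symm u)) u‖ ≤ K)
      ⟨0, by simp⟩ ?_ ?_ ?_
    · rintro s t hst ⟨K, h1⟩
      exact ⟨K, fun u hu => h1 u (hst hu)⟩
    · rintro s t ⟨K, h1⟩ ⟨K', h1'⟩
      refine ⟨max K K', ?_⟩
      rintro u (hu | hu) r hr k hk
      · exact (h1 u hu r hr k hk).trans (le_max_left _ _)
      · exact (h1' u hu r hr k hk).trans (le_max_right _ _)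
    · intro u₀ hu₀
      have hut := 𝒰.closedBall_subset_target c hu₀
      by_cases hm : (chartAt (EuclideanSpace ℝ (Fin q)) c).symm u₀ ∈ e.source
      · obtain ⟨K, hK, h1⟩ := exists_eventually_norm_iteratedFDeriv_comp_le contMDiff_id
          (IsManifold.chart_mem_maximalAtlas c) (IsManifold.chart_mem_maximalAtlas z₀) hut hm
        have h2 := ((chartAt (EuclideanSpace ℝ (Fin q)) c).continuousAt_symm hut).eventually_mem
          (e.open_source.mem_nhds hm)
        refine ⟨_, mem_nhdsWithin_of_mem_nhds (h1.and h2), K * B, ?_⟩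
        rintro u ⟨hu1, hu2⟩ r hr k hk
        exact hu1 (r • ψ r) 1 one_le_two B (hB r hr _ (e.map_source hu2)) k hk
      -- Outside the chart around z₀, a whole neighbourhood misses the closed image of the ball of
      -- radius ρ, off which all the bumps vanish.
      · have hK := isClosed_symm_image_closedBall h.closedBall_subset
        have hmK : (chartAt (EuclideanSpace ℝ (Fin q)) c).symm u₀ ∉
            e.symm '' Metric.closedBall (e z₀) ρ := by
          rintro ⟨v, hv, hv'⟩
          exact hm (hv' ▸ e.map_target (h.closedBall_subset hv))
        have hnhds : ((chartAt (EuclideanSpace ℝ (Fin q)) c).target ∩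
            (chartAt (EuclideanSpace ℝ (Fin q)) c).symm ⁻¹'
              (e.symm '' Metric.closedBall (e z₀) ρ)ᶜ) ∈ 𝓝 u₀ :=
          ((chartAt (EuclideanSpace ℝ (Fin q)) c).symm.isOpen_inter_preimage
            hK.isOpen_compl).mem_nhds ⟨hut, hmK⟩
        refine ⟨_, mem_nhdsWithin_of_mem_nhds hnhds, 0, ?_⟩
        rintro u ⟨hu1, hu2⟩ r hr k hk
        have h1 := ((chartAt (EuclideanSpace ℝ (Fin q)) c).continuousAt_symm hu1).eventually
          (h.eventuallyEq_zero hr hr.2.le le_rfl hu2)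
        have h2 : (fun u => (r • ψ r) ((chartAt (EuclideanSpace ℝ (Fin q)) c).symm u)) =ᶠ[𝓝 u]
            fun _ => 0 := by
          filter_upwards [h1] with x hx
          rw [ContMDiffMap.coe_smul, Pi.smul_apply, hx, smul_zero]
        rw [(h2.iteratedFDeriv ℝ k).eq_of_nhds]
        simp [iteratedFDeriv_fun_zero]
  choose! K hKb using key
  refine ⟨∑ c ∈ 𝒰.centers, |K c|, fun r hr c hc u hu k hk => ?_⟩
  exact (hKb c hc u hu r hr k hk).trans ((le_abs_self _).trans
    (Finset.single_le_sum (f := fun c => |K c|) (fun i _ => abs_nonneg _) hc))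

end IsBumpFamily

end Bumps

section Profiles

variable {E : Type*} [NormedAddCommGroup E] [InnerProductSpace ℝ E] [FiniteDimensional ℝ E]

theorem exists_contDiff_profile : ∃ g : E → ℝ, ContDiff ℝ 2 g ∧ (∀ v, 1 < ‖v‖ → g v = 0) ∧
    (∀ v, |g v| ≤ 1) ∧ g =ᶠ[𝓝 0] fun _ => 1 := by
  let f : ContDiffBump (0 : E) := ⟨1 / 2, 1, by norm_num, by norm_num⟩
  refine ⟨f, f.contDiff, fun v hv => f.zero_of_le_dist (by simpa using hv.le), fun v => ?_,
    f.eventuallyEq_one⟩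
  rw [abs_of_nonneg f.nonneg]
  exact f.le_one

theorem exists_contDiff_profile_fderiv (η : E →L[ℝ] ℝ) : ∃ g : E → ℝ, ContDiff ℝ 2 g ∧
    (∀ v, 1 < ‖v‖ → g v = 0) ∧ fderiv ℝ g 0 = η := by
  obtain ⟨f, hf, hf0, -, hf1⟩ := exists_contDiff_profile (E := E)
  refine ⟨fun v => η v * f v, η.contDiff.mul hf, fun v hv => by simp [hf0 v hv], ?_⟩
  have : (fun v => η v * f v) =ᶠ[𝓝 0] η := by
    filter_upwards [hf1] with v hv
    rw [hv, mul_one]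
  rw [this.fderiv_eq, η.fderiv]

end Profiles

/-! ### Ranges of the evaluations of the synchronization and of its derivative. -/

section Ranges

variable {q : ℕ} {M : Type*} [TopologicalSpace M] [ChartedSpace (EuclideanSpace ℝ (Fin q)) M]
  {V : Type*} [NormedAddCommGroup V] [NormedSpace ℝ V]

theorem tder_add {f g : M → V} {m : M} (hf : MDifferentiableAt (𝓡 q) 𝓘(ℝ, V) f m)
    (hg : MDifferentiableAt (𝓡 q) 𝓘(ℝ, V) g m) :
    tder (q := q) (f + g) m = tder (q := q) f m + tder (q := q) g m :=
  mfderiv_add hf hg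

theorem tder_const_smul {f : M → V} {m : M} (t : ℝ) (hf : MDifferentiableAt (𝓡 q) 𝓘(ℝ, V) f m) :
    tder (q := q) (t • f) m = t • tder (q := q) f m :=
  const_smul_mfderiv hf t

theorem tmap_iterate_of_fixed {h : M → M} (hh : ContMDiff (𝓡 q) (𝓡 q) 2 h) {x : M}
    (hx : h x = x) (i : ℕ) : tmap (q := q) h^[i] x = tmap (q := q) h x ^ i := by
  induction i with
  | zero => exact tmap_id x
  | succ i ih =>
    have hi : h^[i] x = x := Function.IsFixedPt.iterate hx i
    rw [Function.iterate_succ', tmap_comp (hh.mdifferentiableAt two_ne_zero)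
      ((hh.iterate i).mdifferentiableAt two_ne_zero), ih, hi, pow_succ']
    rfl

theorem Function.Injective.eq_of_iterate_eq {α : Type*} {h : α → α} (hinj : Function.Injective h)
    {x : α} (hx : x ∉ Function.periodicPts h) {j k : ℕ} (hjk : h^[j] x = h^[k] x) : j = k := by
  by_contra hne
  wlog hlt : j < k generalizing j k
  · exact this hjk.symm (Ne.symm hne) (by omega)
  refine hx ⟨k - j, by omega, ?_⟩
  refine hinj.iterate j ?_
  rw [← Function.iterate_add_apply, hjk]
  congr 2
  omega

theorem Function.Injective.mem_periodicPts_of_iterate {α : Type*} {h : α → α}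
    (hinj : Function.Injective h) {x : α} {k : ℕ} (hx : h^[k] x ∈ Function.periodicPts h) :
    x ∈ Function.periodicPts h := by
  obtain ⟨n, hn, hp⟩ := hx
  refine ⟨n, hn, hinj.iterate k ?_⟩
  rw [← Function.iterate_add_apply, add_comm, Function.iterate_add_apply]
  exact hp

namespace DelaySeries

variable {𝒰 : ChartCover q M} (𝒮 : DelaySeries 𝒰 V)

theorem norm_coeff_le (j : ℕ) : ‖𝒮.coeff j‖ ≤ 𝒮.growth ^ j * ‖𝒮.coeff j‖ :=
  le_mul_of_one_le_left (norm_nonneg _) (one_le_pow₀ 𝒮.one_le_growth)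

variable [IsManifold (𝓡 q) ∞ M]

open Classical in
-- A periodic orbit is finite, so a bump around x of small enough radius vanishes near all its other
-- points.
theorem exists_tder_orbit_eq [T2Space M] {x : M} (hx : x ∈ Function.periodicPts 𝒮.map)
    (η : EuclideanSpace ℝ (Fin q) →L[ℝ] ℝ) :
    ∃ w : C2Fun q M, ∀ j, tder (q := q) w (𝒮.map^[j] x) = if 𝒮.map^[j] x = x then η else 0 := by
  obtain ⟨g, hg, hg0, hg1⟩ := exists_contDiff_profile_fderiv η
  obtain ⟨ρ, ψ, h⟩ := exists_isBumpFamily x hg hg0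
  have hn := Function.minimalPeriod_pos_of_mem_periodicPts hx
  have h1 : ∀ᶠ r in 𝓝[>] (0 : ℝ), ∀ j ∈ Finset.range (Function.minimalPeriod 𝒮.map x),
      𝒮.map^[j] x ≠ x → ψ r =ᶠ[𝓝 (𝒮.map^[j] x)] fun _ => 0 := by
    rw [Finset.eventually_all]
    intro j _
    rw [eventually_imp_distrib_left]
    exact fun hj => h.eventually_eventuallyEq_zero hj
  obtain ⟨r, hr1, hr⟩ := (h1.and h.eventually_mem_Ioo).exists
  refine ⟨r • ψ r, fun j => ?_⟩
  split_ifs with hj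
  · rw [hj, h.tder_center hr, hg1]
  · rw [← Function.iterate_mod_minimalPeriod_eq] at hj ⊢
    have h2 : ⇑(r • ψ r) =ᶠ[𝓝 (𝒮.map^[j % Function.minimalPeriod 𝒮.map x] x)]
        fun _ => (0 : ℝ) := by
      filter_upwards [hr1 _ (Finset.mem_range.2 (Nat.mod_lt j hn)) hj] with y hy
      rw [ContMDiffMap.coe_smul, Pi.smul_apply, hy, smul_zero]
    rw [tder_congr h2, tder_const]

variable [CompleteSpace V]

theorem mdifferentiableAt_sync (w : C2Fun q M) (m : M) :
    MDifferentiableAt (𝓡 q) 𝓘(ℝ, V) (𝒮.sync w) m :=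
  (𝒮.contMDiff_sync w).mdifferentiableAt two_ne_zero

/-- The difference of the values of the synchronization at two points. -/
noncomputable def evalPair (x y : M) : C2Fun q M →ₗ[ℝ] V :=
  (LinearMap.proj (R := ℝ) (φ := fun _ : M => V) x -
    LinearMap.proj (R := ℝ) (φ := fun _ : M => V) y) ∘ₗ 𝒮.sync

@[simp]
theorem evalPair_apply (x y : M) (w : C2Fun q M) :
    𝒮.evalPair x y w = 𝒮.sync w x - 𝒮.sync w y := rfl

/-- The derivative of the synchronization at a point. -/
noncomputable def evalTangent (m : M) : C2Fun q M →ₗ[ℝ] EuclideanSpace ℝ (Fin q) →L[ℝ] V where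
  toFun w := tder (q := q) (𝒮.sync w) m
  map_add' w w' := by
    rw [map_add]
    exact tder_add (𝒮.mdifferentiableAt_sync w m) (𝒮.mdifferentiableAt_sync w' m)
  map_smul' t w := by
    rw [map_smul]
    exact tder_const_smul t (𝒮.mdifferentiableAt_sync w m)

@[simp]
theorem evalTangent_apply (m : M) (w : C2Fun q M) :
    𝒮.evalTangent m w = tder (q := q) (𝒮.sync w) m := rfl

open Classical in
-- Dominated convergence: the bumps are bounded by 1 and tend pointwise to the indicator of z₀.
theorem tendsto_sync_bump [T2Space M] {z₀ : M} {g : EuclideanSpace ℝ (Fin q) → ℝ} {ρ : ℝ}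
    {ψ : ℝ → C2Fun q M} (h : IsBumpFamily z₀ g ρ ψ) (hg : ∀ v, |g v| ≤ 1) (hg0 : g 0 = 1) (m : M) :
    Tendsto (fun r => 𝒮.sync (ψ r) m) (𝓝[>] 0)
      (𝓝 (∑' j, (if 𝒮.map^[j] m = z₀ then (1 : ℝ) else 0) • 𝒮.coeff j)) := by
  refine tendsto_tsum_of_dominated_convergence 𝒮.summable_growth (fun j => ?_) ?_
  · refine tendsto_const_nhds.congr' ?_
    by_cases hj : 𝒮.map^[j] m = z₀
    · filter_upwards [h.eventually_mem_Ioo] with r hr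
      rw [if_pos hj, hj, h.apply_center hr, hg0]
    · filter_upwards [h.eventually_eventuallyEq_zero hj] with r hr
      rw [if_neg hj, hr.eq_of_nhds]
  · filter_upwards [h.eventually_mem_Ioo] with r hr j
    rw [norm_smul]
    refine (mul_le_of_le_one_left (norm_nonneg _) ?_).trans (𝒮.norm_coeff_le j)
    exact h.abs_le hg hr _

open Classical in
theorem tendsto_tder_sync_bump [T2Space M] {z₀ : M} {g : EuclideanSpace ℝ (Fin q) → ℝ} {ρ : ℝ}
    {ψ : ℝ → C2Fun q M} (h : IsBumpFamily z₀ g ρ ψ) (m : M) (u : EuclideanSpace ℝ (Fin q)) :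
    Tendsto (fun r => tder (q := q) (𝒮.sync (r • ψ r)) m u) (𝓝[>] 0)
      (𝓝 (∑' j, (if 𝒮.map^[j] m = z₀ then fderiv ℝ g 0 (tmap 𝒮.map^[j] m u) else 0) •
        𝒮.coeff j)) := by
  obtain ⟨b, hb⟩ := h.exists_jetBound 𝒰
  obtain ⟨R, hR⟩ := 𝒮.exists_norm_tder_shift_le m u
  simp_rw [← (𝒮.hasSum_tder_sync _ m u).tsum_eq]
  refine tendsto_tsum_of_dominated_convergence ((𝒮.summable_bound b).mul_right R) (fun j => ?_) ?_
  · refine tendsto_const_nhds.congr' ?_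
    by_cases hj : 𝒮.map^[j] m = z₀
    · filter_upwards [h.eventually_mem_Ioo] with r hr
      rw [if_pos hj, hj, h.tder_center hr]
    · filter_upwards [h.eventually_eventuallyEq_zero hj] with r hr
      have h2 : ⇑(r • ψ r) =ᶠ[𝓝 (𝒮.map^[j] m)] fun _ => (0 : ℝ) := by
        filter_upwards [hr] with x hx
        rw [ContMDiffMap.coe_smul, Pi.smul_apply, hx, smul_zero]
      rw [if_neg hj, tder_congr h2, tder_const]
      rfl
  · filter_upwards [h.eventually_mem_Ioo] with r hr j
    have := hR (r • ψ r) b (hb r hr) j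
    rwa [tder_shift] at this

/-- At a periodic point with a cyclic covector, some observation yields an immersion. -/
theorem exists_injective_tder_sync [T2Space M] {A : V →L[ℝ] V} {C : V} (hcoeff : ∀ j, 𝒮.coeff j = (A ^ j) C)
    {x : M} (hx : x ∈ Function.periodicPts 𝒮.map)
    (hli : LinearIndependent ℝ fun i : Fin q =>
      ((A ^ Function.minimalPeriod 𝒮.map x) ^ (i : ℕ)) C)
    (hcyc : ∃ η : EuclideanSpace ℝ (Fin q) →L[ℝ] ℝ, ∀ u, (∀ i < q,
      η ((tmap (q := q) 𝒮.map^[Function.minimalPeriod 𝒮.map x] x ^ i) u) = 0) → u = 0) :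
    ∃ w, Function.Injective (tder (q := q) (𝒮.sync w) x) := by
  classical
  obtain ⟨η, hη⟩ := hcyc
  obtain ⟨w, hw⟩ := 𝒮.exists_tder_orbit_eq hx η
  refine ⟨w, (injective_iff_map_eq_zero _).2 fun u hu => ?_⟩
  set n := Function.minimalPeriod 𝒮.map x with hn
  have hn0 : 0 < n := Function.minimalPeriod_pos_of_mem_periodicPts hx
  have h1 := 𝒮.hasSum_tder_sync w x u
  rw [hu] at h1
  -- Only times divisible by the period contribute, because the differential of w vanishes at the
  -- other points of the orbit.
  have hinj : Function.Injective fun i : ℕ => n * i := fun i j h => Nat.eq_of_mul_eq_mul_left hn0 h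
  rw [← hinj.hasSum_iff] at h1
  · set T := tmap (q := q) 𝒮.map^[n] x with hT
    refine LinearMap.eq_zero_of_hasSum_cyclic (E := EuclideanSpace ℝ (Fin q)) (q := q) (by simp)
      T.toLinearMap η.toLinearMap (fun u hu => hη u fun i hi => ?_) (A ^ n) C hli u ?_
    · have := hu i hi
      rwa [← ContinuousLinearMap.toLinearMap_pow] at this
    · refine h1.congr_fun fun i => ?_
      have hfix : 𝒮.map^[n] x = x := Function.iterate_minimalPeriod
      have e1 : 𝒮.map^[n * i] x = x := by
        rw [Function.iterate_mul]
        exact Function.IsFixedPt.iterate hfix i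
      have e2 : tmap (q := q) 𝒮.map^[n * i] x = T ^ i := by
        rw [Function.iterate_mul]
        exact tmap_iterate_of_fixed (𝒮.contMDiff_map.iterate n) hfix i
      simp only [Function.comp_apply]
      rw [hw, if_pos e1, e2, hcoeff, pow_mul, ← ContinuousLinearMap.toLinearMap_pow]
      rfl
  · intro j hj
    rw [hw, if_neg, zero_apply, zero_smul]
    intro h2
    obtain ⟨i, hi⟩ := Function.isPeriodicPt_iff_minimalPeriod_dvd.1 h2
    exact hj ⟨i, hi.symm⟩

variable [FiniteDimensional ℝ V] [T2Space M]

open Classical in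
-- The indicator of a point is in general not a C² observation, but its would-be image is a limit of
-- elements of the range, and a subspace of the finite-dimensional V is closed.
theorem indicator_mem_range_evalPair (x y z : M) :
    ∑' j, (if 𝒮.map^[j] x = z then (1 : ℝ) else 0) • 𝒮.coeff j -
      ∑' j, (if 𝒮.map^[j] y = z then (1 : ℝ) else 0) • 𝒮.coeff j ∈
      LinearMap.range (𝒮.evalPair x y) := by
  obtain ⟨g, hg, hg0, hg1, hg2⟩ := exists_contDiff_profile (E := EuclideanSpace ℝ (Fin q))
  obtain ⟨ρ, ψ, h⟩ := exists_isBumpFamily z hg hg0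
  refine (Submodule.closed_of_finiteDimensional (LinearMap.range (𝒮.evalPair x y))).mem_of_tendsto
    ((𝒮.tendsto_sync_bump h hg1 hg2.eq_of_nhds x).sub
      (𝒮.tendsto_sync_bump h hg1 hg2.eq_of_nhds y)) (Eventually.of_forall fun r => ⟨ψ r, rfl⟩)

open Classical in
theorem indicator_mem_range_evalTangent (x z : M) (u : EuclideanSpace ℝ (Fin q))
    (η : EuclideanSpace ℝ (Fin q) →L[ℝ] ℝ) :
    ∑' j, (if 𝒮.map^[j] x = z then η (tmap 𝒮.map^[j] x u) else 0) • 𝒮.coeff j ∈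
      LinearMap.range ((ContinuousLinearMap.apply ℝ V u).toLinearMap ∘ₗ 𝒮.evalTangent x) := by
  obtain ⟨g, hg, hg0, hg1⟩ := exists_contDiff_profile_fderiv η
  obtain ⟨ρ, ψ, h⟩ := exists_isBumpFamily z hg hg0
  have h1 := 𝒮.tendsto_tder_sync_bump h x u
  rw [hg1] at h1
  exact (Submodule.closed_of_finiteDimensional (LinearMap.range
    ((ContinuousLinearMap.apply ℝ V u).toLinearMap ∘ₗ 𝒮.evalTangent x))).mem_of_tendsto h1
    (Eventually.of_forall fun r => ⟨r • ψ r, rfl⟩)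

/-- Induction on k puts every coefficient into the range. The indicator of h^k x contributes
coefficient k, minus coefficient j if h^j y = h^k x; then j < k, since otherwise injectivity would
put x on the forward orbit of y. -/
theorem surjective_evalPair_of_forall_ne (hinj : Function.Injective 𝒮.map)
    (hspan : Submodule.span ℝ (Set.range 𝒮.coeff) = ⊤) {x y : M}
    (hx : x ∉ Function.periodicPts 𝒮.map) (hxy : ∀ p, 𝒮.map^[p] y ≠ x) :
    Function.Surjective (𝒮.evalPair x y) := by
  classical
  rw [← LinearMap.range_eq_top, eq_top_iff, ← hspan, Submodule.span_le]
  rintro _ ⟨k, rfl⟩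
  induction k using Nat.strong_induction_on with
  | _ k ih =>
    have h1 := 𝒮.indicator_mem_range_evalPair x y (𝒮.map^[k] x)
    have h2 : ∑' j, (if 𝒮.map^[j] x = 𝒮.map^[k] x then (1 : ℝ) else 0) • 𝒮.coeff j =
        𝒮.coeff k := by
      rw [tsum_eq_single k fun j hj => ?_, if_pos rfl, one_smul]
      rw [if_neg fun h => hj (hinj.eq_of_iterate_eq hx h), zero_smul]
    rw [h2] at h1
    by_cases hy : ∃ j, 𝒮.map^[j] y = 𝒮.map^[k] x
    · obtain ⟨j, hj⟩ := hy
      have hyp : y ∉ Function.periodicPts 𝒮.map := by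
        rintro ⟨n, hn, hp⟩
        refine hx (hinj.mem_periodicPts_of_iterate (k := k) ⟨n, hn, ?_⟩)
        rw [← hj]
        exact hp.apply_iterate j
      have hjk : j < k := by
        by_contra! hle
        refine hxy (j - k) (hinj.iterate k ?_)
        rw [← Function.iterate_add_apply, Nat.add_sub_cancel' hle, hj]
      have h3 : ∑' i, (if 𝒮.map^[i] y = 𝒮.map^[k] x then (1 : ℝ) else 0) • 𝒮.coeff i =
          𝒮.coeff j := by
        rw [tsum_eq_single j fun i hi => ?_, if_pos hj, one_smul]
        rw [if_neg fun h => hi (hinj.eq_of_iterate_eq hyp (h.trans hj.symm)), zero_smul]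
      rw [h3] at h1
      simpa using Submodule.add_mem _ h1 (ih j hjk)
    · push Not at hy
      have h3 : ∑' i, (if 𝒮.map^[i] y = 𝒮.map^[k] x then (1 : ℝ) else 0) • 𝒮.coeff i = 0 := by
        simp [hy]
      rwa [h3, sub_zero] at h1

/-- If h^p y = x with x not periodic, then y is not periodic and does not lie on the forward orbit
of x. So exchanging the two points, if necessary, gives the one-sided situation. -/
theorem surjective_evalPair (hinj : Function.Injective 𝒮.map)
    (hspan : Submodule.span ℝ (Set.range 𝒮.coeff) = ⊤) {x y : M} (hxy : x ≠ y)
    (h : x ∉ Function.periodicPts 𝒮.map ∨ y ∉ Function.periodicPts 𝒮.map) :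
    Function.Surjective (𝒮.evalPair x y) := by
  have hswap : Function.Surjective (𝒮.evalPair y x) → Function.Surjective (𝒮.evalPair x y) := by
    intro hs v
    obtain ⟨w, hw⟩ := hs (-v)
    exact ⟨w, by rw [← neg_eq_iff_eq_neg] at hw; simpa using hw⟩
  have key : ∀ x y : M, x ≠ y → x ∉ Function.periodicPts 𝒮.map →
      Function.Surjective (𝒮.evalPair x y) ∨ Function.Surjective (𝒮.evalPair y x) := by
    intro x y hxy hx
    by_cases hp : ∃ p, 𝒮.map^[p] y = x
    · obtain ⟨p, hp⟩ := hp
      right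
      have hy : y ∉ Function.periodicPts 𝒮.map := by
        rintro ⟨n, hn, hn'⟩
        exact hx ⟨n, hn, hp ▸ hn'.apply_iterate p⟩
      refine 𝒮.surjective_evalPair_of_forall_ne hinj hspan hy fun p' hp' => ?_
      have h1 : 𝒮.map^[p' + p] y = 𝒮.map^[0] y := by
        rw [Function.iterate_add_apply, hp, hp', Function.iterate_zero, id]
      have h2 := hinj.eq_of_iterate_eq hy h1
      have hp0 : p = 0 := by omega
      subst hp0
      exact hxy hp.symm
    · push Not at hp
      exact Or.inl (𝒮.surjective_evalPair_of_forall_ne hinj hspan hx hp)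
  rcases h with h | h
  · exact (key x y hxy h).elim id hswap
  · exact (key y x hxy.symm h).elim hswap id

/-- The orbit never returns, so a bump at h^k x whose differential is normalized on the k-th image
of u selects the k-th coefficient alone. -/
theorem surjective_evalTangent (hinj : Function.Injective 𝒮.map)
    (hspan : Submodule.span ℝ (Set.range 𝒮.coeff) = ⊤) {x : M}
    (hx : x ∉ Function.periodicPts 𝒮.map) {u : EuclideanSpace ℝ (Fin q)}
    (hu : ∀ k, tmap (q := q) 𝒮.map^[k] x u ≠ 0) (v : V) :
    ∃ w, tder (q := q) (𝒮.sync w) x u = v := by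
  classical
  suffices h : Function.Surjective
      ((ContinuousLinearMap.apply ℝ V u).toLinearMap ∘ₗ 𝒮.evalTangent x) from h v
  rw [← LinearMap.range_eq_top, eq_top_iff, ← hspan, Submodule.span_le]
  rintro _ ⟨k, rfl⟩
  obtain ⟨η, hη⟩ := SeparatingDual.exists_eq_one (R := ℝ) (hu k)
  have h1 := 𝒮.indicator_mem_range_evalTangent x (𝒮.map^[k] x) u η
  rwa [tsum_eq_single k fun j hj => ?_, if_pos rfl, hη, one_smul] at h1
  rw [if_neg fun h => hj (hinj.eq_of_iterate_eq hx h), zero_smul]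

end DelaySeries

end Ranges

/-! ### Density from a single good observation. -/

section LinePerturbation

variable {W V E : Type*} [TopologicalSpace W] [AddCommGroup W] [Module ℝ W] [ContinuousAdd W]
  [ContinuousSMul ℝ W] [NormedAddCommGroup V] [NormedSpace ℝ V] [NormedAddCommGroup E]
  [NormedSpace ℝ E] [FiniteDimensional ℝ E]

/-- On each line in the direction ψ all but finitely many times are good, in particular arbitrarily
small ones. -/
theorem dense_of_finite_bad_times {Q : W → Prop} (ψ : W)
    (h : ∀ w, {t : ℝ | ¬ Q (w + t • ψ)}.Finite) : Dense {w | Q w} := by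
  rw [dense_iff_inter_open]
  rintro O hO ⟨w, hw⟩
  have hc : Continuous fun t : ℝ => w + t • ψ := by fun_prop
  obtain ⟨t, htO, ht⟩ := ((Set.Finite.countable (h w)).dense_compl ℝ).inter_open_nonempty _ (hO.preimage hc)
    ⟨0, by simpa using hw⟩
  exact ⟨w + t • ψ, htO, by simpa using ht⟩

theorem LinearMap.dense_setOf_apply_ne_zero (L : W →ₗ[ℝ] V) (h : ∃ ψ, L ψ ≠ 0) :
    Dense {w | L w ≠ 0} := by
  obtain ⟨ψ, hψ⟩ := h
  refine dense_of_finite_bad_times ψ fun w => Set.Subsingleton.finite fun t ht t' ht' => ?_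
  simp only [Set.mem_ofPred_eq, not_not, map_add, map_smul] at ht ht'
  have h1 : (t - t') • L ψ = 0 := by
    rw [sub_smul, sub_eq_zero]
    exact add_left_cancel (ht.trans ht'.symm)
  exact sub_eq_zero.1 ((smul_eq_zero.1 h1).resolve_right hψ)

/-- With R a left inverse of L ψ, injectivity of L (w + t • ψ) can fail only if -t is an eigenvalue
of R ∘ L w, and there are finitely many of these. -/
theorem LinearMap.dense_setOf_injective (L : W →ₗ[ℝ] E →L[ℝ] V)
    (h : ∃ ψ, Function.Injective (L ψ)) : Dense {w | Function.Injective (L w)} := by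
  obtain ⟨ψ, hψ⟩ := h
  obtain ⟨R, hR⟩ := LinearMap.exists_leftInverse_of_injective (L ψ).toLinearMap
    (LinearMap.ker_eq_bot.2 hψ)
  refine dense_of_finite_bad_times ψ fun w => ?_
  let S : Module.End ℝ E := R ∘ₗ (L w).toLinearMap
  refine ((Module.End.finite_spectrum S).preimage neg_injective.injOn).subset fun t ht => ?_
  simp only [Set.mem_preimage]
  by_contra hn
  apply ht
  rw [spectrum.notMem_iff] at hn
  have hu : Function.Injective (algebraMap ℝ (Module.End ℝ E) (-t) - S) :=
    ((Module.End.isUnit_iff _).1 hn).1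
  refine (injective_iff_map_eq_zero _).2 fun v hv => ?_
  refine (injective_iff_map_eq_zero _).1 hu v ?_
  have h1 : R (L (w + t • ψ) v) = 0 := by rw [hv, map_zero]
  have h2 : R (L ψ v) = v := LinearMap.congr_fun hR v
  simp only [map_add, map_smul, _root_.add_apply, _root_.smul_apply,
    h2] at h1
  rw [LinearMap.sub_apply, Module.algebraMap_end_apply, neg_smul, sub_eq_zero, neg_eq_iff_add_eq_zero,
    add_comm]
  exact h1

end LinePerturbation

theorem ContinuousLinearMap.injective_iff_forall_sphere_ne_zero {E V : Type*}
    [NormedAddCommGroup E] [NormedSpace ℝ E] [NormedAddCommGroup V] [NormedSpace ℝ V]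
    (L : E →L[ℝ] V) :
    Function.Injective L ↔ ∀ v ∈ Metric.sphere (0 : E) 1, L v ≠ 0 := by
  rw [injective_iff_map_eq_zero]
  constructor
  · intro h v hv h0
    rw [h v h0] at hv
    simp at hv
  · intro h v hv
    by_contra hv0
    refine h (‖v‖⁻¹ • v) (by simp [norm_smul, norm_ne_zero_iff.2 hv0]) ?_
    rw [map_smul, hv, smul_zero]

/-! ### Immersions are open and dense. -/

section Genericity

variable {q : ℕ} {M : Type*} [TopologicalSpace M] [ChartedSpace (EuclideanSpace ℝ (Fin q)) M]
  {V : Type*} [NormedAddCommGroup V] [NormedSpace ℝ V]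

theorem ChartCover.finite_core_inter (𝒰 : ChartCover q M) {P : Set M} (hP : P.Finite) (c : M) :
    {u | u ∈ 𝒰.core c ∧ (chartAt (EuclideanSpace ℝ (Fin q)) c).symm u ∈ P}.Finite := by
  refine Set.Finite.of_finite_image (f := (chartAt (EuclideanSpace ℝ (Fin q)) c).symm)
    (hP.subset ?_) ?_
  · rintro _ ⟨u, hu, rfl⟩
    exact hu.2
  · exact (chartAt (EuclideanSpace ℝ (Fin q)) c).symm.injOn.mono fun u hu =>
      𝒰.ball_subset_target c (𝒰.core_subset_ball c hu.1)

namespace DelaySeries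

variable {𝒰 : ChartCover q M} (𝒮 : DelaySeries 𝒰 V) [IsManifold (𝓡 q) ∞ M] [CompleteSpace V]

/-- The derivative of the synchronization in the chart around `c`. -/
noncomputable def evalChart (c : M) :
    C2Fun q M →ₗ[ℝ] EuclideanSpace ℝ (Fin q) × EuclideanSpace ℝ (Fin q) → V :=
  -- The derivative is taken on M and pulled back by the inverse of the chart differential. This is
  -- linear in w at every p, including points outside the chart, and agrees with `fderiv` on the
  -- ball.
  LinearMap.pi fun p => (ContinuousLinearMap.apply ℝ V (Function.invFun
    (tmap (q := q) (chartAt (EuclideanSpace ℝ (Fin q)) c)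
      ((chartAt (EuclideanSpace ℝ (Fin q)) c).symm p.1)) p.2)).toLinearMap ∘ₗ
        𝒮.evalTangent ((chartAt (EuclideanSpace ℝ (Fin q)) c).symm p.1)

theorem tmap_chart_invFun {c : M} {u : EuclideanSpace ℝ (Fin q)} (hu : u ∈ 𝒰.ball c)
    (v : EuclideanSpace ℝ (Fin q)) :
    tmap (q := q) (chartAt (EuclideanSpace ℝ (Fin q)) c)
      ((chartAt (EuclideanSpace ℝ (Fin q)) c).symm u) (Function.invFun
        (tmap (q := q) (chartAt (EuclideanSpace ℝ (Fin q)) c)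
          ((chartAt (EuclideanSpace ℝ (Fin q)) c).symm u)) v) = v :=
  Function.invFun_eq ((bijective_tmap_chartAt
    (OpenPartialHomeomorph.map_target _ (𝒰.ball_subset_target c hu))).2 v)

theorem tder_sync_symm (w : C2Fun q M) {c : M} {u : EuclideanSpace ℝ (Fin q)}
    (hu : u ∈ 𝒰.ball c) :
    tder (q := q) (𝒮.sync w) ((chartAt (EuclideanSpace ℝ (Fin q)) c).symm u) =
      (fderiv ℝ (fun u => 𝒮.sync w ((chartAt (EuclideanSpace ℝ (Fin q)) c).symm u)) u).comp
        (tmap (chartAt (EuclideanSpace ℝ (Fin q)) c)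
          ((chartAt (EuclideanSpace ℝ (Fin q)) c).symm u)) := by
  have hut := 𝒰.ball_subset_target c hu
  rw [tder_eq_fderiv_comp (OpenPartialHomeomorph.map_target _ hut)
    (𝒮.mdifferentiableAt_sync w _), OpenPartialHomeomorph.right_inv _ hut]

theorem evalChart_apply (w : C2Fun q M) {c : M}
    {p : EuclideanSpace ℝ (Fin q) × EuclideanSpace ℝ (Fin q)} (hp : p.1 ∈ 𝒰.ball c) :
    𝒮.evalChart c w p =
      fderiv ℝ (fun u => 𝒮.sync w ((chartAt (EuclideanSpace ℝ (Fin q)) c).symm u)) p.1 p.2 := by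
  simp only [evalChart, LinearMap.pi_apply, LinearMap.comp_apply, evalTangent_apply,
    ContinuousLinearMap.coe_coe, ContinuousLinearMap.apply_apply]
  rw [𝒮.tder_sync_symm w hp, ContinuousLinearMap.comp_apply, tmap_chart_invFun hp]

theorem injective_tder_sync_symm_iff (w : C2Fun q M) {c : M} {u : EuclideanSpace ℝ (Fin q)}
    (hu : u ∈ 𝒰.ball c) :
    Function.Injective (tder (q := q) (𝒮.sync w)
      ((chartAt (EuclideanSpace ℝ (Fin q)) c).symm u)) ↔ Function.Injective
        (fderiv ℝ (fun u => 𝒮.sync w ((chartAt (EuclideanSpace ℝ (Fin q)) c).symm u)) u) := by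
  rw [𝒮.tder_sync_symm w hu, ContinuousLinearMap.coe_comp]
  exact Function.Injective.of_comp_iff' _ (bijective_tmap_chartAt
    (OpenPartialHomeomorph.map_target _ (𝒰.ball_subset_target c hu)))

theorem injective_tder_sync_symm_iff_evalChart (w : C2Fun q M) {c : M}
    {u : EuclideanSpace ℝ (Fin q)} (hu : u ∈ 𝒰.ball c) :
    Function.Injective (tder (q := q) (𝒮.sync w)
      ((chartAt (EuclideanSpace ℝ (Fin q)) c).symm u)) ↔
        ∀ v ∈ Metric.sphere (0 : EuclideanSpace ℝ (Fin q)) 1, 𝒮.evalChart c w (u, v) ≠ 0 := by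
  rw [𝒮.injective_tder_sync_symm_iff w hu]
  have hL : ∀ v, 𝒮.evalChart c w (u, v) = fderiv ℝ (fun u =>
      𝒮.sync w ((chartAt (EuclideanSpace ℝ (Fin q)) c).symm u)) u v :=
    fun v => 𝒮.evalChart_apply w (p := (u, v)) hu
  simp only [hL]
  exact ContinuousLinearMap.injective_iff_forall_sphere_ne_zero _

theorem contDiffOn_evalChart (w : C2Fun q M) {c : M} (hc : c ∈ 𝒰.centers) :
    ContDiffOn ℝ 1 (𝒮.evalChart c w) (𝒰.ball c ×ˢ Set.univ) := by
  have h1 : ContDiffOn ℝ 1 (fderiv ℝ fun u =>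
      𝒮.sync w ((chartAt (EuclideanSpace ℝ (Fin q)) c).symm u)) (𝒰.ball c) :=
    (𝒮.contDiffOn_sync w hc).fderiv_of_isOpen (𝒰.isOpen_ball c) (by norm_num)
  refine ((h1.comp contDiff_fst.contDiffOn fun p hp => hp.1).clm_apply
    contDiff_snd.contDiffOn).congr fun p hp => ?_
  exact 𝒮.evalChart_apply w hp.1

theorem continuousAt_evalChart (w : C2Fun q M) {c : M} (hc : c ∈ 𝒰.centers)
    {p : EuclideanSpace ℝ (Fin q) × EuclideanSpace ℝ (Fin q)} (hp : p.1 ∈ 𝒰.ball c) :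
    ContinuousAt (fun x : C2Fun q M × EuclideanSpace ℝ (Fin q) × EuclideanSpace ℝ (Fin q) =>
      𝒮.evalChart c x.1 x.2) (w, p) := by
  have h1 : ContinuousAt (fun x : C2Fun q M × EuclideanSpace ℝ (Fin q) ×
      EuclideanSpace ℝ (Fin q) => (x.1, x.2.1)) (w, p) := by fun_prop
  have h2 := (ContinuousAt.comp (f := fun x : C2Fun q M × EuclideanSpace ℝ (Fin q) ×
      EuclideanSpace ℝ (Fin q) => (x.1, x.2.1)) (x := (w, p))
      (𝒮.continuousAt_uncurry_fderiv_sync w hc hp) h1).clm_apply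
    (g := fun x : C2Fun q M × EuclideanSpace ℝ (Fin q) × EuclideanSpace ℝ (Fin q) => x.2.2)
    (by fun_prop)
  refine h2.congr ?_
  have h3 : ∀ᶠ x : C2Fun q M × EuclideanSpace ℝ (Fin q) × EuclideanSpace ℝ (Fin q) in 𝓝 (w, p),
      x.2.1 ∈ 𝒰.ball c :=
    (show ContinuousAt (fun x : C2Fun q M × EuclideanSpace ℝ (Fin q) ×
      EuclideanSpace ℝ (Fin q) => x.2.1) (w, p) by fun_prop).eventually_mem
        ((𝒰.isOpen_ball c).mem_nhds hp)
  filter_upwards [h3] with x hx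
  exact (𝒮.evalChart_apply x.1 hx).symm

theorem isOpen_setOf_injective_tder (m : M) :
    IsOpen {w | Function.Injective (tder (q := q) (𝒮.sync w) m)} := by
  obtain ⟨c, hc, hm, hmc⟩ := 𝒰.exists_mem_core m
  have hu := 𝒰.core_subset_ball c hmc
  have h1 : IsOpen {w | ∀ p ∈ {chartAt (EuclideanSpace ℝ (Fin q)) c m} ×ˢ
      Metric.sphere (0 : EuclideanSpace ℝ (Fin q)) 1, 𝒮.evalChart c w p ≠ 0} := by
    refine (isCompact_singleton.prod (isCompact_sphere _ _)).isOpen_setOf_forall_ne_zero ?_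
    rintro ⟨u, v⟩ ⟨rfl, -⟩ w
    exact 𝒮.continuousAt_evalChart w hc hu
  convert h1 using 3 with w
  have h2 := 𝒮.injective_tder_sync_symm_iff_evalChart w hu
  rw [OpenPartialHomeomorph.left_inv _ hm] at h2
  rw [h2]
  constructor
  · rintro h ⟨a, b⟩ ⟨rfl, hb⟩
    exact h b hb
  · exact fun h v hv => h _ ⟨rfl, hv⟩

theorem forall_injective_tder_iff (w : C2Fun q M) :
    (∀ m, Function.Injective (tder (q := q) (𝒮.sync w) m)) ↔ ∀ c ∈ 𝒰.centers,
      ∀ p ∈ 𝒰.core c ×ˢ Metric.sphere (0 : EuclideanSpace ℝ (Fin q)) 1,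
        𝒮.evalChart c w p ≠ 0 := by
  constructor
  · rintro h c hc ⟨u, v⟩ ⟨hu, hv⟩
    exact (𝒮.injective_tder_sync_symm_iff_evalChart w (𝒰.core_subset_ball c hu)).1 (h _) v hv
  · intro h m
    obtain ⟨c, hc, hm, hmc⟩ := 𝒰.exists_mem_core m
    have h2 := 𝒮.injective_tder_sync_symm_iff_evalChart w (𝒰.core_subset_ball c hmc)
    rw [OpenPartialHomeomorph.left_inv _ hm] at h2
    exact h2.2 fun v hv => h c hc _ ⟨hmc, hv⟩

theorem isOpen_setOf_forall_evalChart_ne_zero {c : M} (hc : c ∈ 𝒰.centers) :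
    IsOpen {w | ∀ p ∈ 𝒰.core c ×ˢ Metric.sphere (0 : EuclideanSpace ℝ (Fin q)) 1,
      𝒮.evalChart c w p ≠ 0} :=
  ((𝒰.isCompact_core c).prod (isCompact_sphere _ _)).isOpen_setOf_forall_ne_zero
    fun _ hp w => 𝒮.continuousAt_evalChart w hc (𝒰.core_subset_ball c hp.1)

theorem isOpen_setOf_forall_injective_tder :
    IsOpen {w | ∀ m, Function.Injective (tder (q := q) (𝒮.sync w) m)} := by
  simp_rw [forall_injective_tder_iff]
  have := isOpen_biInter_finset fun c hc => 𝒮.isOpen_setOf_forall_evalChart_ne_zero (c := c) hc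
  convert this using 1
  ext w
  simp

variable [FiniteDimensional ℝ V] [T2Space M]

/-- In a chart the unit tangent vectors form a compact subset of a space of dimension 2q. Over
non-periodic points the evaluation is onto; over the finitely many periodic points the observations
of `hper` give density by line perturbation. -/
theorem dense_setOf_forall_injective_tder (hinj : Function.Injective 𝒮.map)
    (htmap : ∀ k x, Function.Injective (tmap (q := q) 𝒮.map^[k] x))
    (hspan : Submodule.span ℝ (Set.range 𝒮.coeff) = ⊤)
    (hfin : (Function.periodicPts 𝒮.map).Finite)
    (hper : ∀ x ∈ Function.periodicPts 𝒮.map,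
      ∃ w, Function.Injective (tder (q := q) (𝒮.sync w) x))
    (hdim : 2 * q < Module.finrank ℝ V) :
    Dense {w | ∀ m, Function.Injective (tder (q := q) (𝒮.sync w) m)} := by
  simp_rw [forall_injective_tder_iff]
  refine Finset.dense_setOf_forall_of_isOpen _ _
    (fun c hc => 𝒮.isOpen_setOf_forall_evalChart_ne_zero hc) fun c hc => ?_
  have hd : Dense {w | ∀ x ∈ hfin.toFinset, Function.Injective (tder (q := q) (𝒮.sync w) x)} :=
    Finset.dense_setOf_forall_of_isOpen _ _ (fun x _ => 𝒮.isOpen_setOf_injective_tder x)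
      fun x hx => (𝒮.evalTangent x).dense_setOf_injective (hper x (by simpa using hx))
  refine dense_setOf_forall_ne_zero (Ω := 𝒰.ball c ×ˢ Set.univ)
    (Z₀ := {u | u ∈ 𝒰.core c ∧ (chartAt (EuclideanSpace ℝ (Fin q)) c).symm u ∈
      Function.periodicPts 𝒮.map} ×ˢ Metric.sphere (0 : EuclideanSpace ℝ (Fin q)) 1)
    (by simpa [two_mul] using hdim) (𝒮.evalChart c)
    ((𝒰.isOpen_ball c).prod isOpen_univ) (fun w => 𝒮.contDiffOn_evalChart w hc)
    (fun p hp w => 𝒮.continuousAt_evalChart w hc hp.1)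
    ((𝒰.isCompact_core c).prod (isCompact_sphere _ _))
    (Set.prod_mono (𝒰.core_subset_ball c) (Set.subset_univ _))
    ((𝒰.finite_core_inter hfin c).isCompact.prod (isCompact_sphere _ _))
    (Set.prod_mono (fun u hu => 𝒰.core_subset_ball c hu.1) (Set.subset_univ _)) ?_
    (hd.mono ?_)
  · rintro ⟨u, v⟩ ⟨⟨hu, hv⟩, hn⟩ y
    have hx : (chartAt (EuclideanSpace ℝ (Fin q)) c).symm u ∉ Function.periodicPts 𝒮.map :=
      fun h => hn ⟨⟨hu, h⟩, hv⟩
    refine 𝒮.surjective_evalTangent hinj hspan hx (fun k h0 => ?_) y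
    have h1 := tmap_chart_invFun (𝒰.core_subset_ball c hu) v
    rw [(injective_iff_map_eq_zero _).1 (htmap k _) _ h0, map_zero] at h1
    rw [← h1] at hv
    simp at hv
  · rintro w hw ⟨u, v⟩ ⟨⟨hu, hx⟩, hv⟩
    exact (𝒮.injective_tder_sync_symm_iff_evalChart w (𝒰.core_subset_ball c hu)).1
      (hw _ (by simpa using hx)) v hv

end DelaySeries

end Genericity

/-! ### Injective immersions are open and dense. -/

section Injectivity

variable {q : ℕ} {M : Type*} [TopologicalSpace M] [ChartedSpace (EuclideanSpace ℝ (Fin q)) M]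
  {V : Type*} [NormedAddCommGroup V] [NormedSpace ℝ V]

/-- On the convex set, g - D has Lipschitz constant κ/2, less than the expansion κ of D. -/
theorem eq_of_norm_fderiv_sub_le {E : Type*} [NormedAddCommGroup E] [NormedSpace ℝ E] {g : E → V}
    {s : Set E} (hs : Convex ℝ s) {D : E →L[ℝ] V} {κ : ℝ} (hκ : 0 < κ)
    (hD : ∀ v, κ * ‖v‖ ≤ ‖D v‖) (hg : ∀ u ∈ s, DifferentiableAt ℝ g u)
    (hgD : ∀ u ∈ s, ‖fderiv ℝ g u - D‖ ≤ κ / 2) {x y : E} (hx : x ∈ s) (hy : y ∈ s)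
    (hxy : g x = g y) : x = y := by
  have h1 := hs.norm_image_sub_le_of_norm_hasFDerivWithin_le' (f := g) (f' := fderiv ℝ g) (φ := D)
    (fun u hu => (hg u hu).hasFDerivAt.hasFDerivWithinAt) hgD hx hy
  rw [hxy, sub_self, zero_sub, norm_neg] at h1
  have h2 := hD (y - x)
  have h3 : ‖y - x‖ ≤ 0 := by nlinarith [norm_nonneg (y - x)]
  exact (sub_eq_zero.1 (norm_le_zero_iff.1 h3)).symm

theorem ContinuousLinearMap.exists_pos_mul_norm_le {E : Type*} [NormedAddCommGroup E]
    [NormedSpace ℝ E] [FiniteDimensional ℝ E] {D : E →L[ℝ] V} (hD : Function.Injective D) :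
    ∃ κ : ℝ, 0 < κ ∧ ∀ v, κ * ‖v‖ ≤ ‖D v‖ := by
  obtain ⟨K, hK, hK'⟩ := LinearMap.exists_antilipschitzWith D.toLinearMap
    (LinearMap.ker_eq_bot.2 hD)
  refine ⟨(K : ℝ)⁻¹, by positivity, fun v => ?_⟩
  rw [inv_mul_le_iff₀ (by exact_mod_cast hK)]
  simpa using hK'.le_mul_norm_sub v 0

namespace DelaySeries

variable {𝒰 : ChartCover q M} (𝒮 : DelaySeries 𝒰 V) [IsManifold (𝓡 q) ∞ M] [CompleteSpace V]

/-- Near a point of the diagonal at which the synchronization is immersive, it is injective, also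
for all nearby observations. -/
theorem eventually_diagonal {w₀ : C2Fun q M} {m₀ : M}
    (h : Function.Injective (tder (q := q) (𝒮.sync w₀) m₀)) :
    ∀ᶠ z : C2Fun q M × M × M in 𝓝 (w₀, m₀, m₀),
      𝒮.sync z.1 z.2.1 = 𝒮.sync z.1 z.2.2 → z.2.1 = z.2.2 := by
  obtain ⟨c, hc, hm, hmc⟩ := 𝒰.exists_mem_core m₀
  set e := chartAt (EuclideanSpace ℝ (Fin q)) c with he
  have hu := 𝒰.core_subset_ball c hmc
  rw [← e.left_inv hm, 𝒮.injective_tder_sync_symm_iff w₀ hu] at h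
  obtain ⟨κ, hκ, hD⟩ := ContinuousLinearMap.exists_pos_mul_norm_le h
  have h1 := Metric.tendsto_nhds.1 (𝒮.continuousAt_uncurry_fderiv_sync w₀ hc hu) (κ / 2)
    (half_pos hκ)
  rw [nhds_prod_eq, eventually_prod_iff] at h1
  obtain ⟨Q, hQ, R, hR, h2⟩ := h1
  obtain ⟨ε, hε, hball⟩ := Metric.mem_nhds_iff.1
    (Filter.inter_mem hR ((𝒰.isOpen_ball c).mem_nhds hu))
  have h3 : ∀ᶠ x in 𝓝 m₀, x ∈ e.source ∧ e x ∈ Metric.ball (e m₀) ε :=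
    (e.open_source.eventually_mem hm).and
      ((e.continuousAt hm).eventually_mem (Metric.ball_mem_nhds _ hε))
  rw [nhds_prod_eq, nhds_prod_eq]
  filter_upwards [hQ.prod_mk (h3.prod_mk h3)] with z hz heq
  obtain ⟨hzQ, ⟨hx, hxb⟩, hy, hyb⟩ := hz
  refine e.injOn hx hy ?_
  refine eq_of_norm_fderiv_sub_le (g := fun u => 𝒮.sync z.1 (e.symm u))
    (convex_ball (e m₀) ε) hκ hD (fun u hu => ?_) (fun u hu => ?_) hxb hyb ?_
  · exact (𝒮.hasFDerivAt_sync z.1 hc (hball hu).2).differentiableAt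
  · rw [← dist_eq_norm]
    exact (h2 hzQ (hball hu).1).le
  · rw [e.left_inv hx, e.left_inv hy, heq]

theorem continuous_evalPair :
    Continuous fun z : C2Fun q M × M × M => 𝒮.sync z.1 z.2.1 - 𝒮.sync z.1 z.2.2 :=
  (𝒮.continuous_uncurry_sync.comp (by fun_prop : Continuous fun z : C2Fun q M × M × M =>
    (z.1, z.2.1))).sub (𝒮.continuous_uncurry_sync.comp
      (by fun_prop : Continuous fun z : C2Fun q M × M × M => (z.1, z.2.2)))

/-- Near the diagonal immersivity forces injectivity, uniformly in nearby observations; away from it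
f(x) ≠ f(y) persists. Compactness of M × M joins the two. -/
theorem isOpen_setOf_injective_immersion [CompactSpace M] :
    IsOpen {w | (∀ m, Function.Injective (tder (q := q) (𝒮.sync w) m)) ∧
      Function.Injective (𝒮.sync w)} := by
  rw [isOpen_iff_mem_nhds]
  rintro w₀ ⟨h1, h2⟩
  have h3 : ∀ᶠ w in 𝓝 w₀, ∀ p ∈ (Set.univ : Set (M × M)),
      𝒮.sync w p.1 = 𝒮.sync w p.2 → p.1 = p.2 := by
    refine isCompact_univ.eventually_forall_of_forall_eventually ?_
    rintro ⟨x, y⟩ -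
    by_cases hxy : x = y
    · subst hxy
      exact 𝒮.eventually_diagonal (h1 x)
    · have hne : 𝒮.sync w₀ x - 𝒮.sync w₀ y ≠ 0 := sub_ne_zero.2 (h2.ne hxy)
      filter_upwards [(𝒮.continuous_evalPair.tendsto (w₀, x, y)).eventually_ne hne] with z hz h
      exact absurd (sub_eq_zero.2 h) hz
  filter_upwards [h3, 𝒮.isOpen_setOf_forall_injective_tder.mem_nhds h1] with w hw1 hw2
  exact ⟨hw2, fun x y hxy => hw1 (x, y) trivial hxy⟩

/-- The difference of the values of the synchronization, in the charts around `c` and `d`. -/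
noncomputable def evalPairChart (c d : M) :
    C2Fun q M →ₗ[ℝ] EuclideanSpace ℝ (Fin q) × EuclideanSpace ℝ (Fin q) → V :=
  LinearMap.pi fun p => 𝒮.evalPair ((chartAt (EuclideanSpace ℝ (Fin q)) c).symm p.1)
    ((chartAt (EuclideanSpace ℝ (Fin q)) d).symm p.2)

theorem contDiffOn_evalPairChart (w : C2Fun q M) {c d : M} (hc : c ∈ 𝒰.centers)
    (hd : d ∈ 𝒰.centers) :
    ContDiffOn ℝ 1 (𝒮.evalPairChart c d w) (𝒰.ball c ×ˢ 𝒰.ball d) :=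
  (((𝒮.contDiffOn_sync w hc).of_le one_le_two).comp contDiff_fst.contDiffOn fun _ hp => hp.1).sub
    (((𝒮.contDiffOn_sync w hd).of_le one_le_two).comp contDiff_snd.contDiffOn fun _ hp => hp.2)

theorem continuousAt_evalPairChart (w : C2Fun q M) {c d : M}
    {p : EuclideanSpace ℝ (Fin q) × EuclideanSpace ℝ (Fin q)}
    (hp : p ∈ 𝒰.ball c ×ˢ 𝒰.ball d) :
    ContinuousAt (fun x : C2Fun q M × EuclideanSpace ℝ (Fin q) × EuclideanSpace ℝ (Fin q) =>
      𝒮.evalPairChart c d x.1 x.2) (w, p) := by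
  have h1 : ContinuousAt (fun x : C2Fun q M × EuclideanSpace ℝ (Fin q) × EuclideanSpace ℝ (Fin q) =>
      (x.1, (chartAt (EuclideanSpace ℝ (Fin q)) c).symm x.2.1,
        (chartAt (EuclideanSpace ℝ (Fin q)) d).symm x.2.2)) (w, p) := by
    refine continuousAt_fst.prodMk (ContinuousAt.prodMk ?_ ?_)
    · exact ContinuousAt.comp (g := (chartAt (EuclideanSpace ℝ (Fin q)) c).symm)
        (f := fun x : C2Fun q M × EuclideanSpace ℝ (Fin q) × EuclideanSpace ℝ (Fin q) => x.2.1)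
        ((chartAt (EuclideanSpace ℝ (Fin q)) c).continuousAt_symm
        (𝒰.ball_subset_target c hp.1)) (by fun_prop)
    · exact ContinuousAt.comp (g := (chartAt (EuclideanSpace ℝ (Fin q)) d).symm)
        (f := fun x : C2Fun q M × EuclideanSpace ℝ (Fin q) × EuclideanSpace ℝ (Fin q) => x.2.2)
        ((chartAt (EuclideanSpace ℝ (Fin q)) d).continuousAt_symm
        (𝒰.ball_subset_target d hp.2)) (by fun_prop)
  exact ContinuousAt.comp (f := fun x : C2Fun q M × EuclideanSpace ℝ (Fin q) ×
    EuclideanSpace ℝ (Fin q) => (x.1, (chartAt (EuclideanSpace ℝ (Fin q)) c).symm x.2.1,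
        (chartAt (EuclideanSpace ℝ (Fin q)) d).symm x.2.2)) 𝒮.continuous_evalPair.continuousAt h1

variable [FiniteDimensional ℝ V] [T2Space M]

/-- On the diagonal the difference always vanishes, so a neighbourhood U of it is removed; the
remaining pairs form a compact set of distinct points. -/
theorem isOpen_dense_setOf_evalPairChart_ne_zero (hinj : Function.Injective 𝒮.map)
    (hspan : Submodule.span ℝ (Set.range 𝒮.coeff) = ⊤)
    (hfin : (Function.periodicPts 𝒮.map).Finite)
    (hsep : ∀ x y, x ≠ y → ∃ w, 𝒮.sync w x ≠ 𝒮.sync w y)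
    (hdim : 2 * q < Module.finrank ℝ V) {U : Set (M × M)} (hU : IsOpen U)
    (hdiag : Set.diagonal M ⊆ U) {c d : M} (hc : c ∈ 𝒰.centers) (hd : d ∈ 𝒰.centers) :
    IsOpen {w | ∀ p ∈ 𝒰.core c ×ˢ 𝒰.core d,
      ((chartAt (EuclideanSpace ℝ (Fin q)) c).symm p.1,
        (chartAt (EuclideanSpace ℝ (Fin q)) d).symm p.2) ∉ U → 𝒮.evalPairChart c d w p ≠ 0} ∧
    Dense {w | ∀ p ∈ 𝒰.core c ×ˢ 𝒰.core d,
      ((chartAt (EuclideanSpace ℝ (Fin q)) c).symm p.1,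
        (chartAt (EuclideanSpace ℝ (Fin q)) d).symm p.2) ∉ U → 𝒮.evalPairChart c d w p ≠ 0} := by
  set ec := chartAt (EuclideanSpace ℝ (Fin q)) c
  set ed := chartAt (EuclideanSpace ℝ (Fin q)) d
  let Z : Set (EuclideanSpace ℝ (Fin q) × EuclideanSpace ℝ (Fin q)) :=
    (𝒰.core c ×ˢ 𝒰.core d) ∩ (fun p => (ec.symm p.1, ed.symm p.2)) ⁻¹' Uᶜ
  have hcoreB : 𝒰.core c ×ˢ 𝒰.core d ⊆ 𝒰.ball c ×ˢ 𝒰.ball d :=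
    Set.prod_mono (𝒰.core_subset_ball c) (𝒰.core_subset_ball d)
  have hcont : ContinuousOn (fun p : EuclideanSpace ℝ (Fin q) × EuclideanSpace ℝ (Fin q) =>
      (ec.symm p.1, ed.symm p.2)) (𝒰.core c ×ˢ 𝒰.core d) :=
    ((ec.continuousOn_symm.mono (𝒰.ball_subset_target c)).comp continuousOn_fst
      fun p hp => (hcoreB hp).1).prodMk
      ((ed.continuousOn_symm.mono (𝒰.ball_subset_target d)).comp continuousOn_snd
      fun p hp => (hcoreB hp).2)
  have hcore : IsCompact (𝒰.core c ×ˢ 𝒰.core d) := (𝒰.isCompact_core c).prod (𝒰.isCompact_core d)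
  have hZ : IsCompact Z := hcore.of_isClosed_subset
    (hcont.preimage_isClosed_of_isClosed hcore.isClosed hU.isClosed_compl) Set.inter_subset_left
  have hZB : Z ⊆ 𝒰.ball c ×ˢ 𝒰.ball d := Set.inter_subset_left.trans hcoreB
  have hset : {w | ∀ p ∈ 𝒰.core c ×ˢ 𝒰.core d, (ec.symm p.1, ed.symm p.2) ∉ U →
      𝒮.evalPairChart c d w p ≠ 0} = {w | ∀ p ∈ Z, 𝒮.evalPairChart c d w p ≠ 0} := by
    ext w
    exact ⟨fun h p hp => h p hp.1 hp.2, fun h p hp hpU => h p ⟨hp, hpU⟩⟩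
  rw [hset]
  refine ⟨hZ.isOpen_setOf_forall_ne_zero fun p hp w =>
    𝒮.continuousAt_evalPairChart w (hZB hp), ?_⟩
  -- The pairs of periodic points: finitely many, and the only ones at which the evaluation may fail
  -- to be onto.
  let Z₀ : Set (EuclideanSpace ℝ (Fin q) × EuclideanSpace ℝ (Fin q)) :=
    Z ∩ {u | u ∈ 𝒰.core c ∧ ec.symm u ∈ Function.periodicPts 𝒮.map} ×ˢ
      {u | u ∈ 𝒰.core d ∧ ed.symm u ∈ Function.periodicPts 𝒮.map}
  have hZ₀ : Z₀.Finite := ((𝒰.finite_core_inter hfin c).prod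
    (𝒰.finite_core_inter hfin d)).subset Set.inter_subset_right
  have hne : ∀ p ∈ Z, ec.symm p.1 ≠ ed.symm p.2 := fun p hp h => hp.2 (hdiag h)
  refine dense_setOf_forall_ne_zero (Ω := 𝒰.ball c ×ˢ 𝒰.ball d) (Z₀ := Z₀)
    (by simpa [two_mul] using hdim) (𝒮.evalPairChart c d)
    ((𝒰.isOpen_ball c).prod (𝒰.isOpen_ball d)) (fun w => 𝒮.contDiffOn_evalPairChart w hc hd)
    (fun p hp w => 𝒮.continuousAt_evalPairChart w hp) hZ hZB hZ₀.isCompact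
    (Set.inter_subset_left.trans hZB) ?_ ?_
  · rintro p ⟨hp, hp0⟩ v
    refine 𝒮.surjective_evalPair hinj hspan (hne p hp) ?_ v
    by_contra! h
    exact hp0 ⟨hp, ⟨hp.1.1, h.1⟩, hp.1.2, h.2⟩
  · have := Finset.dense_setOf_forall_of_isOpen hZ₀.toFinset
      (fun p (w : C2Fun q M) => 𝒮.evalPairChart c d w p ≠ 0) (fun p hp => ?_) fun p hp => ?_
    · simpa using this
    · have h1 := (isCompact_singleton (x := p)).isOpen_setOf_forall_ne_zero
        (ev := fun w => 𝒮.evalPairChart c d w) fun p' hp' w => by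
          rw [Set.mem_singleton_iff.1 hp']
          exact 𝒮.continuousAt_evalPairChart w (hZB (hZ₀.mem_toFinset.1 hp).1)
      simpa using h1
    · refine (𝒮.evalPair (ec.symm p.1) (ed.symm p.2)).dense_setOf_apply_ne_zero ?_
      obtain ⟨w, hw⟩ := hsep _ _ (hne p (hZ₀.mem_toFinset.1 hp).1)
      exact ⟨w, sub_ne_zero.2 hw⟩

/-- Immersivity is secured first: an immersive w₀ has a neighbourhood O', and the diagonal a
neighbourhood U, in which no double points occur. Only pairs outside U remain to be separated, by a
generic perturbation inside O'. -/
theorem dense_setOf_injective_immersion [CompactSpace M] (hinj : Function.Injective 𝒮.map)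
    (htmap : ∀ k x, Function.Injective (tmap (q := q) 𝒮.map^[k] x))
    (hspan : Submodule.span ℝ (Set.range 𝒮.coeff) = ⊤)
    (hfin : (Function.periodicPts 𝒮.map).Finite)
    (hper : ∀ x ∈ Function.periodicPts 𝒮.map,
      ∃ w, Function.Injective (tder (q := q) (𝒮.sync w) x))
    (hsep : ∀ x y, x ≠ y → ∃ w, 𝒮.sync w x ≠ 𝒮.sync w y)
    (hdim : 2 * q < Module.finrank ℝ V) :
    Dense {w | (∀ m, Function.Injective (tder (q := q) (𝒮.sync w) m)) ∧
      Function.Injective (𝒮.sync w)} := by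
  rw [dense_iff_inter_open]
  intro O hO hOne
  obtain ⟨w₀, hw₀O, hw₀⟩ := (𝒮.dense_setOf_forall_injective_tder hinj htmap hspan hfin hper
    hdim).inter_open_nonempty O hO hOne
  have hev : ∀ᶠ z : C2Fun q M × M × M in 𝓝ˢ ({w₀} ×ˢ Set.diagonal M),
      𝒮.sync z.1 z.2.1 = 𝒮.sync z.1 z.2.2 → z.2.1 = z.2.2 := by
    rw [Filter.eventually_iff, mem_nhdsSet_iff_forall]
    rintro ⟨w, x, y⟩ ⟨hw, hxy⟩
    obtain rfl : w = w₀ := hw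
    obtain rfl : x = y := hxy
    exact 𝒮.eventually_diagonal (hw₀ x)
  obtain ⟨O', U, hO', hU, hwO', hdU, hsub⟩ :=
    generalized_tube_lemma isCompact_singleton isClosed_diagonal.isCompact isOpen_interior
      (subset_interior_iff_mem_nhdsSet.2 hev)
  have hgood : Dense {w | ∀ cd ∈ 𝒰.centers ×ˢ 𝒰.centers, ∀ p ∈ 𝒰.core cd.1 ×ˢ 𝒰.core cd.2,
      ((chartAt (EuclideanSpace ℝ (Fin q)) cd.1).symm p.1,
        (chartAt (EuclideanSpace ℝ (Fin q)) cd.2).symm p.2) ∉ U →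
          𝒮.evalPairChart cd.1 cd.2 w p ≠ 0} := by
    refine Finset.dense_setOf_forall_of_isOpen _ _ (fun cd hcd => ?_) fun cd hcd => ?_
    · exact (𝒮.isOpen_dense_setOf_evalPairChart_ne_zero hinj hspan hfin hsep hdim hU hdU
        (Finset.mem_product.1 hcd).1 (Finset.mem_product.1 hcd).2).1
    · exact (𝒮.isOpen_dense_setOf_evalPairChart_ne_zero hinj hspan hfin hsep hdim hU hdU
        (Finset.mem_product.1 hcd).1 (Finset.mem_product.1 hcd).2).2
  obtain ⟨w, ⟨⟨hwO, hwO'⟩, hwi⟩, hw⟩ := hgood.inter_open_nonempty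
    (O ∩ O' ∩ {w | ∀ m, Function.Injective (tder (q := q) (𝒮.sync w) m)})
    ((hO.inter hO').inter 𝒮.isOpen_setOf_forall_injective_tder) ⟨w₀, ⟨hw₀O, hwO' rfl⟩, hw₀⟩
  refine ⟨w, hwO, hwi, fun x y hxy => ?_⟩
  by_cases hU' : (x, y) ∈ U
  · exact interior_subset (hsub (Set.mk_mem_prod hwO' hU')) hxy
  · exfalso
    obtain ⟨c, hc, hx, hxc⟩ := 𝒰.exists_mem_core x
    obtain ⟨d, hd, hy, hyd⟩ := 𝒰.exists_mem_core y
    refine hw (c, d) (Finset.mk_mem_product hc hd) (chartAt (EuclideanSpace ℝ (Fin q)) c x,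
      chartAt (EuclideanSpace ℝ (Fin q)) d y) ⟨hxc, hyd⟩ ?_ ?_
    · simpa only [OpenPartialHomeomorph.left_inv _ hx, OpenPartialHomeomorph.left_inv _ hy]
        using hU'
    · simp only [evalPairChart, LinearMap.pi_apply, evalPair_apply,
        OpenPartialHomeomorph.left_inv _ hx, OpenPartialHomeomorph.left_inv _ hy]
      exact sub_eq_zero.2 hxy

end DelaySeries

end Injectivity

/-! ### Linear reservoirs: contraction, series and separation of points. -/

section Reservoir

variable {N : ℕ}

/-- A bound through the entries makes the later rescaling factor a visibly measurable function of
them. -/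
theorem Matrix.exists_norm_toEuclideanCLM_le (N : ℕ) : ∃ B : ℝ, 0 ≤ B ∧
    ∀ A : Matrix (Fin N) (Fin N) ℝ,
      ‖Matrix.toEuclideanCLM (𝕜 := ℝ) A‖ ≤ B * ∑ i, ∑ j, |A i j| := by
  refine ⟨∑ i, ∑ j, ‖Matrix.toEuclideanCLM (𝕜 := ℝ)
    (Matrix.single i j 1 : Matrix (Fin N) (Fin N) ℝ)‖, by positivity, fun A => ?_⟩
  conv_lhs => rw [Matrix.matrix_eq_sum_single A]
  rw [map_sum, Finset.mul_sum]
  refine (norm_sum_le _ _).trans (Finset.sum_le_sum fun i _ => ?_)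
  rw [map_sum, Finset.mul_sum]
  refine (norm_sum_le _ _).trans (Finset.sum_le_sum fun j _ => ?_)
  rw [show Matrix.single i j (A i j) = A i j • (Matrix.single i j 1 : Matrix (Fin N) (Fin N) ℝ) by
    simp, map_smul, norm_smul, Real.norm_eq_abs, mul_comm]
  gcongr
  exact (Finset.single_le_sum (f := fun j => ‖Matrix.toEuclideanCLM (𝕜 := ℝ)
    (Matrix.single i j 1 : Matrix (Fin N) (Fin N) ℝ)‖) (fun _ _ => norm_nonneg _)
    (Finset.mem_univ j)).trans
    (Finset.single_le_sum (f := fun i => ∑ j, ‖Matrix.toEuclideanCLM (𝕜 := ℝ)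
    (Matrix.single i j 1 : Matrix (Fin N) (Fin N) ℝ)‖) (fun _ _ => by positivity)
    (Finset.mem_univ i))

/-- Bounded responses of a contractive linear state map are unique. -/
theorem IsBoundedResponse.unique {M : Type*} {φ : Equiv.Perm M} {w : M → ℝ}
    {A : Matrix (Fin N) (Fin N) ℝ} {C : EuclideanSpace ℝ (Fin N)}
    (hA : ‖Matrix.toEuclideanCLM (𝕜 := ℝ) A‖ < 1) {m : M} {x y : ℤ → EuclideanSpace ℝ (Fin N)}
    (hx : IsBoundedResponse φ w (linearStateMap A C) m x)
    (hy : IsBoundedResponse φ w (linearStateMap A C) m y) : x = y := by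
  obtain ⟨R, hR⟩ := hx.1.exists_norm_le
  obtain ⟨R', hR'⟩ := hy.1.exists_norm_le
  set L := Matrix.toEuclideanCLM (𝕜 := ℝ) A with hL
  have hstep : ∀ t, x t - y t = L (x (t - 1) - y (t - 1)) := by
    intro t
    rw [hx.2 t, hy.2 t, linearStateMap, linearStateMap, map_sub]
    abel
  -- Each step into the past gains a factor ‖L‖, while the distance there stays at most R + R'.
  have hpow : ∀ n : ℕ, ∀ t, ‖x t - y t‖ ≤ ‖L‖ ^ n * (R + R') := by
    intro n
    induction n with
    | zero =>
      intro t
      rw [pow_zero, one_mul]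
      exact (norm_sub_le _ _).trans (add_le_add (hR _ ⟨t, rfl⟩) (hR' _ ⟨t, rfl⟩))
    | succ n ih =>
      intro t
      rw [hstep, pow_succ', mul_assoc]
      exact (L.le_opNorm _).trans (by gcongr; exact ih _)
  ext1 t
  rw [← sub_eq_zero, ← norm_le_zero_iff]
  have hlim : Tendsto (fun n : ℕ => ‖L‖ ^ n * (R + R')) atTop (𝓝 0) := by
    simpa using (tendsto_pow_atTop_nhds_zero_of_lt_one (norm_nonneg L) hA).mul_const (R + R')
  exact ge_of_tendsto' hlim fun n => hpow n t

theorem IsGeneralizedSynchronization.unique {M V : Type*} [NormedAddCommGroup V]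
    {φ : Equiv.Perm M} {w : M → ℝ} {F : V → ℝ → V} {f g : M → V}
    (hf : IsGeneralizedSynchronization φ w F f) (hg : IsGeneralizedSynchronization φ w F g) :
    f = g := by
  ext m
  obtain ⟨x, hx, -⟩ := hf.echoState m
  have h1 := hf.response_eq m x hx 0
  have h2 := hg.response_eq m x hx 0
  simpa using h1.symm.trans h2

variable {q : ℕ} {M : Type*} [TopologicalSpace M] [ChartedSpace (EuclideanSpace ℝ (Fin q)) M]

theorem norm_toEuclideanCLM_pow_apply_le {A : Matrix (Fin N) (Fin N) ℝ} {ε : ℝ}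
    (hA : ‖Matrix.toEuclideanCLM (𝕜 := ℝ) A‖ ≤ ε) (C : EuclideanSpace ℝ (Fin N)) (j : ℕ) :
    ‖Matrix.toEuclideanCLM (𝕜 := ℝ) (A ^ j) C‖ ≤ ε ^ j * ‖C‖ := by
  induction j with
  | zero => simp
  | succ j ih =>
    rw [pow_succ', map_mul, mul_apply_eq_comp, pow_succ', mul_assoc]
    exact (ContinuousLinearMap.le_opNorm _ _).trans
      (mul_le_mul hA ih (norm_nonneg _) ((norm_nonneg _).trans hA))

/-- The series `∑ j, w (φ^{-j} m) • A^j C` of a linear reservoir. -/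
noncomputable def reservoirSeries {𝒰 : ChartCover q M} {h : M → M}
    (hh : ContMDiff (𝓡 q) (𝓡 q) 2 h) {K : ℝ} (hK : 1 ≤ K)
    (hjet : ∀ w : C2Fun q M, ∀ n ≤ 2, ∀ b : ℝ, 𝒰.JetBound n w b →
      ∀ j : ℕ, 𝒰.JetBound n (w ∘ h^[j]) (K ^ j * b))
    {A : Matrix (Fin N) (Fin N) ℝ} (hA : ‖Matrix.toEuclideanCLM (𝕜 := ℝ) A‖ ≤ (3 * K)⁻¹)
    (C : EuclideanSpace ℝ (Fin N)) : DelaySeries 𝒰 (EuclideanSpace ℝ (Fin N)) where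
  map := h
  coeff j := Matrix.toEuclideanCLM (𝕜 := ℝ) (A ^ j) C
  growth := K
  contMDiff_map := hh
  one_le_growth := hK
  jetBound_iterate := hjet
  -- The factor K⁻¹ in the bound on A cancels the growth K^j, and 3⁻¹ leaves a geometric series.
  summable_growth := by
    have hg : Summable fun j : ℕ => (3⁻¹ : ℝ) ^ j * ‖C‖ :=
      (summable_geometric_of_lt_one (by norm_num) (by norm_num)).mul_right _
    refine Summable.of_nonneg_of_le (fun j => by positivity) (fun j => ?_) hg
    have hK0 : K ≠ 0 := by positivity
    calc K ^ j * ‖Matrix.toEuclideanCLM (𝕜 := ℝ) (A ^ j) C‖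
        ≤ K ^ j * ((3 * K)⁻¹ ^ j * ‖C‖) := by
          gcongr
          exact norm_toEuclideanCLM_pow_apply_le hA C j
      _ = 3⁻¹ ^ j * ‖C‖ := by
          rw [← mul_assoc, ← mul_pow, mul_inv, mul_left_comm, mul_inv_cancel₀ hK0, mul_one]

theorem span_range_pow_apply_eq_top {A : Matrix (Fin N) (Fin N) ℝ} {C : EuclideanSpace ℝ (Fin N)}
    (h : IsCyclicForPowers A C) :
    Submodule.span ℝ (Set.range fun j : ℕ => Matrix.toEuclideanCLM (𝕜 := ℝ) (A ^ j) C) = ⊤ := by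
  rw [eq_top_iff, ← (h 1 one_pos).span_eq_top_of_card_eq_finrank' (by simp)]
  refine Submodule.span_mono ?_
  rintro _ ⟨i, rfl⟩
  exact ⟨1 * i, rfl⟩

/-- The constant term dominates a series whose coefficients decay fast enough. -/
theorem tsum_smul_ne_zero_of_norm_le {V : Type*} [NormedAddCommGroup V] [NormedSpace ℝ V]
    [CompleteSpace V] {a : ℕ → V} {ε : ℕ → ℝ} (ha0 : a 0 ≠ 0)
    (ha : ∀ j, ‖a j‖ ≤ 3⁻¹ ^ j * ‖a 0‖) (hε0 : ε 0 = 1) (hε : ∀ j, |ε j| ≤ 1) :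
    ∑' j, ε j • a j ≠ 0 := by
  have hb : ∀ j, ‖ε j • a j‖ ≤ 3⁻¹ ^ j * ‖a 0‖ := fun j => by
    rw [norm_smul]
    exact (mul_le_of_le_one_left (norm_nonneg _) (hε j)).trans (ha j)
  have hg : HasSum (fun j : ℕ => (3⁻¹ : ℝ) ^ j * ‖a 0‖) ((1 - 3⁻¹)⁻¹ * ‖a 0‖) :=
    (hasSum_geometric_of_lt_one (by norm_num) (by norm_num)).mul_right _
  have hs : Summable fun j => ε j • a j := Summable.of_norm_bounded hg.summable hb
  -- With ratio 1/3 the tail is at most half of the constant term; this is the reason for the 3 in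
  -- the bound on A.
  have hg' : HasSum (fun j : ℕ => (3⁻¹ : ℝ) ^ (j + 1) * ‖a 0‖) (2⁻¹ * ‖a 0‖) := by
    have h3 := hg.mul_left 3⁻¹
    rw [← mul_assoc, show (3⁻¹ : ℝ) * (1 - 3⁻¹)⁻¹ = 2⁻¹ by norm_num] at h3
    simpa only [pow_succ', mul_assoc] using h3
  intro h0
  rw [hs.tsum_eq_zero_add, hε0, one_smul] at h0
  have h1 : ‖∑' j, ε (j + 1) • a (j + 1)‖ ≤ 2⁻¹ * ‖a 0‖ :=
    tsum_of_norm_bounded hg' fun j => hb (j + 1)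
  rw [eq_neg_of_add_eq_zero_right h0, norm_neg] at h1
  have := norm_pos_iff.2 ha0
  linarith

/-- Test with the indicator of x itself. The coefficients 1[h^j x = x] - 1[h^j y = x] are bounded by
1, and the one for j = 0 equals 1 because y ≠ x, so the limit vector is non-zero whether or not the
points are periodic. -/
theorem DelaySeries.exists_sync_ne {V : Type*} [NormedAddCommGroup V] [NormedSpace ℝ V]
    [CompleteSpace V] [FiniteDimensional ℝ V] [IsManifold (𝓡 q) ∞ M] [T2Space M]
    {𝒰 : ChartCover q M} (𝒮 : DelaySeries 𝒰 V) (h0 : 𝒮.coeff 0 ≠ 0)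
    (h : ∀ j, ‖𝒮.coeff j‖ ≤ 3⁻¹ ^ j * ‖𝒮.coeff 0‖) {x y : M} (hxy : x ≠ y) :
    ∃ w, 𝒮.sync w x ≠ 𝒮.sync w y := by
  classical
  by_contra! hc
  obtain ⟨w, hw⟩ := 𝒮.indicator_mem_range_evalPair x y x
  have hs : ∀ z : M, Summable fun j =>
      (if 𝒮.map^[j] z = x then (1 : ℝ) else 0) • 𝒮.coeff j := fun z =>
    Summable.of_norm_bounded 𝒮.summable_growth fun j => by
      rw [norm_smul]
      refine (mul_le_of_le_one_left (norm_nonneg _) ?_).trans (𝒮.norm_coeff_le j)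
      split_ifs <;> simp
  rw [evalPair_apply, sub_eq_zero.2 (hc w), ← (hs x).tsum_sub (hs y)] at hw
  simp_rw [← sub_smul] at hw
  refine tsum_smul_ne_zero_of_norm_le h0 h ?_ (fun j => ?_) hw.symm
  · simp [hxy.symm]
  · split_ifs <;> simp

theorem DelaySeries.isC2Embedding_sync_iff {V : Type*} [NormedAddCommGroup V] [NormedSpace ℝ V]
    [CompleteSpace V] [IsManifold (𝓡 q) ∞ M] [CompactSpace M]
    {𝒰 : ChartCover q M} (𝒮 : DelaySeries 𝒰 V) (w : C2Fun q M) :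
    IsC2Embedding (q := q) (𝒮.sync w) ↔
      (∀ m, Function.Injective (tder (q := q) (𝒮.sync w) m)) ∧
        Function.Injective (𝒮.sync w) :=
  ⟨fun h => ⟨h.immersion, h.isEmbedding.injective⟩, fun h => ⟨𝒮.contMDiff_sync w, h.1,
    ((𝒮.contMDiff_sync w).continuous.isClosedEmbedding h.2).isEmbedding⟩⟩

variable [IsManifold (𝓡 q) ∞ M]

theorem isGeneralizedSynchronization_sync {𝒰 : ChartCover q M} {φ : Equiv.Perm M}
    (𝒮 : DelaySeries 𝒰 (EuclideanSpace ℝ (Fin N))) (hmap : 𝒮.map = φ.symm)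
    {A : Matrix (Fin N) (Fin N) ℝ} (hA : ‖Matrix.toEuclideanCLM (𝕜 := ℝ) A‖ < 1)
    {C : EuclideanSpace ℝ (Fin N)}
    (hcoeff : ∀ j, 𝒮.coeff j = Matrix.toEuclideanCLM (𝕜 := ℝ) (A ^ j) C) (w : C2Fun q M) :
    IsGeneralizedSynchronization φ w (linearStateMap A C) (𝒮.sync w) := by
  -- Splitting off the term j = 0 and taking A out of the remaining ones is the recursion of the
  -- state map.
  have hrec : ∀ m, 𝒮.sync w m = linearStateMap A C (𝒮.sync w (φ.symm m)) (w m) := by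
    intro m
    have h1 := (𝒮.hasSum w (φ.symm m)).mapL (Matrix.toEuclideanCLM (𝕜 := ℝ) A)
    have h2 := 𝒮.hasSum w m
    rw [← (𝒮.summable w m).tsum_eq_zero_add.symm.trans h2.tsum_eq, linearStateMap, add_comm,
      ← h1.tsum_eq]
    congr 1
    · refine tsum_congr fun j => ?_
      rw [map_smul, hcoeff, hcoeff, pow_succ', map_mul, Function.iterate_succ_apply, hmap]
      rfl
    · rw [hcoeff]
      simp
  have hresp : ∀ m, IsBoundedResponse φ w (linearStateMap A C) m
      fun t : ℤ => 𝒮.sync w ((φ ^ t) m) := by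
    refine fun m => ⟨?_, fun t => ?_⟩
    · obtain ⟨b, hb⟩ := 𝒰.exists_jetBound w
      rw [isBounded_iff_forall_norm_le]
      refine ⟨b * 𝒮.weight, ?_⟩
      rintro _ ⟨t, rfl⟩
      exact 𝒮.norm_sync_le le_rfl hb _
    · change 𝒮.sync w ((φ ^ t) m) = linearStateMap A C (𝒮.sync w ((φ ^ (t - 1)) m)) _
      rw [hrec ((φ ^ t) m)]
      congr 2
      rw [show φ ^ (t - 1) = φ⁻¹ * φ ^ t by rw [← zpow_neg_one, ← zpow_add]; congr 1; ring]
      rfl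
  refine ⟨fun m => ⟨_, hresp m, fun x hx => hx.unique hA (hresp m)⟩, fun m x hx t => ?_⟩
  rw [hx.unique hA (hresp m)]

end Reservoir

/-! ### Passing between φ and its inverse, and the final assembly. -/

section Diffeomorphism

variable {q : ℕ} {M : Type*} [TopologicalSpace M] [ChartedSpace (EuclideanSpace ℝ (Fin q)) M]
  (φ : M ≃ₘ^2⟮𝓡 q, 𝓡 q⟯ M)

theorem isPeriodicPt_symm_iff (n : ℕ) (m : M) :
    Function.IsPeriodicPt φ.symm n m ↔ Function.IsPeriodicPt φ n m := by
  have h1 : Function.LeftInverse φ^[n] φ.symm^[n] :=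
    Function.LeftInverse.iterate (fun x => φ.apply_symm_apply x) n
  have h2 : Function.LeftInverse φ.symm^[n] φ^[n] :=
    Function.LeftInverse.iterate (fun x => φ.symm_apply_apply x) n
  constructor
  · intro h
    have := h1 m
    rwa [h.eq] at this
  · intro h
    have := h2 m
    rwa [h.eq] at this

theorem periodicPts_symm : Function.periodicPts φ.symm = Function.periodicPts φ := by
  ext m
  simp only [Function.mem_periodicPts, isPeriodicPt_symm_iff]

theorem minimalPeriod_symm (m : M) :
    Function.minimalPeriod φ.symm m = Function.minimalPeriod φ m :=
  Function.minimalPeriod_eq_minimalPeriod_iff.2 fun n => isPeriodicPt_symm_iff φ n m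

theorem injective_tmap_symm_iterate (k : ℕ) (x : M) :
    Function.Injective (tmap (q := q) φ.symm^[k] x) := by
  have h1 : φ^[k] ∘ φ.symm^[k] = id :=
    funext (Function.LeftInverse.iterate (fun x => φ.apply_symm_apply x) k)
  have h2 := tmap_comp (q := q) (m := x) ((φ.contMDiff.iterate k).mdifferentiableAt two_ne_zero)
    ((φ.symm.contMDiff.iterate k).mdifferentiableAt two_ne_zero)
  rw [h1, tmap_id] at h2
  intro u v huv
  have h3 := congrArg (fun L => L u) h2
  have h4 := congrArg (fun L => L v) h2
  simp only [ContinuousLinearMap.comp_apply, ContinuousLinearMap.id_apply] at h3 h4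
  rw [h3, huv, ← h4]

end Diffeomorphism

/-- The deterministic part. The constant K is chosen before (A, C), so the rescaling can be adapted
to each sample. -/
theorem mainTheorem_of_isCyclicForPowers {q : ℕ} {M : Type*} [TopologicalSpace M] [T2Space M]
    [CompactSpace M] [ChartedSpace (EuclideanSpace ℝ (Fin q)) M] [IsManifold (𝓡 q) ∞ M]
    (φ : M ≃ₘ^2⟮𝓡 q, 𝓡 q⟯ M)
    (hfin : (Function.periodicPts φ).Finite)
    (heig : ∀ m ∈ Function.periodicPts φ,
      ((periodDerivative φ m).toLinearMap.charpoly.rootSet ℂ).ncard = q)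
    {N : ℕ} (hN : 2 * q < N) :
    ∃ K : ℝ, 1 ≤ K ∧ ∀ (A : Matrix (Fin N) (Fin N) ℝ) (C : EuclideanSpace ℝ (Fin N)),
      ‖Matrix.toEuclideanCLM (𝕜 := ℝ) A‖ ≤ (3 * K)⁻¹ → IsCyclicForPowers A C →
        (∀ w : ContMDiffMap (𝓡 q) 𝓘(ℝ, ℝ) M ℝ 2, ∃ f : M → EuclideanSpace ℝ (Fin N),
          IsGeneralizedSynchronization φ.toEquiv w (linearStateMap A C) f ∧
          ContMDiff (𝓡 q) 𝓘(ℝ, EuclideanSpace ℝ (Fin N)) 2 f ∧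
          ∀ m : M, HasSum
            (fun j : ℕ => w ((φ.symm)^[j] m) • Matrix.toEuclideanCLM (𝕜 := ℝ) (A ^ j) C) (f m)) ∧
        IsOpen {w : ContMDiffMap (𝓡 q) 𝓘(ℝ, ℝ) M ℝ 2 | ∃ f : M → EuclideanSpace ℝ (Fin N),
          IsGeneralizedSynchronization φ.toEquiv w (linearStateMap A C) f ∧
          IsC2Embedding (q := q) f} ∧
        Dense {w : ContMDiffMap (𝓡 q) 𝓘(ℝ, ℝ) M ℝ 2 | ∃ f : M → EuclideanSpace ℝ (Fin N),
          IsGeneralizedSynchronization φ.toEquiv w (linearStateMap A C) f ∧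
          IsC2Embedding (q := q) f} := by
  obtain ⟨𝒰⟩ := ChartCover.nonempty (q := q) (M := M)
  obtain ⟨K, hK, hjet⟩ := 𝒰.exists_jetBound_iterate φ.symm.contMDiff
  refine ⟨K, hK, fun A C hA hcyc => ?_⟩
  let 𝒮 := reservoirSeries φ.symm.contMDiff hK hjet hA C
  have hcoeff : ∀ j, 𝒮.coeff j = Matrix.toEuclideanCLM (𝕜 := ℝ) (A ^ j) C := fun j => rfl
  have hA3 : ‖Matrix.toEuclideanCLM (𝕜 := ℝ) A‖ ≤ 3⁻¹ :=
    hA.trans (inv_anti₀ (by norm_num) (by linarith))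
  have hgs : ∀ w : C2Fun q M,
      IsGeneralizedSynchronization φ.toEquiv w (linearStateMap A C) (𝒮.sync w) :=
    isGeneralizedSynchronization_sync 𝒮 rfl (hA3.trans_lt (by norm_num)) hcoeff
  have hset : {w : C2Fun q M | ∃ f : M → EuclideanSpace ℝ (Fin N),
      IsGeneralizedSynchronization φ.toEquiv w (linearStateMap A C) f ∧
      IsC2Embedding (q := q) f} = {w | (∀ m, Function.Injective (tder (q := q) (𝒮.sync w) m)) ∧
        Function.Injective (𝒮.sync w)} := by
    ext w
    simp only [Set.mem_ofPred_eq, ← 𝒮.isC2Embedding_sync_iff]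
    constructor
    · rintro ⟨f, hf, hemb⟩
      rwa [← hf.unique (hgs w)]
    · exact fun h => ⟨_, hgs w, h⟩
  refine ⟨fun w => ⟨𝒮.sync w, hgs w, 𝒮.contMDiff_sync w, 𝒮.hasSum w⟩, ?_⟩
  rw [hset]
  refine ⟨𝒮.isOpen_setOf_injective_immersion, ?_⟩
  have hper : Function.periodicPts 𝒮.map = Function.periodicPts φ := periodicPts_symm φ
  have hC0 : 𝒮.coeff 0 = C := by simp [hcoeff]
  have hC : C ≠ 0 := by
    have := (hcyc 1 one_pos).ne_zero ⟨0, by omega⟩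
    simpa using this
  refine 𝒮.dense_setOf_injective_immersion φ.symm.injective (injective_tmap_symm_iterate φ)
    (span_range_pow_apply_eq_top hcyc) (hper ▸ hfin) (fun x hx => ?_)
    (fun x y => 𝒮.exists_sync_ne (by rwa [hC0]) fun j => ?_) (by simpa using hN)
  · have hn : Function.minimalPeriod 𝒮.map x = Function.minimalPeriod φ x := minimalPeriod_symm φ x
    have hn0 := Function.minimalPeriod_pos_of_mem_periodicPts hx
    refine 𝒮.exists_injective_tder_sync (A := Matrix.toEuclideanCLM (𝕜 := ℝ) A) (C := C)
      (fun j => by rw [hcoeff, map_pow]) hx ?_ ?_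
    -- Cyclicity is applied to A^n with n the period of x; the first q of the N independent vectors
    -- are enough.
    · have h1 := (hcyc _ hn0).comp (Fin.castLE (show q ≤ N by omega)) (Fin.castLE_injective _)
      have hfun : (fun i : Fin q => ((Matrix.toEuclideanCLM (𝕜 := ℝ) A ^
          Function.minimalPeriod 𝒮.map x) ^ (i : ℕ)) C) = (fun i : Fin N =>
          Matrix.toEuclideanCLM (𝕜 := ℝ) (A ^ (Function.minimalPeriod 𝒮.map x * (i : ℕ))) C) ∘
          Fin.castLE (show q ≤ N by omega) := by
        ext1 i
        simp only [Function.comp_apply, Fin.val_castLE]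
        rw [map_pow, pow_mul]
      rw [hfun]
      exact h1
    · obtain ⟨g, hg⟩ := LinearMap.exists_cyclic_covector (q := q) (by simp)
        (periodDerivative φ x).toLinearMap (heig x (hper ▸ hx))
      refine ⟨LinearMap.toContinuousLinearMap g, fun u hu => hg u fun i hi => ?_⟩
      rw [← hu i hi, hn, ← ContinuousLinearMap.toLinearMap_pow]
      rfl
  · rw [hC0, hcoeff]
    exact norm_toEuclideanCLM_pow_apply_le hA3 C j

theorem mainTheorem1 {q : ℕ} {M : Type*} [TopologicalSpace M] [T2Space M] [CompactSpace M]
    [ChartedSpace (EuclideanSpace ℝ (Fin q)) M] [IsManifold (𝓡 q) ∞ M]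
    (φ : M ≃ₘ^2⟮𝓡 q, 𝓡 q⟯ M)
    (hfin : (Function.periodicPts φ).Finite)
    -- the (complex) eigenvalues of `T_m φ^{-n}` are `q` distinct numbers
    (heig : ∀ m ∈ Function.periodicPts φ,
      ((periodDerivative φ m).toLinearMap.charpoly.rootSet ℂ).ncard = q)
    (N : ℕ)
    (hN : max (2 * q) (hfin.toFinset.lcm (Function.minimalPeriod φ)) < N)
    {Ω : Type*} [MeasurableSpace Ω] (P : MeasureTheory.Measure Ω)
    [MeasureTheory.IsProbabilityMeasure P]
    (Abar : Ω → Matrix (Fin N) (Fin N) ℝ) (Cbar : Ω → EuclideanSpace ℝ (Fin N))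
    (hAmeas : ∀ i j, Measurable fun s => Abar s i j)
    (hCmeas : ∀ i, Measurable fun s => Cbar s i)
    (hindep : ProbabilityTheory.iIndepFun
      (fun (k : (Fin N × Fin N) ⊕ Fin N) (s : Ω) =>
        Sum.elim (fun p : Fin N × Fin N => Abar s p.1 p.2) (fun i => Cbar s i) k) P)
    (hAreg : ∀ i j, ∀ x : ℝ, P {s | Abar s i j = x} = 0)
    (hCreg : ∀ i, ∀ x : ℝ, P {s | Cbar s i = x} = 0) :
    ∃ a c : Ω → ℝ, Measurable a ∧ Measurable c ∧ (∀ s, 0 < a s) ∧ (∀ s, 0 < c s) ∧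
      ∀ᵐ s ∂P, ∀ (A : Matrix (Fin N) (Fin N) ℝ) (C : EuclideanSpace ℝ (Fin N)),
        A = a s • Abar s → C = c s • Cbar s →
        -- the generalized synchronization exists, is of class `C^2`, and is given by the series
        (∀ w : ContMDiffMap (𝓡 q) 𝓘(ℝ, ℝ) M ℝ 2, ∃ f : M → EuclideanSpace ℝ (Fin N),
          IsGeneralizedSynchronization φ.toEquiv w (linearStateMap A C) f ∧
          ContMDiff (𝓡 q) 𝓘(ℝ, EuclideanSpace ℝ (Fin N)) 2 f ∧
          ∀ m : M, HasSum
            (fun j : ℕ => w ((φ.symm)^[j] m) • Matrix.toEuclideanCLM (𝕜 := ℝ) (A ^ j) C) (f m)) ∧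
        -- for `w` in an open and dense subset of `C^2(M, ℝ)` it is an embedding
        IsOpen {w : ContMDiffMap (𝓡 q) 𝓘(ℝ, ℝ) M ℝ 2 | ∃ f : M → EuclideanSpace ℝ (Fin N),
          IsGeneralizedSynchronization φ.toEquiv w (linearStateMap A C) f ∧
          IsC2Embedding (q := q) f} ∧
        Dense {w : ContMDiffMap (𝓡 q) 𝓘(ℝ, ℝ) M ℝ 2 | ∃ f : M → EuclideanSpace ℝ (Fin N),
          IsGeneralizedSynchronization φ.toEquiv w (linearStateMap A C) f ∧
          IsC2Embedding (q := q) f} := by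
  obtain ⟨K, hK, hmain⟩ := mainTheorem_of_isCyclicForPowers φ hfin heig
    ((le_max_left _ _).trans_lt hN)
  obtain ⟨B, hB, hnorm⟩ := Matrix.exists_norm_toEuclideanCLM_le N
  have hpos : ∀ s, 0 < (3 * K * (1 + B * ∑ i, ∑ j, |Abar s i j|))⁻¹ := fun s => by positivity
  -- The sum bounds the operator norm up to B, so the rescaled matrix has norm at most (3K)⁻¹; the
  -- summand 1 keeps the denominator positive. The input mask needs no rescaling.
  refine ⟨fun s => (3 * K * (1 + B * ∑ i, ∑ j, |Abar s i j|))⁻¹, fun _ => 1, ?_,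
    measurable_const, hpos, fun _ => one_pos, ?_⟩
  · refine (measurable_const.mul (measurable_const.add (measurable_const.mul ?_))).inv
    exact Finset.measurable_sum _ fun i _ => Finset.measurable_sum _ fun j _ => (hAmeas i j).abs
  · filter_upwards [ae_isCyclicForPowers hAmeas hCmeas hindep hAreg hCreg] with s hs A C hA hC
    subst hA hC
    refine hmain _ _ ?_ (hs.smul (hpos s).ne' one_ne_zero)
    have hS : 0 ≤ ∑ i, ∑ j, |Abar s i j| := by positivity
    rw [map_smul, norm_smul, Real.norm_of_nonneg (hpos s).le, mul_inv, mul_assoc]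
    refine mul_le_of_le_one_right (by positivity) ?_
    rw [inv_mul_le_iff₀ (by positivity), mul_one]
    exact (hnorm _).trans (by linarith)
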